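/- **Setting.** Let $n\ge 2$, $\sigma\ge 1$, $\rho_0>0$, $r>0$. Vectors carry the maximum norm $|\cdot|$, matrices the induced operator norm $\|\cdot\|$ (and $|A|$ is the largest modulus of an entry of $A$). Let $U_\rho=\{\theta\in\mathbb C^n:|\operatorname{Im}\theta|<\rho\}$, let $\|f\|_\rho=\sup_{U_\rho}\|f\|$, and let $\langle f\rangle$ be the average of $f$ over $\mathbb T^n=\mathbb R^n/\mathbb Z^n$. Let $\dot z=B(z)\nabla H(z)$ be a generalized Hamiltonian system on a phase space $\mathbf U$ that is an open subset of $\mathbb R^{2n}$ or of $\mathbb T^n\times\mathbb R^n$: $H$ and $B$ are real analytic, $B$ is skew-symmetric and invertible and satisfies the Jacobi identity, and the two-form $\Omega(\xi,\eta)=\langle\xi,B(z)^{-1}\eta\rangle$ is exact on $\mathbf U$, $\Omega=d\alpha$. Let $\mathcal P_\rho$ be the set of maps $K$ on $\overline U_\rho$ with values in the complexified phase space that are continuous, one-periodic in all variables, holomorphic on $U_\rho$, and map real points into $\mathbf U$. Let $K_0\in\mathcal P_{\rho_0}$ and $\mathcal B_r=\{z:\inf_{|\operatorname{Im}\theta|\le\rho_0}|z-K_0(\theta)|<r\}$;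 assume that the real points of $\mathcal B_r$ lie in $\mathbf U$, that $H$ and $B$ extend holomorphically to $\mathcal B_r$, that $B$ is invertible there, and that $\|B\|_{C^2,\mathcal B_r}$, $\|B^{-1}\|_{\mathcal B_r}$, $\|H\|_{C^3,\mathcal B_r}$ are finite. Let $0<\gamma\le 1$ and let $\omega\in\mathbb R^n$ satisfy $|k\cdot\omega|\ge\gamma|k|_1^{-\sigma}$ for all $k\in\mathbb Z^n\setminus\{0\}$; write $\partial_\omega f=Df\,\omega$. For $K\in\mathcal P_\rho$ put $e=F(K)=B(K)\nabla H(K)-\partial_\omega K$, $N=(DK^TDK)^{-1}$, let $A(\theta)$ be the derivative of $z\mapsto B(z)\nabla H(z)$ at $K(\theta)$, and (with $B$, $DB$, $\nabla H$ evaluated at $K(\theta)$, and $DB\,[v]$ the derivative of $B$ in the direction $v$) $$S^0=N\,DK^T\{AB-BA-DB\,[B\nabla H]+B\,DK\,N\,DK^T(A+A^T)\}DK\,N .$$ $K$ is *non-degenerate* on $U_\rho$ if $DK(\theta)^TDK(\theta)$ is invertible for all $\theta\in U_\rho$ and $\langle S^0\rangle$ is invertible. The *quasi-Newton correction* of $K$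 is $\Delta K=DK\,\xi_x+B(K)\,DK\,N\,\xi_y$, where $\xi_x,\xi_y:U_\rho\to\mathbb C^n$ are the one-periodic real analytic functions with $$\partial_\omega\xi_x=S^0\xi_y-p_x,\qquad \partial_\omega\xi_y=-p_y,\qquad \langle\xi_x\rangle=0,$$ $$p_x=N^TDK^T\big(B\,DK\,N\,DK^TB^{-1}-I\big)e,\qquad p_y=-DK^TB^{-1}e .$$ For $0<\delta_0<\min(\rho_0/12,1)$ let $\delta_m=\delta_0 2^{-m}$, $\rho_{m+1}=\rho_m-3\delta_m$. The *quasi-Newton iteration* is $K_{m+1}=K_m+\Delta K_m$ on $\overline U_{\rho_{m+1}}$, where $\Delta K_m$ is the correction of $K_m$ on $U_{\rho_m}$. Write $e_m=F(K_m)$, $\varepsilon_m=\|e_m\|_{\rho_m}$, $r_m=\|K_m-K_0\|_{\rho_m}$, and $N_m$, $S^0_m$ for $N$, $S^0$ at $K=K_m$. For a polynomial $\lambda(y_1,y_2,y_3)$ with nonnegative coefficients let $c(K)=\lambda(\|DK\|_\rho,\|N\|_\rho,|\langle S^0\rangle^{-1}|)$ for $K\in\mathcal P_\rho$, and $c_m=c(K_m)$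 (with $\rho=\rho_m$). The *step conditions* for $K\in\mathcal P_\rho$, $\rho\le\rho_0$, with loss $\delta$ ($0<\delta<1$, $3\delta<\rho$), are: $K$ is non-degenerate on $U_\rho$ and $$\|K-K_0\|_\rho+c(K)\gamma^{-2}\delta^{-2\sigma}\|e\|_\rho<r,\qquad c(K)\gamma^{-2}\delta^{-(2\sigma+1)}\|e\|_\rho\le\tfrac12,$$ the norms $\|DK\|_\rho,\|N\|_\rho,\|e\|_\rho,\|K-K_0\|_\rho$ being finite. **Theorem 5.1.** There is a polynomial $\lambda$ with nonnegative coefficients, depending only on $n,\sigma,r,\rho_0$ and on upper bounds for $\|B\|_{C^2,\mathcal B_r},\|B^{-1}\|_{\mathcal B_r},\|H\|_{C^3,\mathcal B_r}$, with the following two properties. (a) *($\lambda$ gives valid constants for one step.)* Whenever $K\in\mathcal P_\rho$ satisfies the step conditions with loss $\delta$, the correction $\Delta K$ exists, and $K'=K+\Delta K$ (on $\overline U_{\rho-3\delta}$), with error $e'$ and with $N'$, $S^{0\prime}$ in place of $N$, $S^0$, satisfies $$\|\Delta K\|_{\rho-2\delta}\le c(K)\gamma^{-2}\delta^{-2\sigma}\|e\|_\rho,\quad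 \|D\Delta K\|_{\rho-3\delta}\le c(K)\gamma^{-2}\delta^{-(2\sigma+1)}\|e\|_\rho,\quad \|e'\|_{\rho-3\delta}\le c(K)\gamma^{-4}\delta^{-4\sigma}\|e\|_\rho^2,$$ $$\|N'\|_{\rho-3\delta}\le\|N\|_\rho+c(K)\gamma^{-2}\delta^{-(2\sigma+1)}\|e\|_\rho,\quad |\langle S^{0\prime}\rangle^{-1}|\le|\langle S^0\rangle^{-1}|+c(K)\gamma^{-2}\delta^{-(2\sigma+1)}\|e\|_\rho,$$ $K'\in\mathcal P_{\rho-3\delta}$, $K'$ is non-degenerate on $U_{\rho-3\delta}$, and $K'(\overline U_{\rho-3\delta})\subset\mathcal B_r$. (b) There is a constant $c>0$, depending only on $n,\sigma,r,\rho_0$ and on upper bounds for $\|B\|_{C^2,\mathcal B_r}$, $\|B^{-1}\|_{\mathcal B_r}$, $\|H\|_{C^3,\mathcal B_r}$, $\|DK_0\|_{\rho_0}$, $\|N_0\|_{\rho_0}$, $|\langle S_0^0\rangle^{-1}|$ (in particular not on $\gamma$, $\omega$, $\delta_0$), such that: if $K_0$ is non-degenerate on $U_{\rho_0}$ with $\|DK_0\|_{\rho_0},\|N_0\|_{\rho_0}<\infty$,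 and $$\kappa:=2^{4\sigma}c\,\gamma^{-4}\delta_0^{-4\sigma}\|e_0\|_{\rho_0}\le\tfrac12,\tag{5.31}$$ $$\Big[1+\frac{2^{4\sigma}}{2^{2\sigma}-1}\Big]c\,\gamma^{-2}\delta_0^{-2\sigma}\|e_0\|_{\rho_0}<r,\tag{5.32}$$ then the quasi-Newton iteration starting from $K_0$ can be carried out for all $m$, and for every $m\ge1$: $K_{m-1}\in\mathcal P_{\rho_{m-1}}$ maps $\overline U_{\rho_{m-1}}$ into $\mathcal B_r$, the norms $\|DK_{m-1}\|_{\rho_{m-1}},\|N_{m-1}\|_{\rho_{m-1}},\varepsilon_{m-1},r_{m-1}$ are finite, $c_{m-1}\le c$, and $$DK_{m-1}(\theta)^TDK_{m-1}(\theta)\ (\theta\in U_{\rho_{m-1}})\ \text{ and }\ \langle S^0_{m-1}\rangle\ \text{ are invertible},\tag{5.22}$$ $$r_{m-1}+c_{m-1}\gamma^{-2}\delta_{m-1}^{-2\sigma}\varepsilon_{m-1}<r,\tag{5.23}$$ $$c_{m-1}\gamma^{-2}\delta_{m-1}^{-(2\sigma+1)}\varepsilon_{m-1}\le\tfrac12.\tag{5.24}$$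 -/

import Mathlib

open scoped Matrix

/-! Vectors carry the maximum norm (the norm of a function type); a matrix carries the operator
norm that it induces, `‖A‖ = sup |A x| / |x|`, which is the maximal absolute row sum. -/

attribute [local instance] Matrix.linftyOpNormedAddCommGroup Matrix.linftyOpNormedSpace

noncomputable section

namespace QuasiNewton

/-- The real point `t ∈ ℝⁿ` as a point of `ℂⁿ`. -/
def toC {m : ℕ} (t : Fin m → ℝ) : Fin m → ℂ := fun j => (t j : ℂ)

/-- The integer point `k ∈ ℤⁿ` as a point of `ℂⁿ`. -/
def intC {m : ℕ} (k : Fin m → ℤ) : Fin m → ℂ := fun j => (k j : ℂ)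

/-- The open complex strip `U_ρ = {θ ∈ ℂⁿ : |Im θ| < ρ}`, with the maximum norm. -/
def strip (n : ℕ) (ρ : ℝ) : Set (Fin n → ℂ) := {θ | ∀ j, |(θ j).im| < ρ}

/-- The closed complex strip `{θ ∈ ℂⁿ : |Im θ| ≤ ρ}`. -/
def closedStrip (n : ℕ) (ρ : ℝ) : Set (Fin n → ℂ) := {θ | ∀ j, |(θ j).im| ≤ ρ}

/-- `f` is bounded on `U_ρ`. -/
def BddOnStrip {n : ℕ} {E : Type} [Norm E] (ρ : ℝ) (f : (Fin n → ℂ) → E) : Prop :=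
  ∃ C : ℝ, ∀ θ ∈ strip n ρ, ‖f θ‖ ≤ C

/-- `‖f‖_ρ = sup_{θ ∈ U_ρ} ‖f θ‖`; used only for functions that are bounded on `U_ρ`. -/
def stripNorm {n : ℕ} {E : Type} [Norm E] (ρ : ℝ) (f : (Fin n → ℂ) → E) : ℝ :=
  ⨆ θ : strip n ρ, ‖f θ‖

/-- The average `⟨f⟩` over the torus `ℝⁿ / ℤⁿ`. -/
def average {n : ℕ} (f : (Fin n → ℂ) → ℂ) : ℂ :=
  ∫ t in Set.Icc (0 : Fin n → ℝ) 1, f (toC t)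

/-- The average of a matrix-valued function, entry by entry. -/
def matAverage {n p q : ℕ} (f : (Fin n → ℂ) → Matrix (Fin p) (Fin q) ℂ) :
    Matrix (Fin p) (Fin q) ℂ :=
  Matrix.of fun i j => average fun θ => f θ i j

/-- The maximum norm `|A|` of a matrix, the largest absolute value of an entry. -/
def maxNorm {p q : ℕ} (A : Matrix (Fin p) (Fin q) ℂ) : ℝ := ⨆ i, ⨆ j, ‖A i j‖

/-- `ω` is `(γ, σ)`-Diophantine: `|k · ω| ≥ γ |k|₁ ^ (-σ)` for all nonzero integer vectors `k`. -/
def IsDiophantine {n : ℕ} (γ σ : ℝ) (ω : Fin n → ℝ) : Prop :=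
  ∀ k : Fin n → ℤ, k ≠ 0 →
    γ * (∑ j, |(k j : ℝ)|) ^ (-σ) ≤ |∑ j, (k j : ℝ) * ω j|

/-- A generalized Hamiltonian system `dz/dt = B(z) ∇H(z)` on a phase space `U`, which is an open
subset of `ℝ²ⁿ` (`angular = false`) or of `𝕋ⁿ × ℝⁿ` (`angular = true`). In the second case
`U`, `H`, `B` and the one-form are given by their `ℤⁿ`-periodic lifts to `ℝ²ⁿ`. -/
structure System (n : ℕ) where
  angular : Bool
  U : Set (Fin (2 * n) → ℝ)
  H : (Fin (2 * n) → ℝ) → ℝ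
  B : (Fin (2 * n) → ℝ) → Matrix (Fin (2 * n)) (Fin (2 * n)) ℝ
  isOpen_U : IsOpen U
  analytic_H : AnalyticOnNhd ℝ H U
  analytic_B : ∀ i j, AnalyticOnNhd ℝ (fun z => B z i j) U
  /-- periodicity in the angles -/
  periodic : angular = true → ∀ v : Fin (2 * n) → ℤ, (∀ i, n ≤ i.val → v i = 0) → ∀ z ∈ U,
    (z + fun i => (v i : ℝ)) ∈ U ∧ H (z + fun i => (v i : ℝ)) = H z ∧
      B (z + fun i => (v i : ℝ)) = B z
  skew : ∀ z ∈ U, ∀ i j, B z i j = - B z j i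
  /-- the Jacobi identity -/
  jacobi : ∀ z ∈ U, ∀ i j k,
    ∑ l, (fderiv ℝ (fun w => B w i j) z (Pi.single l 1) * B z l k
      + fderiv ℝ (fun w => B w j k) z (Pi.single l 1) * B z l i
      + fderiv ℝ (fun w => B w k i) z (Pi.single l 1) * B z l j) = 0
  invertible : ∀ z ∈ U, IsUnit (B z).det
  /-- the two-form `Ω(ξ, η) = ⟨ξ, B(z)⁻¹ η⟩` is exact, `Ω = dα` for a smooth one-form
  `α = ∑ a_j(z) dz_j` on the phase space -/
  exact : ∃ a : (Fin (2 * n) → ℝ) → (Fin (2 * n) → ℝ),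
    (∀ j, ContDiffOn ℝ (⊤ : ℕ∞) (fun z => a z j) U) ∧
    (angular = true → ∀ v : Fin (2 * n) → ℤ, (∀ i, n ≤ i.val → v i = 0) → ∀ z ∈ U,
      a (z + fun i => (v i : ℝ)) = a z) ∧
    ∀ z ∈ U, ∀ i j, (B z)⁻¹ i j =
      fderiv ℝ (fun w => a w j) z (Pi.single i 1) - fderiv ℝ (fun w => a w i) z (Pi.single j 1)

/-- The lattice by which `ℝ²ⁿ` is divided to obtain the space containing the phase space:
`0` for `ℝ²ⁿ`, and `ℤⁿ × 0` for `𝕋ⁿ × ℝⁿ`. -/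
def System.IsPeriod {n : ℕ} (S : System n) (v : Fin (2 * n) → ℤ) : Prop :=
  if S.angular then ∀ i, n ≤ i.val → v i = 0 else v = 0

/-- `K ∈ 𝒫_ρ`: a map of the closed strip, continuous, holomorphic inside, one-periodic in all its
variables as a map to the (complexified) phase space, and mapping real points into `U`. -/
structure System.MemP {n : ℕ} (S : System n) (ρ : ℝ) (K : (Fin n → ℂ) → (Fin (2 * n) → ℂ)) :
    Prop where
  continuousOn : ContinuousOn K (closedStrip n ρ)
  differentiableOn : DifferentiableOn ℂ K (strip n ρ)
  periodic : ∀ k : Fin n → ℤ, ∃ v, S.IsPeriod v ∧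
    ∀ θ ∈ closedStrip n ρ, K (θ + intC k) = K θ + intC v
  real : ∀ t : Fin n → ℝ, ∃ x ∈ S.U, K (toC t) = toC x

/-- The complex neighbourhood `ℬ_r = {z : inf_{|Im θ| ≤ ρ₀} |z - K₀(θ)| < r}` of the image of `K₀`
(in the angular case: its full preimage in `ℂ²ⁿ`). -/
def System.nbhd {n : ℕ} (S : System n) (ρ₀ r : ℝ) (K₀ : (Fin n → ℂ) → (Fin (2 * n) → ℂ)) :
    Set (Fin (2 * n) → ℂ) :=
  {z | ∃ θ ∈ closedStrip n ρ₀, ∃ v, S.IsPeriod v ∧ ‖z - (K₀ θ + intC v)‖ < r}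

/-- A holomorphic extension of `H` and `B` to a set `D ⊆ ℂ²ⁿ`. -/
structure System.Extension {n : ℕ} (S : System n) (D : Set (Fin (2 * n) → ℂ)) where
  H : (Fin (2 * n) → ℂ) → ℂ
  B : (Fin (2 * n) → ℂ) → Matrix (Fin (2 * n)) (Fin (2 * n)) ℂ
  holo_H : DifferentiableOn ℂ H D
  holo_B : DifferentiableOn ℂ B D
  ext_H : ∀ x ∈ S.U, toC x ∈ D → H (toC x) = (S.H x : ℂ)
  ext_B : ∀ x ∈ S.U, toC x ∈ D → ∀ i j, B (toC x) i j = (S.B x i j : ℂ)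
  periodic : ∀ v, S.IsPeriod v → ∀ z ∈ D, z + intC v ∈ D →
    H (z + intC v) = H z ∧ B (z + intC v) = B z

namespace System.Extension

variable {n : ℕ} {S : System n} {D : Set (Fin (2 * n) → ℂ)} (E : S.Extension D)

/-- `B` is invertible on `D`, and `‖B‖_{C², D} ≤ bB`, `‖B⁻¹‖_D ≤ bI`, `‖H‖_{C³, D} ≤ bH`. -/
structure NormBounds (bB bI bH : ℝ) : Prop where
  bound_B : ∀ j ≤ 2, ∀ z ∈ D, ‖iteratedFDeriv ℂ j E.B z‖ ≤ bB
  invertible : ∀ z ∈ D, IsUnit (E.B z).det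
  bound_inv : ∀ z ∈ D, ‖(E.B z)⁻¹‖ ≤ bI
  bound_H : ∀ j ≤ 3, ∀ z ∈ D, ‖iteratedFDeriv ℂ j E.H z‖ ≤ bH

/-- The gradient `∇H(z)`. -/
def grad (z : Fin (2 * n) → ℂ) : Fin (2 * n) → ℂ := fun j => fderiv ℂ E.H z (Pi.single j 1)

/-- The matrix `DB(z) h`, the derivative of `B` at `z` in the direction `h`. -/
def dirB (z h : Fin (2 * n) → ℂ) : Matrix (Fin (2 * n)) (Fin (2 * n)) ℂ :=
  Matrix.of fun i j => fderiv ℂ (fun w => E.B w i j) z h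

/-- The matrix `Φ(z)`, `Φ_{ik} = ∑_j ∂_k b_{ij} ∂_j H`, so that `Φ(z) h = (DB(z) h) ∇H(z)`. -/
def Phi (z : Fin (2 * n) → ℂ) : Matrix (Fin (2 * n)) (Fin (2 * n)) ℂ :=
  Matrix.of fun i k => ∑ j, E.dirB z (Pi.single k 1) i j * E.grad z j

/-- The Hessian `Ψ(z) = D∇H(z)`. -/
def Psi (z : Fin (2 * n) → ℂ) : Matrix (Fin (2 * n)) (Fin (2 * n)) ℂ :=
  Matrix.of fun i k => fderiv ℂ (fun w => E.grad w i) z (Pi.single k 1)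

end System.Extension

/-- The Jacobian matrix `DK(θ)`. -/
def jac {n p : ℕ} (K : (Fin n → ℂ) → (Fin p → ℂ)) (θ : Fin n → ℂ) : Matrix (Fin p) (Fin n) ℂ :=
  Matrix.of fun i j => fderiv ℂ K θ (Pi.single j 1) i

/-- The derivative `∂_ω K(θ) = DK(θ) ω`. -/
def dω {n p : ℕ} (ω : Fin n → ℝ) (K : (Fin n → ℂ) → (Fin p → ℂ)) (θ : Fin n → ℂ) : Fin p → ℂ :=
  fderiv ℂ K θ (toC ω)

/-- `N(θ) = (DK(θ)ᵀ DK(θ))⁻¹`. -/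
def invGram {n p : ℕ} (K : (Fin n → ℂ) → (Fin p → ℂ)) (θ : Fin n → ℂ) : Matrix (Fin n) (Fin n) ℂ :=
  ((jac K θ)ᵀ * jac K θ)⁻¹

/-- `f` is real analytic on `U_ρ` and one-periodic in all its variables. -/
structure RealAnalyticPeriodic {n p : ℕ} (ρ : ℝ) (f : (Fin n → ℂ) → (Fin p → ℂ)) : Prop where
  differentiableOn : DifferentiableOn ℂ f (strip n ρ)
  periodic : ∀ k : Fin n → ℤ, ∀ θ ∈ strip n ρ, f (θ + intC k) = f θ
  real : ∀ t : Fin n → ℝ, ∃ x : Fin p → ℝ, f (toC t) = toC x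

namespace System.Extension

variable {n : ℕ} {S : System n} {D : Set (Fin (2 * n) → ℂ)} (E : S.Extension D)

/-- The error `e = F(K)`, `e(θ) = B(K(θ)) ∇H(K(θ)) - ∂_ω K(θ)`. -/
def err (ω : Fin n → ℝ) (K : (Fin n → ℂ) → (Fin (2 * n) → ℂ)) (θ : Fin n → ℂ) :
    Fin (2 * n) → ℂ :=
  E.B (K θ) *ᵥ E.grad (K θ) - dω ω K θ

/-- `A(θ) = Φ(K(θ)) + B(K(θ)) Ψ(K(θ))`. -/
def linA (K : (Fin n → ℂ) → (Fin (2 * n) → ℂ)) (θ : Fin n → ℂ) :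
    Matrix (Fin (2 * n)) (Fin (2 * n)) ℂ :=
  E.Phi (K θ) + E.B (K θ) * E.Psi (K θ)

/-- `S⁰ = N DKᵀ {A B - B A - DB·(B∇H) + B DK N DKᵀ (A + Aᵀ)} DK N`. -/
def S0 (K : (Fin n → ℂ) → (Fin (2 * n) → ℂ)) (θ : Fin n → ℂ) : Matrix (Fin n) (Fin n) ℂ :=
  invGram K θ * (jac K θ)ᵀ *
    (E.linA K θ * E.B (K θ) - E.B (K θ) * E.linA K θ
      - E.dirB (K θ) (E.B (K θ) *ᵥ E.grad (K θ))
      + E.B (K θ) * jac K θ * invGram K θ * (jac K θ)ᵀ * (E.linA K θ + (E.linA K θ)ᵀ))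
    * jac K θ * invGram K θ

/-- `K` is non-degenerate on `U_ρ`: `DKᵀ DK` is invertible at every point, and so is the
average `⟨S⁰⟩`. -/
def NonDegenerate (ρ : ℝ) (K : (Fin n → ℂ) → (Fin (2 * n) → ℂ)) : Prop :=
  (∀ θ ∈ strip n ρ, IsUnit ((jac K θ)ᵀ * jac K θ).det) ∧ IsUnit (matAverage (E.S0 K)).det

/-- `s = |⟨S⁰⟩⁻¹|`. -/
def invAvg (K : (Fin n → ℂ) → (Fin (2 * n) → ℂ)) : ℝ := maxNorm (matAverage (E.S0 K))⁻¹

/-- `p_x = Nᵀ DKᵀ (B DK N DKᵀ B⁻¹ - I) e`. -/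
def pX (ω : Fin n → ℝ) (K : (Fin n → ℂ) → (Fin (2 * n) → ℂ)) (θ : Fin n → ℂ) : Fin n → ℂ :=
  ((invGram K θ)ᵀ * (jac K θ)ᵀ *
    (E.B (K θ) * jac K θ * invGram K θ * (jac K θ)ᵀ * (E.B (K θ))⁻¹ - 1)) *ᵥ E.err ω K θ

/-- `p_y = - DKᵀ B⁻¹ e`. -/
def pY (ω : Fin n → ℝ) (K : (Fin n → ℂ) → (Fin (2 * n) → ℂ)) (θ : Fin n → ℂ) : Fin n → ℂ :=
  - (((jac K θ)ᵀ * (E.B (K θ))⁻¹) *ᵥ E.err ω K θ)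

/-- `Δ` is the quasi-Newton correction of `K`, that is, the approximate solution of the linearized
equation `A Δ - ∂_ω Δ = -e`: it equals `M ξ` with `M = (DK, B DK N)`, where `ξ = (ξ_x, ξ_y)`
solves the reduced equation `∂_ω ξ_x = S⁰ ξ_y - p_x`, `∂_ω ξ_y = -p_y` and `⟨ξ_x⟩ = 0`. -/
def IsCorrection (ω : Fin n → ℝ) (ρ : ℝ) (K Δ : (Fin n → ℂ) → (Fin (2 * n) → ℂ)) : Prop :=
  ∃ ξx ξy : (Fin n → ℂ) → (Fin n → ℂ),
    RealAnalyticPeriodic ρ ξx ∧ RealAnalyticPeriodic ρ ξy ∧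
    (∀ θ ∈ strip n ρ, dω ω ξx θ = E.S0 K θ *ᵥ ξy θ - E.pX ω K θ) ∧
    (∀ θ ∈ strip n ρ, dω ω ξy θ = - E.pY ω K θ) ∧
    (∀ j, average (fun θ => ξx θ j) = 0) ∧
    ∀ θ ∈ strip n ρ, Δ θ = jac K θ *ᵥ ξx θ + (E.B (K θ) * jac K θ * invGram K θ) *ᵥ ξy θ

/-- One step of the quasi-Newton method, `K' = K + Δ` on the strip of width `ρ - 3δ`. -/
def IsStep (ω : Fin n → ℝ) (ρ δ : ℝ) (K Δ K' : (Fin n → ℂ) → (Fin (2 * n) → ℂ)) : Prop :=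
  E.IsCorrection ω ρ K Δ ∧ ∀ θ ∈ closedStrip n (ρ - 3 * δ), K' θ = K θ + Δ θ

/-- The constant `λ(‖DK‖_ρ, ‖N‖_ρ, |⟨S⁰⟩⁻¹|)` belonging to `K`. -/
def const (lam : MvPolynomial (Fin 3) ℝ) (ρ : ℝ) (K : (Fin n → ℂ) → (Fin (2 * n) → ℂ)) : ℝ :=
  MvPolynomial.eval ![stripNorm ρ (jac K), stripNorm ρ (invGram K), E.invAvg K] lam

/-- The conditions for a quasi-Newton step from `K`, with loss of width `δ`:
`K` is non-degenerate, `‖K - K₀‖_ρ + C γ⁻² δ^{-2σ} ‖e‖_ρ < r` and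
`C γ⁻² δ^{-(2σ+1)} ‖e‖_ρ ≤ 1/2` for the constant `C` of `K`; all the norms that occur are finite. -/
structure StepConditions (lam : MvPolynomial (Fin 3) ℝ) (σ γ : ℝ) (ω : Fin n → ℝ) (r ρ δ : ℝ)
    (K₀ K : (Fin n → ℂ) → (Fin (2 * n) → ℂ)) : Prop where
  bdd_jac : BddOnStrip ρ (jac K)
  bdd_invGram : BddOnStrip ρ (invGram K)
  bdd_err : BddOnStrip ρ (E.err ω K)
  bdd_sub : BddOnStrip ρ (K - K₀)
  nonDegenerate : E.NonDegenerate ρ K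
  inside : stripNorm ρ (K - K₀)
    + E.const lam ρ K * γ ^ (-2 : ℝ) * δ ^ (-(2 * σ)) * stripNorm ρ (E.err ω K) < r
  small : E.const lam ρ K * γ ^ (-2 : ℝ) * δ ^ (-(2 * σ + 1)) * stripNorm ρ (E.err ω K) ≤ 1 / 2

/-- The estimates for one quasi-Newton step `K' = K + Δ` from `K`, with the constant of `K`. -/
structure StepEstimates (lam : MvPolynomial (Fin 3) ℝ) (σ γ : ℝ) (ω : Fin n → ℝ) (ρ δ : ℝ)
    (K Δ K' : (Fin n → ℂ) → (Fin (2 * n) → ℂ)) : Prop where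
  bdd_Δ : BddOnStrip (ρ - 2 * δ) Δ
  norm_Δ : stripNorm (ρ - 2 * δ) Δ
    ≤ E.const lam ρ K * γ ^ (-2 : ℝ) * δ ^ (-(2 * σ)) * stripNorm ρ (E.err ω K)
  bdd_jac_Δ : BddOnStrip (ρ - 3 * δ) (jac Δ)
  norm_jac_Δ : stripNorm (ρ - 3 * δ) (jac Δ)
    ≤ E.const lam ρ K * γ ^ (-2 : ℝ) * δ ^ (-(2 * σ + 1)) * stripNorm ρ (E.err ω K)
  memP : S.MemP (ρ - 3 * δ) K'
  nonDegenerate : E.NonDegenerate (ρ - 3 * δ) K'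
  mapsTo : Set.MapsTo K' (closedStrip n (ρ - 3 * δ)) D
  bdd_invGram : BddOnStrip (ρ - 3 * δ) (invGram K')
  norm_invGram : stripNorm (ρ - 3 * δ) (invGram K') ≤ stripNorm ρ (invGram K)
    + E.const lam ρ K * γ ^ (-2 : ℝ) * δ ^ (-(2 * σ + 1)) * stripNorm ρ (E.err ω K)
  invAvg_le : E.invAvg K' ≤ E.invAvg K
    + E.const lam ρ K * γ ^ (-2 : ℝ) * δ ^ (-(2 * σ + 1)) * stripNorm ρ (E.err ω K)
  bdd_err : BddOnStrip (ρ - 3 * δ) (E.err ω K')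
  norm_err : stripNorm (ρ - 3 * δ) (E.err ω K')
    ≤ E.const lam ρ K * γ ^ (-4 : ℝ) * δ ^ (-(4 * σ)) * stripNorm ρ (E.err ω K) ^ 2

end System.Extension

/-- `λ` yields valid constants for the quasi-Newton method: it has nonnegative coefficients, and
whenever the conditions for a step hold with the constants given by `λ`, the step can be made and
satisfies the step estimates with these constants. The polynomial may depend only on
`n`, `σ`, `ρ₀`, `r` and the bounds for `‖B‖_{C²}`, `‖B⁻¹‖`, `‖H‖_{C³}` on `ℬ_r`. -/
def IsStepPolynomial (n : ℕ) (σ ρ₀ r bB bI bH : ℝ) (lam : MvPolynomial (Fin 3) ℝ) : Prop :=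
  (∀ a, 0 ≤ lam.coeff a) ∧
  ∀ (S : System n) (K₀ : (Fin n → ℂ) → (Fin (2 * n) → ℂ)), S.MemP ρ₀ K₀ →
  (∀ x, toC x ∈ S.nbhd ρ₀ r K₀ → x ∈ S.U) →
  ∀ E : S.Extension (S.nbhd ρ₀ r K₀), E.NormBounds bB bI bH →
  ∀ (γ : ℝ) (ω : Fin n → ℝ), 0 < γ → γ ≤ 1 → IsDiophantine γ σ ω →
  ∀ ρ δ : ℝ, ρ ≤ ρ₀ → 0 < δ → δ < 1 → 3 * δ < ρ →
  ∀ K : (Fin n → ℂ) → (Fin (2 * n) → ℂ), S.MemP ρ K →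
  E.StepConditions lam σ γ ω r ρ δ K₀ K →
  (∃ Δ, E.IsCorrection ω ρ K Δ) ∧
    ∀ Δ K', E.IsStep ω ρ δ K Δ K' → E.StepEstimates lam σ γ ω ρ δ K Δ K'

/-- `δ_m = δ₀ 2^{-m}`. -/
def deltaSeq (δ₀ : ℝ) (m : ℕ) : ℝ := δ₀ / 2 ^ m

/-- `ρ_{m+1} = ρ_m - 3 δ_m`. -/
def rhoSeq (ρ₀ δ₀ : ℝ) : ℕ → ℝ
  | 0 => ρ₀
  | m + 1 => rhoSeq ρ₀ δ₀ m - 3 * deltaSeq δ₀ m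

/-- `K₀, K₁, K₂, …` is the quasi-Newton iteration that starts from `K₀`. -/
def System.Extension.IsIteration {n : ℕ} {S : System n} {D : Set (Fin (2 * n) → ℂ)}
    (E : S.Extension D) (ω : Fin n → ℝ) (ρ₀ δ₀ : ℝ) (K₀ : (Fin n → ℂ) → (Fin (2 * n) → ℂ))
    (K : ℕ → (Fin n → ℂ) → (Fin (2 * n) → ℂ)) : Prop :=
  K 0 = K₀ ∧
    ∀ m, ∃ Δ, E.IsStep ω (rhoSeq ρ₀ δ₀ m) (deltaSeq δ₀ m) (K m) Δ (K (m + 1))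

end QuasiNewton

end

/-!
# Convergence of a quasi-Newton method for invariant tori of generalized Hamiltonian systems

**One step.** Let `X = DK`, `N = (Xᵀ X)⁻¹`, `e = B ∇H - ∂_ω K`, and let `A` be the derivative of the
vector field along `K`. The right-hand side `p_y` has average zero, because the two-form is exact
and `H ∘ K` is periodic (`average_pY`); the average of `ξ_y` can be chosen such that the equation for
`ξ_x` is solvable, because `⟨S⁰⟩` is invertible. So the reduced equations have a solution
(`HolPeriodic.exists_primitive`, `StepData.exists_isCorrection`). With the loss factor
`ℓ = γ⁻¹ δ^{-σ}`, Rüssmann's estimate (`HolPeriodic.norm_sub_average_le`) gives `|ξ_y| ≲ ℓ ‖e‖` and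
`|ξ_x| ≲ ℓ² ‖e‖`. It is proved in `L²`: Bessel's inequality on the translates of the real torus
bounds the weighted Fourier coefficients of the right-hand side, and the sum of the squares of the
reciprocal small divisors is controlled by their mutual distances (`IsDiophantine.sum_inv_sq_le`).

The correction solves the linearized equation only up to a residual (`residual_eq`), whose terms
are quadratic in the error. Two facts are behind this. The flow of `B ∇H` preserves `B`
(`linA_mul_B`, the Jacobi identity), so that `Xᵀ B⁻¹` annihilates the torsion term. Moreover the
torus is almost isotropic: `Xᵀ B⁻¹ X` is the exterior derivative of `ξ_y` (`lagrange_eq_of_dω`),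
hence `O(ℓ² ‖e‖)`, and therefore the frame `(X, B X N)` has an explicit approximate inverse with a
defect of that order (`frameDefect_eq`). With Taylor's formula the new error is `O(ℓ⁴ ‖e‖²)`
(`StepData.bound_err_new`). The changes of `N` and of `⟨S⁰⟩⁻¹` follow from perturbation of the inverse
(`StepData.invGram_new`, `StepData.matAverage_new`).

All bounds are expressed by powers of one number `Q = β (1 + ‖DK‖ + ‖N‖ + |⟨S⁰⟩⁻¹|)` that dominates
all constants (`PowBound`, `PowClose`); no exponent exceeds `150`, so that the polynomial
`(β (1 + y₁ + y₂ + y₃))^150` serves for every step (`isStepPolynomial`).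

**Iteration.** Let `c` bound this polynomial at data that exceed those of `K₀` by at most one. As
long as the constants stay below `c`, the quantity `2^{4σ} c ℓ_m⁴ ε_m` is at most squared in each
step, and `c ℓ_m² ε_m` and `c ℓ_m² ε_m / δ_m` are at least halved (`scaled_errors_succ`). Their sums
bound the distance to `K₀` and the growth of the data, so that the bound `c` and the step conditions
persist (`IterationInvariant.succ`, `IterationInvariant.stepConditions`).
-/

/-! ### Holomorphic maps of several variables -/

open Metric Filter Topology in
/-- **Cauchy's estimate** for a directional derivative. -/
theorem norm_fderiv_apply_le_of_disc {E F : Type*} [NormedAddCommGroup E] [NormedSpace ℂ E]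
    [NormedAddCommGroup F] [NormedSpace ℂ F] {f : E → F} {x v : E} {R M : ℝ} (hR : 0 < R)
    (hd : ∀ t : ℂ, ‖t‖ ≤ R → DifferentiableAt ℂ f (x + t • v))
    (hM : ∀ t : ℂ, ‖t‖ ≤ R → ‖f (x + t • v)‖ ≤ M) : ‖fderiv ℂ f x v‖ ≤ M / R := by
  have hl : ∀ t : ℂ, HasDerivAt (fun t : ℂ => x + t • v) v t := fun t => by
    simpa using ((hasDerivAt_id t).smul_const v).const_add x
  have h1 : HasDerivAt (fun t : ℂ => f (x + t • v)) (fderiv ℂ f x v) 0 := by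
    have h0 := (hd 0 (by simpa using hR.le)).hasFDerivAt
    have := h0.comp_hasDerivAt 0 (hl 0)
    simpa [Function.comp_def] using this
  rw [← h1.deriv]
  refine Complex.norm_deriv_le_of_forall_mem_sphere_norm_le hR ?_ ?_
  · refine DifferentiableOn.diffContOnCl (fun t ht => ?_)
    rw [closure_ball _ hR.ne'] at ht
    have := (hd t (by simpa using ht)).hasFDerivAt.comp_hasDerivAt t (hl t)
    exact this.differentiableAt.differentiableWithinAt
  · intro t ht
    exact hM t (by simpa using (mem_sphere_zero_iff_norm.1 ht).le)

open Metric Filter Topology in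
/-- **Cauchy's estimate** for the operator norm of the derivative. -/
theorem norm_fderiv_le_of_closedBall {E F : Type*} [NormedAddCommGroup E] [NormedSpace ℂ E]
    [NormedAddCommGroup F] [NormedSpace ℂ F] {f : E → F} {x : E} {R M : ℝ} (hR : 0 < R)
    (hd : ∀ y ∈ closedBall x R, DifferentiableAt ℂ f y)
    (hM : ∀ y ∈ closedBall x R, ‖f y‖ ≤ M) : ‖fderiv ℂ f x‖ ≤ M / R := by
  have hM0 : 0 ≤ M := (norm_nonneg _).trans (hM x (mem_closedBall_self hR.le))
  refine ContinuousLinearMap.opNorm_le_bound _ (by positivity) fun v => ?_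
  rcases eq_or_ne v 0 with rfl | hv
  · simp
  have hv' : 0 < ‖v‖ := norm_pos_iff.2 hv
  have key : ∀ t : ℂ, ‖t‖ ≤ R / ‖v‖ → x + t • v ∈ closedBall x R := fun t ht => by
    rw [mem_closedBall, dist_eq_norm, add_sub_cancel_left, norm_smul]
    rwa [le_div_iff₀ hv'] at ht
  have := norm_fderiv_apply_le_of_disc (f := f) (x := x) (v := v) (div_pos hR hv')
    (fun t ht => hd _ (key t ht)) (fun t ht => hM _ (key t ht))
  refine this.trans (le_of_eq ?_)
  field_simp

open Metric Filter Topology in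
/-- The derivative of a holomorphic map of several variables is continuous: by Cauchy's estimate
the map is locally Lipschitz, and Cauchy's estimate for `f - f (· + h)` then bounds the increment
of the derivative. -/
theorem continuousOn_fderiv_of_differentiableOn {E F : Type*} [NormedAddCommGroup E]
    [NormedSpace ℂ E] [NormedAddCommGroup F] [NormedSpace ℂ F] {f : E → F} {U : Set E}
    (hU : IsOpen U) (hf : DifferentiableOn ℂ f U) : ContinuousOn (fderiv ℂ f) U := by
  intro x hx
  refine ContinuousAt.continuousWithinAt ?_
  have hd : ∀ y ∈ U, DifferentiableAt ℂ f y := fun y hy => hf.differentiableAt (hU.mem_nhds hy)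
  have hcont : ContinuousAt f x := (hd x hx).continuousAt
  have h1 : ∀ᶠ y in 𝓝 x, y ∈ U ∧ ‖f y‖ < ‖f x‖ + 1 :=
    (hU.eventually_mem hx).and
      (hcont.norm.eventually_lt continuousAt_const (by linarith))
  obtain ⟨r', hr', hball'⟩ := Metric.eventually_nhds_iff.1 h1
  obtain ⟨r, rfl⟩ : ∃ r, r' = 4 * r := ⟨r' / 4, by ring⟩
  have hr : 0 < r := by linarith
  set M := ‖f x‖ + 1 with hM
  have hball : ∀ y, dist y x < 4 * r → y ∈ U ∧ ‖f y‖ ≤ M := fun y hy =>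
    ⟨(hball' hy).1, (hball' hy).2.le⟩
  have hM0 : 0 ≤ M := by positivity
  have hfd : ∀ y ∈ ball x (3 * r), ‖fderiv ℂ f y‖ ≤ M / r := fun y hy => by
    have hsub : ∀ z ∈ closedBall y r, dist z x < 4 * r := fun z hz => by
      have := dist_triangle z y x
      rw [mem_ball] at hy; rw [mem_closedBall] at hz; linarith
    exact norm_fderiv_le_of_closedBall hr (fun z hz => hd z (hball z (hsub z hz)).1)
      (fun z hz => (hball z (hsub z hz)).2)
  have hlip : ∀ y ∈ ball x (3 * r), ∀ z ∈ ball x (3 * r), ‖f y - f z‖ ≤ M / r * ‖y - z‖ :=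
    fun y hy z hz => (convex_ball x (3 * r)).norm_image_sub_le_of_norm_fderiv_le (𝕜 := ℂ)
      (fun w hw => hd w (hball w (by rw [mem_ball] at hw; linarith)).1) hfd hz hy
  have hest : ∀ y ∈ ball x r, ‖fderiv ℂ f y - fderiv ℂ f x‖ ≤ M / r * ‖y - x‖ / r := by
    intro y hy
    have hyU : y ∈ U := (hball y (by rw [mem_ball] at hy; linarith)).1
    have hsh : ∀ z ∈ closedBall x r, z + (y - x) ∈ ball x (3 * r) ∧ z ∈ ball x (3 * r) := by
      intro z hz
      rw [mem_closedBall] at hz; rw [mem_ball] at hy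
      refine ⟨?_, by rw [mem_ball]; linarith⟩
      rw [mem_ball, dist_eq_norm]
      rw [dist_eq_norm] at hz hy
      calc ‖z + (y - x) - x‖ = ‖(z - x) + (y - x)‖ := by congr 1; abel
        _ ≤ ‖z - x‖ + ‖y - x‖ := norm_add_le _ _
        _ < 3 * r := by linarith
    have hdz : ∀ z ∈ ball x (3 * r), DifferentiableAt ℂ f z := fun z hz =>
      hd z (hball z (by rw [mem_ball] at hz; linarith)).1
    have hg : ∀ z ∈ closedBall x r, DifferentiableAt ℂ (fun z => f (z + (y - x)) - f z) z :=
      fun z hz => DifferentiableAt.sub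
        ((hdz _ (hsh z hz).1).comp z (differentiableAt_id.add_const _)) (hdz _ (hsh z hz).2)
    have hgb : ∀ z ∈ closedBall x r, ‖(fun z => f (z + (y - x)) - f z) z‖ ≤ M / r * ‖y - x‖ :=
      fun z hz => by
        have := hlip _ (hsh z hz).1 _ (hsh z hz).2
        simpa using this
    have h := norm_fderiv_le_of_closedBall hr hg hgb
    have heq : fderiv ℂ (fun z => f (z + (y - x)) - f z) x = fderiv ℂ f y - fderiv ℂ f x := by
      have hx' : DifferentiableAt ℂ f (x + (y - x)) := by simpa using hd y hyU
      have hx'' : DifferentiableAt ℂ (fun z => f (z + (y - x))) x :=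
        hx'.comp x (differentiableAt_id.add_const _)
      rw [fderiv_fun_sub hx'' (hd x hx), fderiv_comp_add_right]
      simp
    rwa [heq] at h
  have htend : Tendsto (fun y => M / r * ‖y - x‖ / r) (𝓝 x) (𝓝 0) := by
    have : Continuous fun y => M / r * ‖y - x‖ / r := by fun_prop
    simpa using this.tendsto x
  rw [ContinuousAt, tendsto_iff_norm_sub_tendsto_zero]
  refine squeeze_zero' (Eventually.of_forall fun _ => norm_nonneg _) ?_ htend
  filter_upwards [ball_mem_nhds x hr] with y hy using hest y hy

open Metric Filter Topology in
/-- A directional derivative of a holomorphic map of several variables is holomorphic: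
differentiate Cauchy's formula for it under the integral sign. -/
theorem differentiableOn_fderiv_apply {E F : Type*} [NormedAddCommGroup E]
    [NormedSpace ℂ E] [NormedAddCommGroup F] [NormedSpace ℂ F] [CompleteSpace F]
    {f : E → F} {U : Set E} (hU : IsOpen U) (hf : DifferentiableOn ℂ f U) (v : E) :
    DifferentiableOn ℂ (fun x => fderiv ℂ f x v) U := by
  intro x hx
  refine DifferentiableAt.differentiableWithinAt ?_
  have hd : ∀ y ∈ U, DifferentiableAt ℂ f y := fun y hy => hf.differentiableAt (hU.mem_nhds hy)
  have hc := continuousOn_fderiv_of_differentiableOn hU hf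
  have hcx : ContinuousAt (fderiv ℂ f) x := hc.continuousAt (hU.mem_nhds hx)
  have h1 : ∀ᶠ y in 𝓝 x, y ∈ U ∧ ‖fderiv ℂ f y‖ < ‖fderiv ℂ f x‖ + 1 :=
    (hU.eventually_mem hx).and
      (hcx.norm.eventually_lt continuousAt_const (by linarith))
  obtain ⟨r', hr', hball⟩ := Metric.eventually_nhds_iff.1 h1
  set M := ‖fderiv ℂ f x‖ + 1 with hM
  set R : ℝ := r' / (2 * (‖v‖ + 1)) with hR
  have hv1 : 0 < ‖v‖ + 1 := by positivity
  have hRpos : 0 < R := by positivity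
  have hRv : R * ‖v‖ < r' / 2 := by
    have : R * (‖v‖ + 1) = r' / 2 := by rw [hR]; field_simp
    nlinarith
  have hin : ∀ y ∈ ball x (r' / 2), ∀ t : ℂ, ‖t‖ ≤ R → dist (y + t • v) x < r' := by
    intro y hy t ht
    rw [mem_ball, dist_eq_norm] at hy
    rw [dist_eq_norm]
    calc ‖y + t • v - x‖ = ‖(y - x) + t • v‖ := by congr 1; abel
      _ ≤ ‖y - x‖ + ‖t‖ * ‖v‖ := by rw [← norm_smul]; exact norm_add_le _ _
      _ ≤ ‖y - x‖ + R * ‖v‖ := by gcongr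
      _ < r' := by linarith
  have hl : ∀ (y : E) (t : ℂ), HasDerivAt (fun t : ℂ => y + t • v) v t := fun y t => by
    simpa using ((hasDerivAt_id t).smul_const v).const_add y
  -- Cauchy's formula for the directional derivative
  have hcauchy : ∀ y ∈ ball x (r' / 2), fderiv ℂ f y v =
      (2 * Real.pi * Complex.I : ℂ)⁻¹ •
        ∮ z in C(0, R), ((z - 0) ^ 2)⁻¹ • f (y + z • v) := by
    intro y hy
    have hV : IsOpen {t : ℂ | y + t • v ∈ U} := hU.preimage (by fun_prop)
    have := Complex.two_pi_I_inv_smul_circleIntegral_sub_sq_inv_smul_of_differentiable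
      (U := {t : ℂ | y + t • v ∈ U}) hV (c := 0) (w₀ := 0) (R := R)
      (f := fun t => f (y + t • v))
      (fun t ht => (hball (hin y hy t (by simpa using ht))).1)
      (fun t ht => ((hd _ ht).hasFDerivAt.comp_hasDerivAt t
        (hl y t)).differentiableAt.differentiableWithinAt) (mem_ball_self hRpos)
    rw [this]
    have hy0 : DifferentiableAt ℂ f (y + (0 : ℂ) • v) :=
      hd _ (hball (hin y hy 0 (by simpa using hRpos.le))).1
    have h2 := hy0.hasFDerivAt.comp_hasDerivAt (0 : ℂ) (hl y 0)
    have h3 := h2.deriv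
    simp only [zero_smul, add_zero] at h3
    exact h3.symm
  have hev : (fun y => fderiv ℂ f y v) =ᶠ[𝓝 x] fun y => (2 * Real.pi * Complex.I : ℂ)⁻¹ •
        ∮ z in C(0, R), ((z - 0) ^ 2)⁻¹ • f (y + z • v) := by
    filter_upwards [ball_mem_nhds x (half_pos hr')] with y hy using hcauchy y hy
  refine DifferentiableAt.congr_of_eventuallyEq ?_ hev
  refine DifferentiableAt.const_smul ?_ _
  simp only [circleIntegral, sub_zero]
  have hcm : ∀ θ : ℝ, ‖circleMap 0 R θ‖ ≤ R := fun θ => by simp [abs_of_pos hRpos]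
  have hcont1 : Continuous fun θ : ℝ => deriv (circleMap 0 R) θ := by
    simp only [deriv_circleMap]; fun_prop
  have hcont2 : Continuous fun θ : ℝ => ((circleMap 0 R θ) ^ 2)⁻¹ := by
    refine Continuous.inv₀ (by fun_prop) fun θ => ?_
    have := circleMap_ne_center (c := 0) (θ := θ) hRpos.ne'
    exact pow_ne_zero 2 this
  have hfc : ∀ y ∈ ball x (r' / 2), Continuous fun θ : ℝ => f (y + circleMap 0 R θ • v) := by
    intro y hy
    refine hf.continuousOn.comp_continuous (by fun_prop) fun θ =>
      (hball (hin y hy _ (hcm θ))).1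
  refine (intervalIntegral.hasFDerivAt_integral_of_dominated_of_fderiv_le
    (F' := fun y θ => deriv (circleMap 0 R) θ • ((circleMap 0 R θ) ^ 2)⁻¹ •
      fderiv ℂ f (y + circleMap 0 R θ • v))
    (bound := fun θ => ‖deriv (circleMap 0 R) θ‖ * (‖((circleMap 0 R θ) ^ 2)⁻¹‖ * M))
    (ball_mem_nhds x (half_pos hr')) ?_ ?_ ?_ ?_ ?_ ?_).differentiableAt
  · filter_upwards [ball_mem_nhds x (half_pos hr')] with y hy
    exact (hcont1.smul (hcont2.smul (hfc y hy))).aestronglyMeasurable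
  · exact (hcont1.smul (hcont2.smul (hfc x (mem_ball_self (half_pos hr'))))).intervalIntegrable _ _
  · refine Continuous.aestronglyMeasurable (hcont1.smul (hcont2.smul ?_))
    exact hc.comp_continuous (by fun_prop) fun θ =>
      (hball (hin x (mem_ball_self (half_pos hr')) _ (hcm θ))).1
  · refine Eventually.of_forall fun θ _ y hy => ?_
    rw [norm_smul, norm_smul]
    gcongr
    exact (hball (hin y hy _ (hcm θ))).2.le
  · exact (hcont1.norm.mul (hcont2.norm.mul continuous_const)).intervalIntegrable _ _
  · refine Eventually.of_forall fun θ _ y hy => ?_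
    have hy' := (hd _ (hball (hin y hy _ (hcm θ))).1).hasFDerivAt
    have h4 : HasFDerivAt (fun y => f (y + circleMap 0 R θ • v))
        (fderiv ℂ f (y + circleMap 0 R θ • v)) y := by
      simpa [Function.comp_def] using
        hy'.comp y ((hasFDerivAt_id y).add_const (circleMap 0 R θ • v))
    exact (h4.const_smul _).const_smul _

/-- A holomorphic map on an open set of a finite-dimensional space is smooth. -/
theorem contDiffOn_of_differentiableOn_complex {E F : Type*} [NormedAddCommGroup E]
    [NormedSpace ℂ E] [FiniteDimensional ℂ E] [NormedAddCommGroup F] [NormedSpace ℂ F]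
    [CompleteSpace F] {f : E → F} {U : Set E} (hU : IsOpen U) (hf : DifferentiableOn ℂ f U)
    (m : ℕ) : ContDiffOn ℂ m f U := by
  induction m generalizing f with
  | zero => exact contDiffOn_zero.2 hf.continuousOn
  | succ m ih =>
    push_cast
    refine contDiffOn_succ_of_fderiv_apply hf (by simp) fun v => ?_
    refine (ih (differentiableOn_fderiv_apply hU hf v)).congr fun x hx => ?_
    rw [fderivWithin_of_isOpen hU hx]

namespace QuasiNewton

open MeasureTheory Set Filter Topology

/-! ### Periodic functions on `ℝⁿ` and the torus -/

-- The normalized measure on the circle `ℝ / ℤ`, for which Mathlib develops Fourier series.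
attribute [local instance] instMeasureSpaceUnitAddCircle instIsAddHaarMeasureUnitAddCircleVolume
  instIsProbabilityMeasureUnitAddCircleVolume

/-- `φ` is a continuous `ℤⁿ`-periodic function on `ℝⁿ`. -/
structure ContPeriodic {n : ℕ} (φ : (Fin n → ℝ) → ℂ) : Prop where
  cont : Continuous φ
  periodic : ∀ (k : Fin n → ℤ) (t : Fin n → ℝ), φ (t + fun i => (k i : ℝ)) = φ t

/-- The average of `φ` over the unit cube. -/
noncomputable def cubeAvg {n : ℕ} (φ : (Fin n → ℝ) → ℂ) : ℂ := ∫ t in Icc (0 : Fin n → ℝ) 1, φ t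

/-- The exponential `θ ↦ exp (2 π i k · θ)` on `ℂⁿ`. -/
noncomputable def expC {n : ℕ} (k : Fin n → ℤ) (θ : Fin n → ℂ) : ℂ :=
  Complex.exp (2 * Real.pi * Complex.I * ∑ j, (k j : ℂ) * θ j)

/-- The `k`-th Fourier coefficient of a function on the cube. -/
noncomputable def cubeCoeff {n : ℕ} (φ : (Fin n → ℝ) → ℂ) (k : Fin n → ℤ) : ℂ :=
  cubeAvg fun t => φ t * expC (-k) (toC t)

/-- The function on the torus induced by a periodic function. -/
noncomputable def torusLift {n : ℕ} (φ : (Fin n → ℝ) → ℂ) (x : UnitAddTorus (Fin n)) : ℂ :=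
  φ fun i => (AddCircle.equivIoc 1 0 (x i) : ℝ)

section Cube

variable {n : ℕ} {φ ψ : (Fin n → ℝ) → ℂ}

theorem continuous_toC : Continuous (toC : (Fin n → ℝ) → _) :=
  continuous_pi fun j => Complex.continuous_ofReal.comp (continuous_apply j)

theorem expC_periodic (k m : Fin n → ℤ) (θ : Fin n → ℂ) : expC k (θ + intC m) = expC k θ := by
  unfold expC intC
  have : 2 * Real.pi * Complex.I * ∑ j, (k j : ℂ) * (θ + fun j => (m j : ℂ)) j =
      2 * Real.pi * Complex.I * ∑ j, (k j : ℂ) * θ j +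
        (∑ j, k j * m j : ℤ) * (2 * Real.pi * Complex.I) := by
    simp only [Pi.add_apply, mul_add, Finset.sum_add_distrib]
    push_cast
    ring
  rw [this, Complex.exp_add, Complex.exp_int_mul_two_pi_mul_I, mul_one]

theorem expC_add (k : Fin n → ℤ) (θ θ' : Fin n → ℂ) :
    expC k (θ + θ') = expC k θ * expC k θ' := by
  simp only [expC, ← Complex.exp_add, Pi.add_apply, mul_add, Finset.sum_add_distrib]

theorem expC_neg_mul (k : Fin n → ℤ) (θ : Fin n → ℂ) : expC (-k) θ * expC k θ = 1 := by
  simp only [expC, ← Complex.exp_add]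
  rw [← mul_add, ← Finset.sum_add_distrib]
  simp

theorem norm_expC (k : Fin n → ℤ) (θ : Fin n → ℂ) :
    ‖expC k θ‖ = Real.exp (-(2 * Real.pi) * ∑ j, (k j : ℝ) * (θ j).im) := by
  rw [expC, Complex.norm_exp]
  congr 1
  have : 2 * (Real.pi : ℂ) * Complex.I * ∑ j, (k j : ℂ) * θ j
      = ((2 * Real.pi : ℝ) : ℂ) * (Complex.I * ∑ j, (k j : ℂ) * θ j) := by push_cast; ring
  rw [this, Complex.re_ofReal_mul, Complex.I_mul_re, Complex.im_sum]
  simp only [← Complex.ofReal_intCast, Complex.im_ofReal_mul]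
  ring

theorem continuous_expC (k : Fin n → ℤ) : Continuous (expC k) := by
  unfold expC; fun_prop

theorem toC_add_int (t : Fin n → ℝ) (k : Fin n → ℤ) :
    toC (t + fun i => (k i : ℝ)) = toC t + intC k := by
  ext j; simp [toC, intC]

theorem ContPeriodic.mul (hφ : ContPeriodic φ) (hψ : ContPeriodic ψ) :
    ContPeriodic fun t => φ t * ψ t :=
  ⟨hφ.cont.mul hψ.cont, fun k t => by rw [hφ.periodic, hψ.periodic]⟩

theorem contPeriodic_expC (k : Fin n → ℤ) : ContPeriodic fun t => expC k (toC t) :=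
  ⟨(continuous_expC k).comp continuous_toC, fun m t => by rw [toC_add_int, expC_periodic]⟩

theorem torusLift_coe (hφ : ContPeriodic φ) (t : Fin n → ℝ) :
    torusLift φ (fun i => (t i : UnitAddCircle)) = φ t := by
  unfold torusLift
  have h : ∀ i, ∃ m : ℤ,
      (AddCircle.equivIoc 1 0 (t i : UnitAddCircle) : ℝ) = t i + m := fun i => by
    have h1 : ((AddCircle.equivIoc 1 0 (t i : UnitAddCircle) : ℝ) : UnitAddCircle) = t i :=
      (AddCircle.equivIoc 1 0).symm_apply_apply _
    rw [← sub_eq_zero, ← AddCircle.coe_sub, AddCircle.coe_eq_zero_iff] at h1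
    obtain ⟨m, hm⟩ := h1
    exact ⟨m, by simp at hm; linarith⟩
  choose m hm using h
  have : (fun i => (AddCircle.equivIoc 1 0 (t i : UnitAddCircle) : ℝ)) =
      t + fun i => (m i : ℝ) := by
    ext i; simpa using hm i
  rw [this, hφ.periodic]

theorem continuous_torusLift (hφ : ContPeriodic φ) : Continuous (torusLift φ) := by
  have hq : IsOpenQuotientMap
      (Pi.map fun (_ : Fin n) (x : ℝ) => (x : UnitAddCircle)) :=
    IsOpenQuotientMap.piMap fun _ => QuotientAddGroup.isOpenQuotientMap_mk
  rw [hq.isQuotientMap.continuous_iff]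
  convert hφ.cont using 1
  ext t
  exact torusLift_coe hφ t

theorem setIntegral_Ioc_eq_cubeAvg (φ : (Fin n → ℝ) → ℂ) :
    ∫ x in {x : Fin n → ℝ | ∀ i, x i ∈ Ioc ((0 : Fin n → ℝ) i) ((0 : Fin n → ℝ) i + 1)}, φ x =
      cubeAvg φ := by
  unfold cubeAvg
  have h : {x : Fin n → ℝ | ∀ i, x i ∈ Ioc ((0 : Fin n → ℝ) i) ((0 : Fin n → ℝ) i + 1)} =
      Set.univ.pi fun i => Ioc ((0 : Fin n → ℝ) i) ((1 : Fin n → ℝ) i) := by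
    ext x; simp
  rw [h]
  exact setIntegral_congr_set Measure.univ_pi_Ioc_ae_eq_Icc

theorem integral_torusLift (hφ : ContPeriodic φ) : ∫ x, torusLift φ x = cubeAvg φ := by
  rw [UnitAddTorus.integral_preimage _ 0, ← setIntegral_Ioc_eq_cubeAvg φ]
  simp only [torusLift_coe hφ]

/-- The average over the cube of a periodic function is translation invariant. -/
theorem cubeAvg_translate (hφ : ContPeriodic φ) (s : Fin n → ℝ) :
    cubeAvg (fun t => φ (t + s)) = cubeAvg φ := by
  have hφs : ContPeriodic fun t => φ (t + s) :=
    ⟨hφ.cont.comp (continuous_add_const s), fun k t => by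
      rw [add_right_comm, hφ.periodic]⟩
  rw [← integral_torusLift hφ, ← integral_torusLift hφs,
    ← integral_add_right_eq_self (torusLift φ) (fun i => (s i : UnitAddCircle))]
  congr 1
  ext x
  obtain ⟨t, rfl⟩ : ∃ t : Fin n → ℝ, (fun i => (t i : UnitAddCircle)) = x := by
    choose t ht using fun i => QuotientAddGroup.mk_surjective (x i)
    exact ⟨t, funext ht⟩
  rw [torusLift_coe hφs, ← torusLift_coe hφ]
  congr 1

theorem mFourier_coe (k : Fin n → ℤ) (t : Fin n → ℝ) :
    UnitAddTorus.mFourier k (fun i => (t i : UnitAddCircle)) = expC k (toC t) := by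
  change ∏ i, fourier (k i) (t i : UnitAddCircle) = _
  simp only [fourier_coe_apply, ← Complex.exp_sum, expC, toC, Finset.mul_sum]
  congr 1
  refine Finset.sum_congr rfl fun i _ => ?_
  push_cast
  ring

theorem mFourierCoeff_torusLift (hφ : ContPeriodic φ) (k : Fin n → ℤ) :
    UnitAddTorus.mFourierCoeff (torusLift φ) k = cubeCoeff φ k := by
  rw [UnitAddTorus.mFourierCoeff_eq_integral _ _ 0, cubeCoeff, ← setIntegral_Ioc_eq_cubeAvg]
  simp only [torusLift_coe hφ, mFourier_coe, smul_eq_mul, mul_comm]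

/-- Fourier inversion for a continuous periodic function with summable coefficients. -/
theorem hasSum_cubeCoeff (hφ : ContPeriodic φ) (hs : Summable (cubeCoeff φ)) (t : Fin n → ℝ) :
    HasSum (fun k => cubeCoeff φ k * expC k (toC t)) (φ t) := by
  have h := UnitAddTorus.hasSum_mFourier_series_apply_of_summable
    (f := ⟨torusLift φ, continuous_torusLift hφ⟩)
    (by
      change Summable (UnitAddTorus.mFourierCoeff (torusLift φ))
      simpa only [funext (mFourierCoeff_torusLift hφ)] using hs)
    (fun i => (t i : UnitAddCircle))
  simp only [ContinuousMap.coe_mk, mFourierCoeff_torusLift hφ, mFourier_coe, smul_eq_mul,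
    torusLift_coe hφ] at h
  exact h

theorem norm_torusLift_le {M : ℝ} (hM : ∀ t, ‖φ t‖ ≤ M) (x : UnitAddTorus (Fin n)) :
    ‖torusLift φ x‖ ≤ M := hM _

/-- Bessel's inequality. -/
theorem summable_sq_cubeCoeff (hφ : ContPeriodic φ) {M : ℝ} (hM : ∀ t, ‖φ t‖ ≤ M) :
    Summable (fun k => ‖cubeCoeff φ k‖ ^ 2) ∧ ∑' k, ‖cubeCoeff φ k‖ ^ 2 ≤ M ^ 2 := by
  set F : C(UnitAddTorus (Fin n), ℂ) := ⟨torusLift φ, continuous_torusLift hφ⟩ with hF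
  have h := UnitAddTorus.hasSum_sq_mFourierCoeff (F.toLp 2 volume ℂ)
  simp only [UnitAddTorus.mFourierCoeff_toLp] at h
  have h' : HasSum (fun k => ‖cubeCoeff φ k‖ ^ 2)
      (∫ x, ‖(F.toLp 2 volume ℂ : UnitAddTorus (Fin n) → ℂ) x‖ ^ 2) := by
    refine h.congr_fun fun k => ?_
    rw [← mFourierCoeff_torusLift hφ]
    rfl
  refine ⟨h'.summable, ?_⟩
  rw [h'.tsum_eq]
  have hae := ContinuousMap.coeFn_toLp (p := 2) (𝕜 := ℂ)
    (volume : Measure (UnitAddTorus (Fin n))) F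
  have heq : ∫ x, ‖(F.toLp 2 volume ℂ : UnitAddTorus (Fin n) → ℂ) x‖ ^ 2 =
      ∫ x, ‖F x‖ ^ 2 := integral_congr_ae (by filter_upwards [hae] with x hx; rw [hx])
  rw [heq]
  calc ∫ x, ‖F x‖ ^ 2 ≤ ∫ x : UnitAddTorus (Fin n), M ^ 2 := by
        refine integral_mono_of_nonneg (Eventually.of_forall fun _ => by positivity)
          (integrable_const _) (Eventually.of_forall fun x => ?_)
        exact pow_le_pow_left₀ (norm_nonneg _) (norm_torusLift_le hM x) 2
    _ = M ^ 2 := by simp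

theorem ContPeriodic.exists_bound (hφ : ContPeriodic φ) : ∃ M, ∀ t, ‖φ t‖ ≤ M := by
  obtain ⟨M, hM⟩ := isCompact_univ.exists_bound_of_continuousOn
    (continuous_torusLift hφ).continuousOn
  exact ⟨M, fun t => by rw [← torusLift_coe hφ]; exact hM _ (mem_univ _)⟩

theorem integrableOn_unitCube (hφ : Continuous φ) :
    IntegrableOn φ (Icc (0 : Fin n → ℝ) 1) :=
  hφ.continuousOn.integrableOn_compact isCompact_Icc

theorem volume_unitCube : (volume : Measure (Fin n → ℝ)).real (Icc (0 : Fin n → ℝ) 1) = 1 := by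
  rw [Measure.real, Real.volume_Icc_pi]
  simp

theorem cubeAvg_const (c : ℂ) : cubeAvg (fun _ : Fin n → ℝ => c) = c := by
  rw [cubeAvg, setIntegral_const, volume_unitCube, one_smul]

theorem cubeAvg_sub (hφ : Continuous φ) (hψ : Continuous ψ) :
    cubeAvg (fun t => φ t - ψ t) = cubeAvg φ - cubeAvg ψ :=
  integral_sub (integrableOn_unitCube hφ) (integrableOn_unitCube hψ)

theorem cubeAvg_mul_const (c : ℂ) : cubeAvg (fun t => φ t * c) = cubeAvg φ * c :=
  integral_mul_const c _

theorem cubeAvg_const_mul (c : ℂ) : cubeAvg (fun t => c * φ t) = c * cubeAvg φ :=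
  integral_const_mul c _

theorem norm_cubeAvg_le {M : ℝ} (hM : ∀ t, ‖φ t‖ ≤ M) : ‖cubeAvg φ‖ ≤ M := by
  have := norm_setIntegral_le_of_norm_le_const (μ := volume) (s := Icc (0 : Fin n → ℝ) 1)
    (f := φ) (C := M) isCompact_Icc.measure_lt_top (fun t _ => hM t)
  rwa [volume_unitCube, mul_one] at this

/-- The average of a directional derivative of a periodic function vanishes. -/
theorem cubeAvg_deriv_eq_zero (hφ : ContPeriodic φ) (hψ : ContPeriodic ψ) (v : Fin n → ℝ)
    (h : ∀ t, HasDerivAt (fun s : ℝ => φ (t + s • v)) (ψ t) 0) : cubeAvg ψ = 0 := by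
  obtain ⟨M, hM⟩ := hψ.exists_bound
  have hd : ∀ (t : Fin n → ℝ) (s : ℝ),
      HasDerivAt (fun s : ℝ => φ (t + s • v)) (ψ (t + s • v)) s := fun t s => by
    have h1 := h (t + s • v)
    rw [← sub_self s] at h1
    have h2 := h1.comp_sub_const s s
    refine h2.congr_of_eventuallyEq (Eventually.of_forall fun s' => ?_)
    change φ _ = φ _
    congr 1
    module
  have hI := (hasDerivAt_integral_of_dominated_loc_of_deriv_le
    (μ := volume.restrict (Icc (0 : Fin n → ℝ) 1)) (F := fun s t => φ (t + s • v))
    (F' := fun s t => ψ (t + s • v)) (x₀ := (0 : ℝ)) (s := univ) (bound := fun _ => M)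
    univ_mem (Eventually.of_forall fun s =>
      (hφ.cont.comp (continuous_add_const _)).aestronglyMeasurable)
    (integrableOn_unitCube (hφ.cont.comp (continuous_add_const _)))
    (hψ.cont.comp (continuous_add_const _)).aestronglyMeasurable
    (Eventually.of_forall fun t s _ => hM _)
    (continuous_const.continuousOn.integrableOn_compact isCompact_Icc)
    (Eventually.of_forall fun t s _ => hd t s)).2
  have hconst : (fun s : ℝ => ∫ t in Icc (0 : Fin n → ℝ) 1, φ (t + s • v)) =
      fun _ => cubeAvg φ := by
    ext s; exact cubeAvg_translate hφ (s • v)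
  rw [hconst] at hI
  have := hI.unique (hasDerivAt_const _ _)
  simpa [cubeAvg] using this

end Cube

end QuasiNewton

namespace QuasiNewton

open MeasureTheory Set Filter Topology

/-! ### Periodic holomorphic functions on a complex strip -/

/-- `g` is holomorphic on `U_ρ` and one-periodic in all its variables. -/
structure HolPeriodic {n : ℕ} (ρ : ℝ) (g : (Fin n → ℂ) → ℂ) : Prop where
  diff : DifferentiableOn ℂ g (strip n ρ)
  periodic : ∀ k : Fin n → ℤ, ∀ θ ∈ strip n ρ, g (θ + intC k) = g θ

/-- The `k`-th Fourier coefficient of the restriction of `g` to `ℝⁿ`. -/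
noncomputable def fcoeff {n : ℕ} (g : (Fin n → ℂ) → ℂ) (k : Fin n → ℤ) : ℂ :=
  cubeCoeff (fun t => g (toC t)) k

/-- The `ℓ¹` norm of an integer vector. -/
def degree {n : ℕ} (k : Fin n → ℤ) : ℕ := ∑ j, (k j).natAbs

section Strip

variable {n : ℕ} {ρ : ℝ} {g h : (Fin n → ℂ) → ℂ}

theorem isOpen_strip (n : ℕ) (ρ : ℝ) : IsOpen (strip n ρ) := by
  have : strip n ρ = ⋂ j, {θ : Fin n → ℂ | |(θ j).im| < ρ} := by ext; simp [strip]
  rw [this]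
  exact isOpen_iInter_of_finite fun j => isOpen_lt (by fun_prop) continuous_const

theorem strip_mono {ρ' : ℝ} (h : ρ' ≤ ρ) : strip n ρ' ⊆ strip n ρ :=
  fun _ hθ j => (hθ j).trans_le h

theorem closedStrip_subset_strip {ρ' : ℝ} (h : ρ' < ρ) : closedStrip n ρ' ⊆ strip n ρ :=
  fun _ hθ j => (hθ j).trans_lt h

theorem strip_subset_closedStrip {ρ' : ℝ} (h : ρ' ≤ ρ) : strip n ρ' ⊆ closedStrip n ρ :=
  fun _ hθ j => ((hθ j).trans_le h).le

theorem toC_mem_strip (hρ : 0 < ρ) (t : Fin n → ℝ) : toC t ∈ strip n ρ :=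
  fun j => by simpa [toC] using hρ

theorem add_intC_mem_strip (k : Fin n → ℤ) {θ : Fin n → ℂ} :
    θ + intC k ∈ strip n ρ ↔ θ ∈ strip n ρ := by
  simp [strip, intC]

theorem add_intC_mem_closedStrip (k : Fin n → ℤ) {θ : Fin n → ℂ} :
    θ + intC k ∈ closedStrip n ρ ↔ θ ∈ closedStrip n ρ := by
  simp [closedStrip, intC]

theorem toC_add_I_mem_strip (t η : Fin n → ℝ) :
    toC t + Complex.I • toC η ∈ strip n ρ ↔ ∀ j, |η j| < ρ := by
  simp [strip, toC]

theorem eq_toC_add_I (θ : Fin n → ℂ) :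
    θ = toC (fun j => (θ j).re) + Complex.I • toC (fun j => (θ j).im) := by
  ext j
  simp [toC, mul_comm Complex.I, Complex.re_add_im]

theorem toC_add (s t : Fin n → ℝ) : toC (s + t) = toC s + toC t := by
  ext j; simp [toC]

theorem toC_smul (s : ℝ) (t : Fin n → ℝ) : toC (s • t) = (s : ℂ) • toC t := by
  ext j; simp [toC]

theorem degree_cast (k : Fin n → ℤ) : (degree k : ℝ) = ∑ j, |(k j : ℝ)| := by
  simp [degree, Nat.cast_natAbs]

theorem norm_expC_le {ρ' : ℝ} (k : Fin n → ℤ) {θ : Fin n → ℂ} (hθ : θ ∈ closedStrip n ρ') :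
    ‖expC k θ‖ ≤ Real.exp (2 * Real.pi * ρ' * degree k) := by
  rw [norm_expC, Real.exp_le_exp, degree_cast, mul_assoc (2 * Real.pi), neg_mul, ← mul_neg,
    Finset.mul_sum, ← Finset.sum_neg_distrib]
  refine mul_le_mul_of_nonneg_left (Finset.sum_le_sum fun j _ => ?_) (by positivity)
  calc -((k j : ℝ) * (θ j).im) ≤ |(k j : ℝ) * (θ j).im| := neg_le_abs _
    _ = |(k j : ℝ)| * |(θ j).im| := abs_mul _ _
    _ ≤ |(k j : ℝ)| * ρ' := mul_le_mul_of_nonneg_left (hθ j) (abs_nonneg _)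
    _ = ρ' * |(k j : ℝ)| := mul_comm _ _

theorem hasFDerivAt_expC (k : Fin n → ℤ) (θ : Fin n → ℂ) :
    HasFDerivAt (expC k) (expC k θ • ((2 * Real.pi * Complex.I : ℂ) •
      ∑ j, (k j : ℂ) • ContinuousLinearMap.proj (R := ℂ) (φ := fun _ : Fin n => ℂ) j)) θ := by
  have h1 : HasFDerivAt (fun θ : Fin n → ℂ => ∑ j, (k j : ℂ) * θ j)
      (∑ j, (k j : ℂ) • ContinuousLinearMap.proj (R := ℂ) (φ := fun _ : Fin n => ℂ) j) θ :=
    HasFDerivAt.fun_sum fun j _ => (hasFDerivAt_apply j θ).const_mul (k j : ℂ)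
  exact (h1.const_mul (2 * Real.pi * Complex.I : ℂ)).cexp

theorem HolPeriodic.mul (hg : HolPeriodic ρ g) (hh : HolPeriodic ρ h) :
    HolPeriodic ρ fun θ => g θ * h θ :=
  ⟨hg.diff.mul hh.diff, fun k θ hθ => by rw [hg.periodic k θ hθ, hh.periodic k θ hθ]⟩

theorem HolPeriodic.add (hg : HolPeriodic ρ g) (hh : HolPeriodic ρ h) :
    HolPeriodic ρ fun θ => g θ + h θ :=
  ⟨hg.diff.add hh.diff, fun k θ hθ => by rw [hg.periodic k θ hθ, hh.periodic k θ hθ]⟩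

theorem HolPeriodic.sub (hg : HolPeriodic ρ g) (hh : HolPeriodic ρ h) :
    HolPeriodic ρ fun θ => g θ - h θ :=
  ⟨hg.diff.sub hh.diff, fun k θ hθ => by rw [hg.periodic k θ hθ, hh.periodic k θ hθ]⟩

theorem HolPeriodic.neg (hg : HolPeriodic ρ g) : HolPeriodic ρ fun θ => -g θ :=
  ⟨hg.diff.neg, fun k θ hθ => by rw [hg.periodic k θ hθ]⟩

theorem holPeriodic_const (c : ℂ) : HolPeriodic (n := n) ρ fun _ => c :=
  ⟨differentiableOn_const c, fun _ _ _ => rfl⟩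

theorem HolPeriodic.mono {ρ' : ℝ} (hg : HolPeriodic ρ g) (h : ρ' ≤ ρ) : HolPeriodic ρ' g :=
  ⟨hg.diff.mono (strip_mono h), fun k θ hθ => hg.periodic k θ (strip_mono h hθ)⟩

theorem HolPeriodic.congr (hg : HolPeriodic ρ g) (hgh : ∀ θ ∈ strip n ρ, h θ = g θ) :
    HolPeriodic ρ h :=
  ⟨hg.diff.congr hgh, fun k θ hθ => by
    rw [hgh _ hθ, hgh _ ((add_intC_mem_strip k).2 hθ), hg.periodic k θ hθ]⟩

theorem HolPeriodic.sum {ι : Type*} {s : Finset ι} {g : ι → (Fin n → ℂ) → ℂ}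
    (hg : ∀ i ∈ s, HolPeriodic ρ (g i)) : HolPeriodic ρ fun θ => ∑ i ∈ s, g i θ :=
  ⟨DifferentiableOn.fun_sum fun i hi => (hg i hi).diff, fun k θ hθ =>
    Finset.sum_congr rfl fun i hi => (hg i hi).periodic k θ hθ⟩

theorem HolPeriodic.prod {ι : Type*} {s : Finset ι} {g : ι → (Fin n → ℂ) → ℂ}
    (hg : ∀ i ∈ s, HolPeriodic ρ (g i)) : HolPeriodic ρ fun θ => ∏ i ∈ s, g i θ := by
  classical
  induction s using Finset.induction_on with
  | empty => simpa using holPeriodic_const 1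
  | insert i s hi ih =>
    simp only [Finset.prod_insert hi]
    exact (hg i (Finset.mem_insert_self i s)).mul
      (ih fun j hj => hg j (Finset.mem_insert_of_mem hj))

theorem holPeriodic_expC (k : Fin n → ℤ) : HolPeriodic ρ (expC k) :=
  ⟨fun θ _ => (hasFDerivAt_expC k θ).differentiableAt.differentiableWithinAt,
    fun m θ _ => expC_periodic k m θ⟩

theorem HolPeriodic.differentiableAt (hg : HolPeriodic ρ g) {θ : Fin n → ℂ}
    (hθ : θ ∈ strip n ρ) : DifferentiableAt ℂ g θ :=
  hg.diff.differentiableAt ((isOpen_strip n ρ).mem_nhds hθ)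

/-- The derivative of a function that is periodic on the strip is periodic. -/
theorem fderiv_periodic {F : Type*} [NormedAddCommGroup F] [NormedSpace ℂ F]
    {g : (Fin n → ℂ) → F} {k : Fin n → ℤ} {c : F}
    (hg : ∀ θ ∈ strip n ρ, g (θ + intC k) = g θ + c)
    {θ : Fin n → ℂ} (hθ : θ ∈ strip n ρ) : fderiv ℂ g (θ + intC k) = fderiv ℂ g θ := by
  rw [← fderiv_comp_add_right]
  have : (fun θ => g (θ + intC k)) =ᶠ[𝓝 θ] fun θ => g θ + c := by
    filter_upwards [(isOpen_strip n ρ).mem_nhds hθ] with θ' hθ' using hg θ' hθ'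
  rw [this.fderiv_eq, fderiv_add_const]

theorem HolPeriodic.fderiv_apply (hg : HolPeriodic ρ g) (v : Fin n → ℂ) :
    HolPeriodic ρ fun θ => fderiv ℂ g θ v :=
  ⟨differentiableOn_fderiv_apply (isOpen_strip n ρ) hg.diff v, fun k θ hθ => by
    rw [fderiv_periodic (c := 0) (fun θ hθ => by rw [hg.periodic k θ hθ, add_zero]) hθ]⟩

/-- The restriction of a holomorphic periodic function to a horizontal translate of `ℝⁿ`. -/
theorem HolPeriodic.contPeriodic (hg : HolPeriodic ρ g) {η : Fin n → ℝ} (hη : ∀ j, |η j| < ρ) :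
    ContPeriodic fun t => g (toC t + Complex.I • toC η) := by
  refine ⟨hg.diff.continuousOn.comp_continuous (continuous_toC.add continuous_const) fun t =>
    (toC_add_I_mem_strip t η).2 hη, fun k t => ?_⟩
  rw [toC_add_int, add_right_comm, hg.periodic k _ ((toC_add_I_mem_strip t η).2 hη)]

theorem HolPeriodic.contPeriodic_real (hg : HolPeriodic ρ g) (hρ : 0 < ρ) :
    ContPeriodic fun t => g (toC t) := by
  have h0 : toC (0 : Fin n → ℝ) = 0 := by ext; simp [toC]
  simpa [h0] using hg.contPeriodic (η := 0) (fun j => by simpa using hρ)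

/-- The derivative of `g` along a real line. -/
theorem HolPeriodic.hasDerivAt_line (hg : HolPeriodic ρ g) {θ : Fin n → ℂ}
    (hθ : θ ∈ strip n ρ) (v : Fin n → ℂ) :
    HasDerivAt (fun s : ℝ => g (θ + (s : ℂ) • v)) (fderiv ℂ g θ v) 0 := by
  have h1 : HasDerivAt (fun s : ℂ => θ + s • v) v 0 := by
    simpa using ((hasDerivAt_id (0 : ℂ)).smul_const v).const_add θ
  have h2 : HasFDerivAt g (fderiv ℂ g θ) (θ + (0 : ℂ) • v) := by
    simpa using (hg.differentiableAt hθ).hasFDerivAt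
  have h3 := h2.comp_hasDerivAt (0 : ℂ) h1
  exact HasDerivAt.comp_ofReal (z := 0) (by simpa [Function.comp_def] using h3)

/-- **Shift of contour**: the average of a periodic holomorphic function over a horizontal
translate of the torus does not depend on the translate. -/
theorem HolPeriodic.cubeAvg_shift (hh : HolPeriodic ρ h) {η : Fin n → ℝ}
    (hη : ∀ j, |η j| < ρ) :
    cubeAvg (fun t => h (toC t + Complex.I • toC η)) = cubeAvg fun t => h (toC t) := by
  have hsη : ∀ s ∈ Icc (0 : ℝ) 1, ∀ j, |(s • η) j| < ρ := fun s hs j => by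
    rw [Pi.smul_apply, smul_eq_mul, abs_mul, abs_of_nonneg hs.1]
    exact (mul_le_of_le_one_left (abs_nonneg _) hs.2).trans_lt (hη j)
  set W : Set ℝ := {s | ∀ j, |(s • η) j| < ρ} with hW
  have hWo : IsOpen W := by
    have : W = ⋂ j, {s : ℝ | |(s • η) j| < ρ} := by ext; simp [hW]
    rw [this]
    exact isOpen_iInter_of_finite fun j =>
      isOpen_lt (by simp only [Pi.smul_apply, smul_eq_mul]; fun_prop) continuous_const
  have hmem : ∀ s ∈ W, ∀ t, toC t + Complex.I • toC (s • η) ∈ strip n ρ := fun s hs t =>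
    (toC_add_I_mem_strip t (s • η)).2 hs
  set h' : (Fin n → ℂ) → ℂ := fun θ => fderiv ℂ h θ (Complex.I • toC η) with hh'
  have hh'p : HolPeriodic ρ h' := hh.fderiv_apply _
  have hline : ∀ s ∈ W, ∀ t, HasDerivAt (fun s : ℝ => h (toC t + Complex.I • toC (s • η)))
      (h' (toC t + Complex.I • toC (s • η))) s := by
    intro s hs t
    have h1 := hh.hasDerivAt_line (hmem s hs t) (Complex.I • toC η)
    rw [← sub_self s] at h1
    refine (h1.comp_sub_const s s).congr_of_eventuallyEq (Eventually.of_forall fun s' => ?_)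
    change h _ = h _
    congr 1
    rw [toC_smul, toC_smul]
    push_cast
    module
  have hzero : ∀ s ∈ W, cubeAvg (fun t => h' (toC t + Complex.I • toC (s • η))) = 0 := by
    intro s hs
    have h0 : cubeAvg (fun t => fderiv ℂ h (toC t + Complex.I • toC (s • η)) (toC η)) = 0 := by
      refine cubeAvg_deriv_eq_zero (hh.contPeriodic hs) ((hh.fderiv_apply (toC η)).contPeriodic hs)
        η fun t => ?_
      have h1 := hh.hasDerivAt_line (hmem s hs t) (toC η)
      refine h1.congr_of_eventuallyEq (Eventually.of_forall fun s' => ?_)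
      change h _ = h _
      congr 1
      rw [toC_add, toC_smul s']
      abel
    simp only [hh', map_smul, smul_eq_mul]
    rw [cubeAvg_const_mul, h0, mul_zero]
  have hder : ∀ s ∈ W, HasDerivAt
      (fun s : ℝ => cubeAvg fun t => h (toC t + Complex.I • toC (s • η))) 0 s := by
    intro s hs
    obtain ⟨ε, hε, hball⟩ := Metric.nhds_basis_closedBall.mem_iff.1 (hWo.mem_nhds hs)
    obtain ⟨M, hM⟩ := ((isCompact_closedBall s ε).prod
        (isCompact_Icc (a := (0 : Fin n → ℝ)) (b := 1))).exists_bound_of_continuousOn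
      (f := fun p : ℝ × (Fin n → ℝ) => h' (toC p.2 + Complex.I • toC (p.1 • η))) (by
        refine hh'p.diff.continuousOn.comp (Continuous.continuousOn ?_) fun p hp =>
          hmem _ (hball hp.1) _
        have h1 : Continuous fun p : ℝ × (Fin n → ℝ) => p.1 • η :=
          continuous_fst.smul continuous_const
        have h2 : Continuous fun p : ℝ × (Fin n → ℝ) => toC (p.1 • η) := continuous_toC.comp h1
        exact (continuous_toC.comp continuous_snd).add (h2.const_smul Complex.I))
    have hI := (hasDerivAt_integral_of_dominated_loc_of_deriv_le
      (μ := volume.restrict (Icc (0 : Fin n → ℝ) 1))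
      (F := fun s t => h (toC t + Complex.I • toC (s • η)))
      (F' := fun s t => h' (toC t + Complex.I • toC (s • η))) (x₀ := s)
      (s := Metric.closedBall s ε) (bound := fun _ => M)
      (Metric.closedBall_mem_nhds s hε) (by
        filter_upwards [hWo.mem_nhds hs] with s' hs'
        exact (hh.contPeriodic hs').cont.aestronglyMeasurable)
      (integrableOn_unitCube (hh.contPeriodic hs).cont)
      (hh'p.contPeriodic hs).cont.aestronglyMeasurable
      ((ae_restrict_mem measurableSet_Icc).mono fun t ht s' hs' => hM (s', t) ⟨hs', ht⟩)
      (continuous_const.continuousOn.integrableOn_compact isCompact_Icc)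
      (Eventually.of_forall fun t s' hs' => hline s' (hball hs') t)).2
    have h0 := hzero s hs
    rw [cubeAvg] at h0
    rwa [h0] at hI
  have := (convex_Icc (0 : ℝ) 1).norm_image_sub_le_of_norm_hasDerivWithin_le (𝕜 := ℝ)
    (f := fun s : ℝ => cubeAvg fun t => h (toC t + Complex.I • toC (s • η)))
    (f' := fun _ => 0) (C := 0) (fun s hs => (hder s (hsη s hs)).hasDerivWithinAt) (by simp)
    (left_mem_Icc.2 zero_le_one) (right_mem_Icc.2 zero_le_one)
  rw [zero_mul, norm_le_zero_iff, sub_eq_zero] at this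
  have h0 : toC (0 : Fin n → ℝ) = 0 := by ext; simp [toC]
  simpa [h0] using this

theorem HolPeriodic.cubeCoeff_shift (hg : HolPeriodic ρ g) {η : Fin n → ℝ}
    (hη : ∀ j, |η j| < ρ) (k : Fin n → ℤ) :
    cubeCoeff (fun t => g (toC t + Complex.I • toC η)) k =
      fcoeff g k * expC k (Complex.I • toC η) := by
  have h := (hg.mul (holPeriodic_expC (-k))).cubeAvg_shift hη
  rw [fcoeff, cubeCoeff, cubeCoeff, ← h, ← cubeAvg_mul_const]
  congr 1
  ext t
  rw [expC_add, mul_assoc, mul_assoc, expC_neg_mul, mul_one]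

end Strip
end QuasiNewton

namespace QuasiNewton

open MeasureTheory Set Filter Topology

/-! ### Fourier series on a complex strip -/

section Fourier

variable {n : ℕ} {ρ : ℝ} {g h : (Fin n → ℂ) → ℂ}

theorem HolPeriodic.exists_bound {ρ' : ℝ} (hg : HolPeriodic ρ g) (h : ρ' < ρ) :
    ∃ M, 0 ≤ M ∧ ∀ θ ∈ closedStrip n ρ', ‖g θ‖ ≤ M := by
  set C : Set (Fin n → ℂ) := Set.univ.pi fun _ => Icc (0 : ℝ) 1 ×ℂ Icc (-ρ') ρ' with hC
  have hCc : IsCompact C := isCompact_univ_pi fun _ => isCompact_Icc.reProdIm isCompact_Icc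
  have hCs : C ⊆ strip n ρ := fun θ hθ j => by
    have := (hθ j trivial).2
    exact (abs_le.2 this).trans_lt h
  obtain ⟨M, hM⟩ := hCc.exists_bound_of_continuousOn (hg.diff.continuousOn.mono hCs)
  refine ⟨max M 0, le_max_right _ _, fun θ hθ => ?_⟩
  set k : Fin n → ℤ := fun j => -⌊(θ j).re⌋ with hk
  rw [← hg.periodic k θ (closedStrip_subset_strip h hθ)]
  refine (hM _ fun j _ => ⟨?_, ?_⟩).trans (le_max_left _ _)
  · simp only [mem_preimage, hk, intC, Pi.add_apply, Complex.add_re, Complex.intCast_re, mem_Icc]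
    push_cast
    exact ⟨by linarith [Int.floor_le (θ j).re], by linarith [Int.lt_floor_add_one (θ j).re]⟩
  · simpa [hk, intC] using abs_le.1 (hθ j)

/-- The Fourier coefficients of a function that is bounded by `M` on horizontal translates of the
torus at height less than `ρ` decay exponentially. -/
theorem HolPeriodic.norm_fcoeff_le {ρ' M : ℝ} (hg : HolPeriodic ρ g) (hρ' : ρ' < ρ) (h0 : 0 ≤ ρ')
    (hM : ∀ θ ∈ closedStrip n ρ', ‖g θ‖ ≤ M) (k : Fin n → ℤ) :
    ‖fcoeff g k‖ ≤ M * Real.exp (-(2 * Real.pi * ρ' * degree k)) := by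
  set η : Fin n → ℝ := fun j => -ρ' * (SignType.sign (k j : ℝ) : ℝ) with hη
  have hηa : ∀ j, |η j| ≤ ρ' := fun j => by
    rw [hη]
    simp only [abs_mul, abs_neg, abs_of_nonneg h0]
    refine mul_le_of_le_one_right h0 ?_
    rcases lt_trichotomy (k j : ℝ) 0 with h | h | h <;> simp [h]
  have hηρ : ∀ j, |η j| < ρ := fun j => (hηa j).trans_lt hρ'
  have h1 := hg.cubeCoeff_shift hηρ k
  have h2 : ‖expC k (Complex.I • toC η)‖ = Real.exp (2 * Real.pi * ρ' * degree k) := by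
    rw [norm_expC, degree_cast]
    congr 1
    simp only [Pi.smul_apply, toC, smul_eq_mul, Complex.mul_im, Complex.I_re, Complex.I_im,
      Complex.ofReal_re, Complex.ofReal_im, zero_mul, one_mul, zero_add, hη]
    rw [Finset.mul_sum, Finset.mul_sum]
    refine Finset.sum_congr rfl fun j _ => ?_
    rw [← sign_mul_self (k j : ℝ)]
    ring
  have h3 : ‖cubeCoeff (fun t => g (toC t + Complex.I • toC η)) k‖ ≤ M := by
    refine norm_cubeAvg_le fun t => ?_
    rw [norm_mul]
    have : ‖expC (-k) (toC t)‖ = 1 := by rw [norm_expC]; simp [toC]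
    rw [this, mul_one]
    exact hM _ fun j => by simpa [toC] using hηa j
  rw [h1, norm_mul, h2] at h3
  rwa [Real.exp_neg, ← div_eq_mul_inv, le_div_iff₀ (Real.exp_pos _)]

theorem summable_exp_neg_degree (n : ℕ) {c : ℝ} (hc : 0 < c) :
    Summable fun k : Fin n → ℤ => Real.exp (-(c * degree k)) := by
  have h1 : Summable fun m : ℤ => Real.exp (-(c * m.natAbs)) := by
    have hN : Summable fun m : ℕ => Real.exp (-(c * m)) := by
      have := Real.summable_exp_nat_mul_iff.2 (neg_lt_zero.2 hc)
      refine this.congr fun m => ?_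
      congr 1; ring
    refine Summable.of_nat_of_neg (by simpa using hN) (by simpa using hN)
  induction n with
  | zero => exact (hasSum_fintype _).summable
  | succ n ih =>
    rw [← (Fin.consEquiv fun _ : Fin (n + 1) => ℤ).summable_iff]
    refine (h1.mul_of_nonneg ih (fun _ => (Real.exp_pos _).le)
      (fun _ => (Real.exp_pos _).le)).congr fun p => ?_
    simp only [Function.comp_apply, degree, Fin.consEquiv_apply, Fin.sum_univ_succ, Fin.cons_zero,
      Fin.cons_succ, ← Real.exp_add]
    congr 1
    push_cast
    ring

/-- **Fourier inversion** on the complex strip, with absolute convergence. -/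
theorem HolPeriodic.hasSum_fourier (hg : HolPeriodic ρ g) {θ : Fin n → ℂ} {ρ'' : ℝ}
    (hρ'' : ρ'' < ρ) (h0 : 0 ≤ ρ'') (hθ : θ ∈ closedStrip n ρ'') :
    (Summable fun k => ‖fcoeff g k * expC k θ‖) ∧
      HasSum (fun k => fcoeff g k * expC k θ) (g θ) := by
  set η : Fin n → ℝ := fun j => (θ j).im with hη
  set t : Fin n → ℝ := fun j => (θ j).re with ht
  have hθe : θ = toC t + Complex.I • toC η := eq_toC_add_I θ
  have hηρ : ∀ j, |η j| < ρ := fun j => (hθ j).trans_lt hρ''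
  obtain ⟨ρ', h1, h2⟩ := exists_between hρ''
  obtain ⟨M, hM0, hM⟩ := hg.exists_bound h2
  have hexp : Summable fun k : Fin n → ℤ =>
      M * Real.exp (-((2 * Real.pi * (ρ' - ρ'')) * degree k)) :=
    (summable_exp_neg_degree n (mul_pos Real.two_pi_pos (sub_pos.2 h1))).mul_left M
  have hbound : ∀ (k : Fin n → ℤ) (θ' : Fin n → ℂ), θ' ∈ closedStrip n ρ'' →
      ‖fcoeff g k * expC k θ'‖ ≤ M * Real.exp (-((2 * Real.pi * (ρ' - ρ'')) * degree k)) := by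
    intro k θ' hθ'
    rw [norm_mul]
    calc ‖fcoeff g k‖ * ‖expC k θ'‖
        ≤ (M * Real.exp (-(2 * Real.pi * ρ' * degree k))) *
          Real.exp (2 * Real.pi * ρ'' * degree k) :=
          mul_le_mul (hg.norm_fcoeff_le h2 (h0.trans h1.le) hM k) (norm_expC_le k hθ')
            (norm_nonneg _) (by positivity)
      _ = M * Real.exp (-((2 * Real.pi * (ρ' - ρ'')) * degree k)) := by
          rw [mul_assoc, ← Real.exp_add]
          congr 2; ring
  have hsum : Summable fun k => ‖fcoeff g k * expC k θ‖ :=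
    Summable.of_nonneg_of_le (fun _ => norm_nonneg _) (fun k => hbound k θ hθ) hexp
  refine ⟨hsum, ?_⟩
  have hcoef : cubeCoeff (fun t => g (toC t + Complex.I • toC η)) =
      fun k => fcoeff g k * expC k (Complex.I • toC η) :=
    funext fun k => hg.cubeCoeff_shift hηρ k
  have hinv := hasSum_cubeCoeff (hg.contPeriodic hηρ) (by
    rw [hcoef]
    refine Summable.of_norm_bounded hexp fun k => hbound k _ fun j => ?_
    simpa [toC] using hθ j) t
  rw [hcoef, ← hθe] at hinv
  refine hinv.congr_fun fun k => ?_
  rw [mul_assoc, ← expC_add, add_comm, ← hθe]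

theorem exists_mem_closedStrip (hρ : 0 < ρ) {θ : Fin n → ℂ} (hθ : θ ∈ strip n ρ) :
    ∃ ρ'' < ρ, 0 ≤ ρ'' ∧ θ ∈ closedStrip n ρ'' := by
  refine ⟨⨆ j, |(θ j).im|, ?_, Real.iSup_nonneg fun j => abs_nonneg _, fun j =>
    le_ciSup (f := fun j => |(θ j).im|) (Finite.bddAbove_range _) j⟩
  rcases isEmpty_or_nonempty (Fin n) with hn | hn
  · simpa using hρ
  · obtain ⟨j, hj⟩ := exists_eq_ciSup_of_finite (f := fun j => |(θ j).im|)
    rw [← hj]; exact hθ j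

/-- A periodic holomorphic function is determined by its Fourier coefficients. -/
theorem HolPeriodic.eq_of_fcoeff_eq (hρ : 0 < ρ) (hg : HolPeriodic ρ g) (hh : HolPeriodic ρ h)
    (heq : ∀ k, fcoeff g k = fcoeff h k) {θ : Fin n → ℂ} (hθ : θ ∈ strip n ρ) : g θ = h θ := by
  obtain ⟨ρ'', h1, h2, h3⟩ := exists_mem_closedStrip hρ hθ
  have hsg := (hg.hasSum_fourier h1 h2 h3).2
  simp only [heq] at hsg
  exact hsg.unique (hh.hasSum_fourier h1 h2 h3).2

/-- Periodic holomorphic functions that agree on `ℝⁿ` agree on the strip. -/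
theorem HolPeriodic.eq_of_eq_real (hρ : 0 < ρ) (hg : HolPeriodic ρ g) (hh : HolPeriodic ρ h)
    (heq : ∀ t : Fin n → ℝ, g (toC t) = h (toC t)) {θ : Fin n → ℂ} (hθ : θ ∈ strip n ρ) :
    g θ = h θ :=
  hg.eq_of_fcoeff_eq hρ hh (fun k => by simp only [fcoeff, heq]) hθ

/-- The Fourier coefficients of a directional derivative. -/
theorem cubeCoeff_deriv {φ ψ : (Fin n → ℝ) → ℂ} (hφ : ContPeriodic φ) (hψ : ContPeriodic ψ)
    (v : Fin n → ℝ) (hd : ∀ t, HasDerivAt (fun s : ℝ => φ (t + s • v)) (ψ t) 0)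
    (k : Fin n → ℤ) :
    cubeCoeff ψ k = 2 * Real.pi * Complex.I * ((∑ j, (k j : ℝ) * v j : ℝ) : ℂ)
      * cubeCoeff φ k := by
  set c : ℂ := 2 * Real.pi * Complex.I * ((∑ j, (k j : ℝ) * v j : ℝ) : ℂ) with hc
  have he := contPeriodic_expC (-k)
  have h1 : ∀ t : Fin n → ℝ, HasDerivAt (fun s : ℝ => expC (-k) (toC (t + s • v)))
      (-c * expC (-k) (toC t)) 0 := by
    intro t
    have h2 := (holPeriodic_expC (ρ := 1) (-k)).hasDerivAt_line (toC_mem_strip one_pos t) (toC v)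
    have h3 : fderiv ℂ (expC (-k)) (toC t) (toC v) = -c * expC (-k) (toC t) := by
      rw [(hasFDerivAt_expC (-k) (toC t)).fderiv]
      simp only [hc, toC, _root_.smul_apply, _root_.sum_apply,
        ContinuousLinearMap.proj_apply, smul_eq_mul, Pi.neg_apply]
      push_cast
      simp only [neg_mul, Finset.sum_neg_distrib]
      ring
    rw [h3] at h2
    simpa only [toC_add, toC_smul] using h2
  have h0 := cubeAvg_deriv_eq_zero (hφ.mul he)
    (ψ := fun t => ψ t * expC (-k) (toC t) - φ t * expC (-k) (toC t) * c)
    ⟨((hψ.cont.mul he.cont).sub ((hφ.cont.mul he.cont).mul continuous_const)), fun m t => by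
      simp only [hψ.periodic, hφ.periodic, he.periodic]⟩ v (fun t => by
      have := (hd t).mul (h1 t)
      simp only [zero_smul, add_zero] at this
      refine this.congr_deriv ?_
      ring)
  rw [cubeAvg_sub (φ := fun t => ψ t * expC (-k) (toC t))
    (ψ := fun t => φ t * expC (-k) (toC t) * c) (hψ.cont.mul he.cont)
    ((hφ.cont.mul he.cont).mul continuous_const), cubeAvg_mul_const, sub_eq_zero] at h0
  rw [cubeCoeff, cubeCoeff, h0, mul_comm]

/-- The Fourier coefficients of a directional derivative of a periodic holomorphic function. -/
theorem HolPeriodic.fcoeff_fderiv (hρ : 0 < ρ) (hg : HolPeriodic ρ g) (v : Fin n → ℝ)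
    (k : Fin n → ℤ) :
    fcoeff (fun θ => fderiv ℂ g θ (toC v)) k =
      2 * Real.pi * Complex.I * ((∑ j, (k j : ℝ) * v j : ℝ) : ℂ) * fcoeff g k := by
  refine cubeCoeff_deriv (hg.contPeriodic_real hρ) ((hg.fderiv_apply _).contPeriodic_real hρ) v
    (fun t => ?_) k
  simpa only [toC_add, toC_smul] using hg.hasDerivAt_line (toC_mem_strip hρ t) (toC v)

theorem fcoeff_zero (g : (Fin n → ℂ) → ℂ) : fcoeff g 0 = average g := by
  simp [fcoeff, cubeCoeff, expC, cubeAvg, average]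

/-- The `ℓ²` bound for the Fourier coefficients of a function bounded by `M`, with the exponential
weight of the strip: sum Bessel's inequality over the `2ⁿ` translates by the corners of a cube. -/
theorem HolPeriodic.sum_sq_fcoeff_le {ρ' M : ℝ} (hg : HolPeriodic ρ g) (hρ' : ρ' < ρ)
    (h0 : 0 ≤ ρ') (hM : ∀ θ ∈ strip n ρ, ‖g θ‖ ≤ M) (F : Finset (Fin n → ℤ)) :
    ∑ k ∈ F, (‖fcoeff g k‖ * Real.exp (2 * Real.pi * ρ' * degree k)) ^ 2 ≤ 2 ^ n * M ^ 2 := by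
  set η : (Fin n → Bool) → Fin n → ℝ := fun s j => if s j then ρ' else -ρ' with hη
  have hηa : ∀ s j, |η s j| = ρ' := fun s j => by
    simp only [hη]; split_ifs <;> simp [abs_of_nonneg h0]
  have hηρ : ∀ s j, |η s j| < ρ := fun s j => (hηa s j).trans_lt hρ'
  have hB : ∀ s, ∑ k ∈ F, (‖fcoeff g k‖ * ‖expC k (Complex.I • toC (η s))‖) ^ 2 ≤ M ^ 2 := by
    intro s
    obtain ⟨h1, h2⟩ := summable_sq_cubeCoeff (hg.contPeriodic (hηρ s)) (M := M)
      fun t => hM _ ((toC_add_I_mem_strip t _).2 (hηρ s))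
    simp only [hg.cubeCoeff_shift (hηρ s), norm_mul] at h1 h2
    exact (h1.sum_le_tsum F fun _ _ => by positivity).trans h2
  have hk : ∀ k : Fin n → ℤ, (‖fcoeff g k‖ * Real.exp (2 * Real.pi * ρ' * degree k)) ^ 2 ≤
      ∑ s, (‖fcoeff g k‖ * ‖expC k (Complex.I • toC (η s))‖) ^ 2 := by
    intro k
    set s : Fin n → Bool := fun j => decide (k j < 0) with hs
    refine le_trans (le_of_eq ?_) (Finset.single_le_sum (fun s _ => by positivity)
      (Finset.mem_univ s))
    congr 2
    rw [norm_expC, degree_cast]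
    congr 1
    simp only [Pi.smul_apply, toC, smul_eq_mul, Complex.mul_im, Complex.I_re, Complex.I_im,
      Complex.ofReal_re, Complex.ofReal_im, zero_mul, one_mul, zero_add, hη, hs]
    rw [Finset.mul_sum, Finset.mul_sum]
    refine Finset.sum_congr rfl fun j _ => ?_
    by_cases hj : k j < 0
    · have : ((k j : ℤ) : ℝ) < 0 := by exact_mod_cast hj
      simp only [hj, decide_true, if_true, abs_of_neg this]
      ring
    · have : (0 : ℝ) ≤ ((k j : ℤ) : ℝ) := by exact_mod_cast not_lt.1 hj
      simp only [hj, decide_false, Bool.false_eq_true, if_false, abs_of_nonneg this]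
      ring
  calc _ ≤ ∑ k ∈ F, ∑ s, (‖fcoeff g k‖ * ‖expC k (Complex.I • toC (η s))‖) ^ 2 :=
        Finset.sum_le_sum fun k _ => hk k
    _ = ∑ s, ∑ k ∈ F, (‖fcoeff g k‖ * ‖expC k (Complex.I • toC (η s))‖) ^ 2 := Finset.sum_comm
    _ ≤ ∑ _s : Fin n → Bool, M ^ 2 := Finset.sum_le_sum fun s _ => hB s
    _ = 2 ^ n * M ^ 2 := by simp

end Fourier

/-! ### Small divisors -/

theorem summable_inv_sq_int : Summable fun j : ℤ => 9 / (|(j : ℝ)| + 1) ^ 2 := by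
  have hN : Summable fun m : ℕ => 9 / ((m : ℝ) + 1) ^ 2 := by
    have := (summable_nat_add_iff 1).2 (Real.summable_one_div_nat_pow.2 one_lt_two)
    simpa [div_eq_mul_inv] using this.mul_left 9
  exact Summable.of_nat_of_neg (by simpa using hN) (by simpa using hN)

/-- The sum of `1 / x²` over numbers `x` with mutual distances, and distances from `0`, at
least `d`. -/
theorem sum_inv_sq_le_of_separated {ι : Type*} (F : Finset ι) (x : ι → ℝ) {d : ℝ} (hd : 0 < d)
    (h0 : ∀ i ∈ F, d ≤ |x i|) (hsep : ∀ i ∈ F, ∀ j ∈ F, i ≠ j → d ≤ |x i - x j|) :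
    ∑ i ∈ F, 1 / x i ^ 2 ≤ (∑' j : ℤ, 9 / (|(j : ℝ)| + 1) ^ 2) / d ^ 2 := by
  set fl : ι → ℤ := fun i => ⌊x i / d⌋ with hfl
  have hinj : Set.InjOn fl F := by
    intro i hi j hj hij
    by_contra hne
    have h1 := hsep i hi j hj hne
    have h2 : |x i / d - x j / d| < 1 := Int.abs_sub_lt_one_of_floor_eq_floor hij
    rw [← sub_div, abs_div, abs_of_pos hd, div_lt_one hd] at h2
    linarith
  have hterm : ∀ i ∈ F, 1 / x i ^ 2 ≤ (9 / (|(fl i : ℝ)| + 1) ^ 2) / d ^ 2 := by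
    intro i hi
    have h1 : |(fl i : ℝ)| + 1 ≤ 3 * (|x i| / d) := by
      have ha : 1 ≤ |x i| / d := (one_le_div hd).2 (h0 i hi)
      have hb : |(fl i : ℝ)| ≤ |x i| / d + 1 := by
        have e : |x i| / d = |x i / d| := by rw [abs_div, abs_of_pos hd]
        rw [e]
        change |((⌊x i / d⌋ : ℤ) : ℝ)| ≤ _
        have := Int.floor_le (x i / d)
        have := Int.lt_floor_add_one (x i / d)
        rw [abs_le]
        constructor
        · linarith [neg_abs_le (x i / d)]
        · linarith [le_abs_self (x i / d)]
      linarith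
    have hx : 0 < |x i| := hd.trans_le (h0 i hi)
    rw [div_div, div_le_div_iff₀ (by rw [← sq_abs]; positivity) (by positivity), one_mul]
    have h2 : (|(fl i : ℝ)| + 1) * d ≤ 3 * |x i| := by
      calc _ ≤ 3 * (|x i| / d) * d := by gcongr
        _ = 3 * |x i| := by field_simp
    calc ((|(fl i : ℝ)| + 1) ^ 2 * d ^ 2) = ((|(fl i : ℝ)| + 1) * d) ^ 2 := by ring
      _ ≤ (3 * |x i|) ^ 2 := by gcongr
      _ = 9 * x i ^ 2 := by rw [mul_pow, sq_abs]; norm_num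
  calc ∑ i ∈ F, 1 / x i ^ 2 ≤ ∑ i ∈ F, (9 / (|(fl i : ℝ)| + 1) ^ 2) / d ^ 2 :=
        Finset.sum_le_sum hterm
    _ = (∑ j ∈ F.image fl, 9 / (|(j : ℝ)| + 1) ^ 2) / d ^ 2 := by
        rw [Finset.sum_image hinj, Finset.sum_div]
    _ ≤ _ := by
        gcongr
        exact summable_inv_sq_int.sum_le_tsum _ fun _ _ => by positivity

/-- Summation by parts: bounds `C y^{-m}` for the sums of `w` over `deg ≤ m` give a bound for the
sum with the weights `y^{2 deg}`. -/
theorem sum_mul_pow_le_of_partial {ι : Type*} (F : Finset ι) (w : ι → ℝ) (deg : ι → ℕ) {y C : ℝ}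
    (hy0 : 0 < y) (hy1 : y < 1) (hC : 0 ≤ C)
    (hpart : ∀ m, (∑ i ∈ F with deg i ≤ m, w i) * y ^ m ≤ C) :
    ∑ i ∈ F, w i * y ^ (2 * deg i) ≤ 2 * C := by
  obtain ⟨N, hN⟩ : ∃ N, ∀ i ∈ F, deg i ≤ N := ⟨F.sup deg, fun i hi => Finset.le_sup hi⟩
  -- `x^j = x^N + ∑_{j ≤ m < N} (1 - x) x^m` with `x = y²`
  have htel : ∀ j ≤ N, (y ^ 2) ^ j = (y ^ 2) ^ N +
      ∑ m ∈ Finset.range N, if j ≤ m then (1 - y ^ 2) * (y ^ 2) ^ m else 0 := by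
    intro j hj
    clear hN
    induction N, hj using Nat.le_induction with
    | base =>
      rw [Finset.sum_eq_zero, add_zero]
      intro m hm
      rw [if_neg (by simpa using hm)]
    | succ N hN ih =>
      rw [Finset.sum_range_succ, if_pos hN]
      linear_combination ih
  have h1 : ∑ i ∈ F, w i * y ^ (2 * deg i) = y ^ N * ((∑ i ∈ F with deg i ≤ N, w i) * y ^ N) +
      ∑ m ∈ Finset.range N, (1 - y ^ 2) * y ^ m * ((∑ i ∈ F with deg i ≤ m, w i) * y ^ m) := by
    have hfN : F.filter (fun i => deg i ≤ N) = F := Finset.filter_true_of_mem hN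
    have hw : ∀ i ∈ F, w i * y ^ (2 * deg i) = w i * (y ^ 2) ^ N +
        ∑ m ∈ Finset.range N, if deg i ≤ m then w i * ((1 - y ^ 2) * (y ^ 2) ^ m) else 0 := by
      intro i hi
      rw [pow_mul, htel _ (hN i hi), mul_add, Finset.mul_sum]
      simp only [mul_ite, mul_zero]
    rw [Finset.sum_congr rfl hw, Finset.sum_add_distrib, Finset.sum_comm, hfN]
    congr 1
    · rw [← Finset.sum_mul]; ring
    · refine Finset.sum_congr rfl fun m _ => ?_
      rw [← Finset.sum_filter, ← Finset.sum_mul]; ring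
  have hy2 : 0 ≤ 1 - y ^ 2 := by nlinarith
  have hyN : y ^ N ≤ 1 := pow_le_one₀ hy0.le hy1.le
  have hgeom : (1 - y) * ∑ m ∈ Finset.range N, y ^ m = 1 - y ^ N := mul_neg_geom_sum y N
  calc ∑ i ∈ F, w i * y ^ (2 * deg i)
      ≤ y ^ N * C + ∑ m ∈ Finset.range N, (1 - y ^ 2) * y ^ m * C := by
        rw [h1]
        refine add_le_add (mul_le_mul_of_nonneg_left (hpart N) (by positivity))
          (Finset.sum_le_sum fun m _ => mul_le_mul_of_nonneg_left (hpart m) (by positivity))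
    _ = C * (y ^ N + (1 + y) * (1 - y ^ N)) := by
        rw [← Finset.sum_mul, ← Finset.mul_sum, ← hgeom]; ring
    _ ≤ C * 2 := by
        refine mul_le_mul_of_nonneg_left ?_ hC
        nlinarith [pow_nonneg hy0.le N]
    _ = 2 * C := mul_comm _ _

theorem rpow_mul_exp_neg_le {p x : ℝ} (hp : 0 < p) (hx : 0 ≤ x) :
    x ^ p * Real.exp (-x) ≤ p ^ p := by
  have h1 : x / p ≤ Real.exp (x / p) := by linarith [Real.add_one_le_exp (x / p)]
  have h2 : (x / p) ^ p ≤ Real.exp x := by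
    calc (x / p) ^ p ≤ Real.exp (x / p) ^ p := Real.rpow_le_rpow (by positivity) h1 hp.le
      _ = Real.exp x := by rw [← Real.exp_mul]; congr 1; field_simp
  rw [Real.div_rpow hx hp.le, div_le_iff₀ (by positivity)] at h2
  rw [Real.exp_neg, ← div_eq_mul_inv, div_le_iff₀ (Real.exp_pos _), mul_comm]
  exact h2

/-- The constant `∑_j 9 / (|j| + 1)²`. -/
noncomputable def separatedConst : ℝ := ∑' j : ℤ, 9 / (|(j : ℝ)| + 1) ^ 2

theorem separatedConst_nonneg : 0 ≤ separatedConst := tsum_nonneg fun _ => by positivity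

section Divisors

variable {n : ℕ} {γ σ : ℝ} {ω : Fin n → ℝ}

theorem degree_pos {k : Fin n → ℤ} (hk : k ≠ 0) : 0 < degree k := by
  obtain ⟨j, hj⟩ := Function.ne_iff.1 hk
  exact Finset.sum_pos' (fun _ _ => Nat.zero_le _) ⟨j, Finset.mem_univ _, Int.natAbs_pos.2 hj⟩

theorem degree_sub_le (k l : Fin n → ℤ) : degree (k - l) ≤ degree k + degree l := by
  rw [degree, degree, degree, ← Finset.sum_add_distrib]
  exact Finset.sum_le_sum fun j _ => Int.natAbs_sub_le _ _

theorem IsDiophantine.lower (hω : IsDiophantine γ σ ω) (hγ : 0 < γ) (hσ : 0 ≤ σ)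
    {k : Fin n → ℤ} (hk : k ≠ 0) {m : ℝ} (hm : (degree k : ℝ) ≤ m) :
    γ * m ^ (-σ) ≤ |∑ j, (k j : ℝ) * ω j| := by
  refine le_trans ?_ (hω k hk)
  rw [← degree_cast]
  have : (0 : ℝ) < degree k := by exact_mod_cast degree_pos hk
  exact mul_le_mul_of_nonneg_left (Real.rpow_le_rpow_of_nonpos this hm (by linarith)) hγ.le

theorem IsDiophantine.pos (hω : IsDiophantine γ σ ω) (hγ : 0 < γ)
    {k : Fin n → ℤ} (hk : k ≠ 0) : 0 < |∑ j, (k j : ℝ) * ω j| := by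
  have hd : (0 : ℝ) < degree k := by exact_mod_cast degree_pos hk
  refine lt_of_lt_of_le ?_ (hω k hk)
  rw [← degree_cast]
  positivity

/-- Rüssmann's bound for the sum of the squares of the inverse small divisors: the numbers `k · ω`
with `|k|₁ ≤ m` have mutual distances at least `γ (2 m)^{-σ}`. -/
theorem IsDiophantine.sum_inv_sq_le (hω : IsDiophantine γ σ ω) (hγ : 0 < γ) (hσ : 0 < σ)
    {a : ℝ} (ha : 0 < a) (F : Finset (Fin n → ℤ)) (hF : ∀ k ∈ F, k ≠ 0) :
    ∑ k ∈ F, 1 / (∑ j, (k j : ℝ) * ω j) ^ 2 * Real.exp (-(a * degree k)) ≤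
      2 * (separatedConst * γ⁻¹ ^ 2 * (8 * σ / a) ^ (2 * σ)) := by
  have hS := separatedConst_nonneg
  set y := Real.exp (-(a / 2)) with hy
  have hexp : ∀ k : Fin n → ℤ, Real.exp (-(a * degree k)) = y ^ (2 * degree k) := fun k => by
    rw [hy, ← Real.exp_nat_mul]; congr 1; push_cast; ring
  simp only [hexp]
  refine sum_mul_pow_le_of_partial F _ degree (Real.exp_pos _)
    (by rw [hy, Real.exp_lt_one_iff]; linarith) (by positivity) fun m => ?_
  rcases Nat.eq_zero_or_pos m with rfl | hm
  · rw [Finset.filter_false_of_mem fun k hk h0 => by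
      have := degree_pos (hF k hk); omega]
    simp only [Finset.sum_empty, zero_mul]
    positivity
  have hm' : (0 : ℝ) < m := by exact_mod_cast hm
  set d := γ * (2 * (m : ℝ)) ^ (-σ) with hd
  have hdpos : 0 < d := by positivity
  have h1 := sum_inv_sq_le_of_separated (F.filter fun k => degree k ≤ m)
    (fun k => ∑ j, (k j : ℝ) * ω j) hdpos (fun k hk => by
      rw [Finset.mem_filter] at hk
      have : (degree k : ℝ) ≤ m := by exact_mod_cast hk.2
      exact hω.lower hγ hσ.le (hF k hk.1) (by linarith)) (fun k hk l hl hkl => by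
      rw [Finset.mem_filter] at hk hl
      have h2 : (degree (k - l) : ℝ) ≤ 2 * m := by
        have := degree_sub_le k l
        have : degree (k - l) ≤ 2 * m := by omega
        exact_mod_cast this
      have h3 := hω.lower hγ hσ.le (sub_ne_zero.2 hkl) h2
      simpa [sub_mul] using h3)
  have h4 : (separatedConst / d ^ 2) * y ^ m ≤
      separatedConst * γ⁻¹ ^ 2 * (8 * σ / a) ^ (2 * σ) := by
    have h5 := rpow_mul_exp_neg_le (p := 2 * σ) (x := a * m / 2) (by positivity) (by positivity)
    have h6 : (d ^ 2)⁻¹ = γ⁻¹ ^ 2 * (4 / a) ^ (2 * σ) * (a * m / 2) ^ (2 * σ) := by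
      rw [mul_assoc, ← Real.mul_rpow (by positivity) (by positivity), hd, mul_pow, mul_inv, inv_pow]
      congr 1
      rw [← Real.rpow_natCast, ← Real.rpow_mul (by positivity), ← Real.rpow_neg (by positivity)]
      congr 1
      · field_simp; ring
      · push_cast; ring
    have h7 : y ^ m = Real.exp (-(a * m / 2)) := by
      rw [hy, ← Real.exp_nat_mul]; congr 1; ring
    have h8 : (8 * σ / a) ^ (2 * σ) = (4 / a) ^ (2 * σ) * (2 * σ) ^ (2 * σ) := by
      rw [← Real.mul_rpow (by positivity) (by positivity)]; congr 1; ring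
    rw [div_eq_mul_inv, h6, h7, h8]
    calc separatedConst * (γ⁻¹ ^ 2 * (4 / a) ^ (2 * σ) * (a * m / 2) ^ (2 * σ)) *
          Real.exp (-(a * m / 2))
        = separatedConst * γ⁻¹ ^ 2 * (4 / a) ^ (2 * σ) *
          ((a * m / 2) ^ (2 * σ) * Real.exp (-(a * m / 2))) := by ring
      _ ≤ separatedConst * γ⁻¹ ^ 2 * (4 / a) ^ (2 * σ) * (2 * σ) ^ (2 * σ) := by gcongr
      _ = _ := by ring
  refine le_trans ?_ h4
  exact mul_le_mul_of_nonneg_right h1 (by positivity)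

/-- The constant in Rüssmann's estimate. -/
noncomputable def ruessmannConst (n : ℕ) (σ : ℝ) : ℝ :=
  Real.sqrt (2 ^ n) * Real.sqrt (2 * separatedConst) * (4 * σ) ^ σ

/-- **Rüssmann's estimate**: if `∂_ω u = f` on `U_ρ` and `|f| ≤ M`, then the oscillation of `u` on
`U_{ρ - δ}` is at most `C γ⁻¹ δ^{-σ} M`. -/
theorem HolPeriodic.norm_sub_average_le {ρ δ M : ℝ} {u f : (Fin n → ℂ) → ℂ}
    (hω : IsDiophantine γ σ ω) (hγ : 0 < γ) (hσ : 0 < σ) (hu : HolPeriodic ρ u)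
    (hf : HolPeriodic ρ f) (huf : ∀ θ ∈ strip n ρ, fderiv ℂ u θ (toC ω) = f θ)
    (hM : ∀ θ ∈ strip n ρ, ‖f θ‖ ≤ M) (hδ : 0 < δ) (hδρ : δ < ρ) {θ : Fin n → ℂ}
    (hθ : θ ∈ strip n (ρ - δ)) :
    ‖u θ - average u‖ ≤ ruessmannConst n σ * γ⁻¹ * δ ^ (-σ) * M := by
  have hρ : 0 < ρ := hδ.trans hδρ
  have hM0 : 0 ≤ M := (norm_nonneg _).trans (hM _ (toC_mem_strip hρ 0))
  have hS := separatedConst_nonneg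
  set ρ' := ρ - δ / 2 with hρ'
  have hcoef : ∀ k, k ≠ 0 → ‖fcoeff u k‖ ≤ ‖fcoeff f k‖ * (1 / |∑ j, (k j : ℝ) * ω j|) := by
    intro k hk
    have hpos := hω.pos hγ hk
    have h1 : fcoeff f k = 2 * Real.pi * Complex.I * ((∑ j, (k j : ℝ) * ω j : ℝ) : ℂ)
        * fcoeff u k := by
      rw [← hu.fcoeff_fderiv hρ ω k, fcoeff, fcoeff]
      congr 1
      ext t
      exact (huf _ (toC_mem_strip hρ t)).symm
    have h2 : ‖fcoeff f k‖ = 2 * Real.pi * |∑ j, (k j : ℝ) * ω j| * ‖fcoeff u k‖ := by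
      rw [h1]
      simp only [norm_mul, Complex.norm_real, Complex.norm_I, Complex.norm_ofNat,
        Real.norm_eq_abs, abs_of_pos Real.pi_pos, mul_one]
    rw [h2]
    have h3 : 2 * Real.pi * |∑ j, (k j : ℝ) * ω j| * ‖fcoeff u k‖ *
        (1 / |∑ j, (k j : ℝ) * ω j|) = 2 * Real.pi * ‖fcoeff u k‖ := by
      field_simp
    rw [h3]
    have : 1 ≤ 2 * Real.pi := by linarith [Real.pi_gt_three]
    exact le_mul_of_one_le_left (norm_nonneg _) this
  have hsum := (hu.hasSum_fourier (sub_lt_self ρ hδ) (sub_pos.2 hδρ).le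
    (strip_subset_closedStrip le_rfl hθ)).2
  have hsub : HasSum (fun k => fcoeff u k * expC k θ -
      (if k = 0 then fcoeff u 0 * expC 0 θ else 0)) (u θ - average u) := by
    refine hsum.sub ?_
    have : average u = fcoeff u 0 * expC 0 θ := by
      rw [fcoeff_zero]; simp [expC]
    rw [this]
    exact hasSum_ite_eq (0 : Fin n → ℤ) _
  have hfin : ∀ F : Finset (Fin n → ℤ), ∑ k ∈ F, ‖fcoeff u k * expC k θ -
      (if k = 0 then fcoeff u 0 * expC 0 θ else 0)‖ ≤
      ruessmannConst n σ * γ⁻¹ * δ ^ (-σ) * M := by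
    intro F
    have hterm : ∀ k ∈ F, k ≠ 0 → ‖fcoeff u k * expC k θ‖ ≤
        (‖fcoeff f k‖ * Real.exp (2 * Real.pi * ρ' * degree k)) *
        (1 / |∑ j, (k j : ℝ) * ω j| * Real.exp (-(Real.pi * δ * degree k))) := by
      intro k _ hk
      rw [norm_mul]
      calc ‖fcoeff u k‖ * ‖expC k θ‖ ≤ (‖fcoeff f k‖ * (1 / |∑ j, (k j : ℝ) * ω j|)) *
            Real.exp (2 * Real.pi * (ρ - δ) * degree k) :=
            mul_le_mul (hcoef k hk) (norm_expC_le k (strip_subset_closedStrip le_rfl hθ))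
              (norm_nonneg _) (by positivity)
        _ = _ := by
            have : Real.exp (2 * Real.pi * (ρ - δ) * degree k) =
                Real.exp (2 * Real.pi * ρ' * degree k) * Real.exp (-(Real.pi * δ * degree k)) := by
              rw [← Real.exp_add]; congr 1; rw [hρ']; ring
            rw [this]; ring
    set G := F.filter fun k => k ≠ 0 with hG
    have h1 : ∑ k ∈ F, ‖fcoeff u k * expC k θ -
        (if k = 0 then fcoeff u 0 * expC 0 θ else 0)‖ ≤
        ∑ k ∈ G, (‖fcoeff f k‖ * Real.exp (2 * Real.pi * ρ' * degree k)) *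
        (1 / |∑ j, (k j : ℝ) * ω j| * Real.exp (-(Real.pi * δ * degree k))) := by
      rw [hG, Finset.sum_filter]
      refine Finset.sum_le_sum fun k hk => ?_
      by_cases h0 : k = 0
      · subst h0; simp
      · rw [if_neg h0, if_pos h0, sub_zero]; exact hterm k hk h0
    have h2 : ∑ k ∈ G, (1 / |∑ j, (k j : ℝ) * ω j| * Real.exp (-(Real.pi * δ * degree k))) ^ 2 ≤
        2 * separatedConst * (γ⁻¹ * δ ^ (-σ) * (4 * σ) ^ σ) ^ 2 := by
      have h3 := hω.sum_inv_sq_le hγ hσ (a := 2 * Real.pi * δ) (by positivity) G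
        (fun k hk => (Finset.mem_filter.1 hk).2)
      have h4 : (8 * σ / (2 * Real.pi * δ)) ^ (2 * σ) ≤ (δ ^ (-σ) * (4 * σ) ^ σ) ^ 2 := by
        have h5 : (δ ^ (-σ) * (4 * σ) ^ σ) ^ 2 = (4 * σ / δ) ^ (2 * σ) := by
          rw [Real.rpow_neg hδ.le, inv_mul_eq_div, ← Real.div_rpow (by positivity) hδ.le,
            ← Real.rpow_natCast, ← Real.rpow_mul (by positivity)]
          congr 1; push_cast; ring
        rw [h5]
        refine Real.rpow_le_rpow (by positivity) ?_ (by positivity)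
        rw [div_le_div_iff₀ (by positivity) hδ]
        have : 0 < σ * δ := by positivity
        nlinarith [Real.pi_gt_three]
      calc _ = ∑ k ∈ G, 1 / (∑ j, (k j : ℝ) * ω j) ^ 2 *
            Real.exp (-((2 * Real.pi * δ) * degree k)) := by
            refine Finset.sum_congr rfl fun k _ => ?_
            rw [mul_pow, div_pow, sq_abs, one_pow, ← Real.exp_nat_mul]
            congr 2; push_cast; ring
        _ ≤ _ := h3
        _ ≤ 2 * (separatedConst * γ⁻¹ ^ 2 * (δ ^ (-σ) * (4 * σ) ^ σ) ^ 2) := by gcongr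
        _ = _ := by ring
    have h6 := hf.sum_sq_fcoeff_le (ρ' := ρ') (by rw [hρ']; linarith) (by rw [hρ']; linarith) hM G
    refine h1.trans ((Real.sum_mul_le_sqrt_mul_sqrt _ _ _).trans ?_)
    calc _ ≤ Real.sqrt (2 ^ n * M ^ 2) *
          Real.sqrt (2 * separatedConst * (γ⁻¹ * δ ^ (-σ) * (4 * σ) ^ σ) ^ 2) := by gcongr
      _ = _ := by
          rw [Real.sqrt_mul (by positivity), Real.sqrt_sq hM0, Real.sqrt_mul (by positivity),
            Real.sqrt_sq (by positivity), ruessmannConst]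
          ring
  have hns : Summable fun k => ‖fcoeff u k * expC k θ -
      (if k = 0 then fcoeff u 0 * expC 0 θ else 0)‖ :=
    summable_of_sum_le (fun _ => norm_nonneg _) hfin
  rw [← hsub.tsum_eq]
  exact (norm_tsum_le_tsum_norm hns).trans
    (hns.tsum_le_of_sum_le hfin)

end Divisors

end QuasiNewton

namespace QuasiNewton

open MeasureTheory Set Filter Topology

/-! ### Solution of the small divisor equation -/

section Existence

variable {n : ℕ} {γ σ ρ : ℝ} {ω : Fin n → ℝ}

theorem convex_strip (n : ℕ) (ρ : ℝ) : Convex ℝ (strip n ρ) := by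
  have : strip n ρ = Set.univ.pi fun _ : Fin n => {z : ℂ | |z.im| < ρ} := by ext; simp [strip]
  rw [this]
  refine convex_pi fun j _ => ?_
  have h2 : {z : ℂ | |z.im| < ρ} = Complex.imLm ⁻¹' Ioo (-ρ) ρ := by
    ext z; simp [abs_lt]
  rw [h2]
  exact (convex_Ioo (-ρ) ρ).linear_preimage Complex.imLm

theorem norm_expC_deriv_le (k : Fin n → ℤ) :
    ‖(2 * Real.pi * Complex.I : ℂ) •
      ∑ j, (k j : ℂ) • ContinuousLinearMap.proj (R := ℂ) (φ := fun _ : Fin n => ℂ) j‖ ≤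
      2 * Real.pi * degree k := by
  refine ContinuousLinearMap.opNorm_le_bound _ (by positivity) fun v => ?_
  simp only [_root_.smul_apply, _root_.sum_apply, ContinuousLinearMap.proj_apply, smul_eq_mul,
    norm_mul, Complex.norm_ofNat, Complex.norm_real, Complex.norm_I, mul_one, Real.norm_eq_abs,
    abs_of_pos Real.pi_pos]
  rw [mul_assoc (2 * Real.pi)]
  refine mul_le_mul_of_nonneg_left ?_ (by positivity)
  rw [degree_cast, Finset.sum_mul]
  refine (norm_sum_le _ _).trans (Finset.sum_le_sum fun j _ => ?_)
  rw [norm_mul, Complex.norm_intCast]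
  exact mul_le_mul_of_nonneg_left (norm_le_pi_norm v j) (abs_nonneg _)

theorem conj_expC_toC (k : Fin n → ℤ) (t : Fin n → ℝ) :
    (starRingEnd ℂ) (expC k (toC t)) = expC (-k) (toC t) := by
  rw [expC, expC, ← Complex.exp_conj]
  congr 1
  simp only [map_mul, map_sum, map_ofNat, Complex.conj_ofReal, Complex.conj_I, toC,
    map_intCast, Pi.neg_apply, Int.cast_neg, neg_mul, Finset.sum_neg_distrib]
  ring

/-- The small divisor equation `∂_ω u = f` has a periodic holomorphic solution if `f` has average
zero: its Fourier series is `∑ f̂_k (2 π i k · ω)⁻¹ exp (2 π i k · θ)`. -/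
theorem HolPeriodic.exists_primitive {f : (Fin n → ℂ) → ℂ}
    (hω : IsDiophantine γ σ ω) (hγ : 0 < γ) (hσ : 0 < σ) (hρ : 0 < ρ)
    (hf : HolPeriodic ρ f) (havg : average f = 0)
    (hreal : ∀ t : Fin n → ℝ, (starRingEnd ℂ) (f (toC t)) = f (toC t)) :
    ∃ u, HolPeriodic ρ u ∧ (∀ θ ∈ strip n ρ, fderiv ℂ u θ (toC ω) = f θ) ∧
      ∀ t : Fin n → ℝ, (starRingEnd ℂ) (u (toC t)) = u (toC t) := by
  set κ : (Fin n → ℤ) → ℂ := fun k => 2 * Real.pi * Complex.I * ((∑ j, (k j : ℝ) * ω j : ℝ) : ℂ)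
    with hκ
  set a : (Fin n → ℤ) → ℂ := fun k => fcoeff f k / κ k with ha
  set u : (Fin n → ℂ) → ℂ := fun θ => ∑' k, a k * expC k θ with hu
  set L : (Fin n → ℤ) → (Fin n → ℂ) →L[ℂ] ℂ := fun k => (2 * Real.pi * Complex.I : ℂ) •
      ∑ j, (k j : ℂ) • ContinuousLinearMap.proj (R := ℂ) (φ := fun _ : Fin n => ℂ) j with hL
  have hLω : ∀ k, L k (toC ω) = κ k := fun k => by
    simp only [hL, hκ, _root_.smul_apply, _root_.sum_apply, ContinuousLinearMap.proj_apply,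
      smul_eq_mul, toC]
    push_cast; ring
  have hakκ : ∀ k, a k * κ k = fcoeff f k := by
    intro k
    by_cases hk : k = 0
    · rw [hk, fcoeff_zero, havg]; simp [hκ]
    · have : κ k ≠ 0 := by
        have := hω.pos hγ hk
        simp only [hκ, ne_eq, mul_eq_zero, not_or]
        exact ⟨by simp [Real.pi_ne_zero], by exact_mod_cast abs_pos.1 this⟩
      rw [ha]; field_simp
  have ha_le : ∀ k, ‖a k‖ ≤ ‖fcoeff f k‖ * (γ⁻¹ * (degree k : ℝ) ^ σ) := by
    intro k
    by_cases hk : k = 0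
    · subst hk; simp [ha, hκ]; positivity
    · have hd : (0 : ℝ) < degree k := by exact_mod_cast degree_pos hk
      have h1 := hω.lower hγ hσ.le hk le_rfl
      have hpos := hω.pos hγ hk
      rw [ha]
      simp only [norm_div, hκ, norm_mul, Complex.norm_ofNat, Complex.norm_real, Complex.norm_I,
        mul_one, Real.norm_eq_abs, abs_of_pos Real.pi_pos]
      rw [div_eq_mul_inv]
      refine mul_le_mul_of_nonneg_left ?_ (norm_nonneg _)
      have h2 : γ⁻¹ * (degree k : ℝ) ^ σ = (γ * (degree k : ℝ) ^ (-σ))⁻¹ := by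
        rw [mul_inv, Real.rpow_neg hd.le, inv_inv]
      rw [h2]
      refine inv_anti₀ (by positivity) (h1.trans ?_)
      have : 1 ≤ 2 * Real.pi := by linarith [Real.pi_gt_three]
      exact le_mul_of_one_le_left hpos.le this
  have key : ∀ ρ'' < ρ, 0 ≤ ρ'' → ∃ b : (Fin n → ℤ) → ℝ, Summable b ∧
      (∀ k, ∀ θ ∈ closedStrip n ρ'', ‖a k * expC k θ‖ ≤ b k) ∧
      (∀ k, ∀ θ ∈ closedStrip n ρ'', ‖a k • expC k θ • L k‖ ≤ b k) := by
    intro ρ'' hρ'' h0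
    obtain ⟨ρ', h1, h2⟩ := exists_between hρ''
    obtain ⟨M, hM0, hM⟩ := hf.exists_bound h2
    set c := 2 * Real.pi * (ρ' - ρ'') with hc
    have hcpos : 0 < c := mul_pos Real.two_pi_pos (sub_pos.2 h1)
    set p := σ + 1 with hp
    have hppos : 0 < p := by positivity
    set A : ℝ := M * γ⁻¹ * (2 * Real.pi) * ((2 / c) ^ p * p ^ p) with hA
    have hbase : ∀ k : Fin n → ℤ, k ≠ 0 → ∀ θ ∈ closedStrip n ρ'',
        ‖a k * expC k θ‖ * (2 * Real.pi * degree k) ≤ A * Real.exp (-(c / 2 * degree k)) := by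
      intro k hk θ hθ
      have hd : (0 : ℝ) < degree k := by exact_mod_cast degree_pos hk
      have h3 : ‖a k * expC k θ‖ ≤ (M * Real.exp (-(2 * Real.pi * ρ' * degree k))) *
          (γ⁻¹ * (degree k : ℝ) ^ σ) * Real.exp (2 * Real.pi * ρ'' * degree k) := by
        rw [norm_mul]
        refine mul_le_mul ((ha_le k).trans ?_) (norm_expC_le k hθ) (norm_nonneg _) (by positivity)
        exact mul_le_mul_of_nonneg_right (hf.norm_fcoeff_le h2 (h0.trans h1.le) hM k)
          (by positivity)
      have h4 : Real.exp (-(2 * Real.pi * ρ' * degree k)) * Real.exp (2 * Real.pi * ρ'' * degree k)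
          = Real.exp (-(c / 2 * degree k)) * Real.exp (-(c / 2 * degree k)) := by
        rw [← Real.exp_add, ← Real.exp_add]; congr 1; rw [hc]; ring
      have h5 := rpow_mul_exp_neg_le (p := p) (x := c / 2 * degree k) hppos (by positivity)
      have h6 : (degree k : ℝ) ^ σ * degree k = (2 / c) ^ p * (c / 2 * degree k) ^ p := by
        rw [← Real.mul_rpow (by positivity) (by positivity), hp]
        have : 2 / c * (c / 2 * (degree k : ℝ)) = degree k := by field_simp
        rw [this, Real.rpow_add hd, Real.rpow_one]
      calc ‖a k * expC k θ‖ * (2 * Real.pi * degree k)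
          ≤ ((M * Real.exp (-(2 * Real.pi * ρ' * degree k))) *
          (γ⁻¹ * (degree k : ℝ) ^ σ) * Real.exp (2 * Real.pi * ρ'' * degree k)) *
            (2 * Real.pi * degree k) := by gcongr
        _ = M * γ⁻¹ * (2 * Real.pi) * (Real.exp (-(2 * Real.pi * ρ' * degree k)) *
            Real.exp (2 * Real.pi * ρ'' * degree k)) * ((degree k : ℝ) ^ σ * degree k) := by ring
        _ = M * γ⁻¹ * (2 * Real.pi) * ((2 / c) ^ p * ((c / 2 * degree k) ^ p *
            Real.exp (-(c / 2 * degree k)))) * Real.exp (-(c / 2 * degree k)) := by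
            rw [h4, h6]; ring
        _ ≤ A * Real.exp (-(c / 2 * degree k)) := by rw [hA]; gcongr
    have hA0 : 0 ≤ A := by positivity
    have ha0 : a 0 = 0 := by simp [ha, hκ]
    refine ⟨fun k => A * Real.exp (-(c / 2 * degree k)),
      (summable_exp_neg_degree n (half_pos hcpos)).mul_left A, fun k θ hθ => ?_, fun k θ hθ => ?_⟩
    · by_cases hk : k = 0
      · subst hk; rw [ha0]; simp only [zero_mul, norm_zero]; positivity
      · have hd : (1 : ℝ) ≤ degree k := by exact_mod_cast degree_pos hk
        refine le_trans (le_mul_of_one_le_right (norm_nonneg _) ?_) (hbase k hk θ hθ)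
        nlinarith [Real.pi_gt_three]
    · by_cases hk : k = 0
      · subst hk; rw [norm_smul, ha0, norm_zero, zero_mul]; positivity
      · refine le_trans ?_ (hbase k hk θ hθ)
        rw [smul_smul, norm_smul]
        exact mul_le_mul_of_nonneg_left (norm_expC_deriv_le k) (norm_nonneg _)
  have hfd : ∀ θ ∈ strip n ρ, HasFDerivAt u (∑' k, a k • expC k θ • L k) θ ∧
      Summable fun k => a k • expC k θ • L k := by
    intro θ hθ
    obtain ⟨ρ'', h1, h2, h3⟩ := exists_mem_closedStrip hρ hθ
    obtain ⟨ρ', h4, h5⟩ := exists_between h1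
    obtain ⟨b, hb, hb1, hb2⟩ := key ρ' h5 (h2.trans h4.le)
    have h6 : θ ∈ strip n ρ' := closedStrip_subset_strip h4 h3
    refine ⟨hasFDerivAt_tsum_of_isPreconnected (u := b) hb (isOpen_strip n ρ')
      (convex_strip n ρ').isPreconnected (f := fun k θ => a k * expC k θ)
      (f' := fun k θ => a k • expC k θ • L k)
      (fun k x _ => (hasFDerivAt_expC k x).const_mul (a k))
      (fun k x hx => hb2 k x (strip_subset_closedStrip le_rfl hx)) h6
      (Summable.of_norm_bounded hb fun k => hb1 k θ (strip_subset_closedStrip le_rfl h6)) h6,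
      Summable.of_norm_bounded hb fun k => hb2 k θ (strip_subset_closedStrip le_rfl h6)⟩
  refine ⟨u, ⟨fun θ hθ => (hfd θ hθ).1.differentiableAt.differentiableWithinAt, fun m θ _ => ?_⟩,
    fun θ hθ => ?_, fun t => ?_⟩
  · simp only [hu, expC_periodic]
  · obtain ⟨h1, h2⟩ := hfd θ hθ
    rw [h1.fderiv, show (∑' k, a k • expC k θ • L k) (toC ω) =
      ∑' k, (a k • expC k θ • L k) (toC ω) from
      (ContinuousLinearMap.apply ℂ ℂ (toC ω)).map_tsum h2]
    obtain ⟨ρ'', h3, h4, h5⟩ := exists_mem_closedStrip hρ hθ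
    rw [← (hf.hasSum_fourier h3 h4 h5).2.tsum_eq]
    refine tsum_congr fun k => ?_
    rw [_root_.smul_apply, _root_.smul_apply, hLω, smul_eq_mul, smul_eq_mul,
      mul_left_comm, hakκ, mul_comm]
  · have hfc : ∀ k, (starRingEnd ℂ) (fcoeff f k) = fcoeff f (-k) := by
      intro k
      rw [fcoeff, fcoeff, cubeCoeff, cubeCoeff, cubeAvg, cubeAvg, ← integral_conj]
      congr 1
      ext s
      rw [map_mul, hreal, conj_expC_toC]
    have hac : ∀ k, (starRingEnd ℂ) (a k) = a (-k) := by
      intro k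
      simp only [ha, map_div₀, hfc, hκ, map_mul, Complex.conj_I, Complex.conj_ofReal, map_ofNat,
        Pi.neg_apply, Int.cast_neg, neg_mul, Finset.sum_neg_distrib, Complex.ofReal_neg]
      congr 1
      ring
    simp only [hu]
    rw [Complex.conj_tsum, ← (Equiv.neg (Fin n → ℤ)).tsum_eq fun k => a k * expC k (toC t)]
    refine tsum_congr fun k => ?_
    rw [map_mul, hac, conj_expC_toC, Equiv.neg_apply]

end Existence
end QuasiNewton

namespace QuasiNewton

open Matrix

/-! ### The operator norm of complex matrices -/

section MatrixNorm

variable {p q m : Type*} [Fintype p] [Fintype q] [Fintype m]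

theorem norm_entry_le (A : Matrix p q ℂ) (i : p) (j : q) : ‖A i j‖ ≤ ‖A‖ := by
  rw [linfty_opNorm_def]
  have h1 : ‖A i j‖₊ ≤ ∑ j, ‖A i j‖₊ :=
    Finset.single_le_sum (f := fun j => ‖A i j‖₊) (fun _ _ => zero_le) (Finset.mem_univ j)
  exact_mod_cast h1.trans (Finset.le_sup (f := fun i => ∑ j, ‖A i j‖₊) (Finset.mem_univ i))

theorem norm_le_of_rowSum {A : Matrix p q ℂ} {M : ℝ} (hM : 0 ≤ M)
    (h : ∀ i, ∑ j, ‖A i j‖ ≤ M) : ‖A‖ ≤ M := by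
  rw [linfty_opNorm_def]
  have : (Finset.univ.sup fun i => ∑ j, ‖A i j‖₊) ≤ (⟨M, hM⟩ : NNReal) := by
    refine Finset.sup_le fun i _ => NNReal.coe_le_coe.1 ?_
    rw [NNReal.coe_sum]
    exact h i
  exact_mod_cast this

theorem norm_le_of_entries {A : Matrix p q ℂ} {M : ℝ} (hM : 0 ≤ M)
    (h : ∀ i j, ‖A i j‖ ≤ M) : ‖A‖ ≤ Fintype.card q * M := by
  refine norm_le_of_rowSum (by positivity) fun i => ?_
  refine (Finset.sum_le_sum fun j _ => h i j).trans ?_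
  simp

theorem norm_transpose_le (A : Matrix p q ℂ) : ‖Aᵀ‖ ≤ Fintype.card p * ‖A‖ :=
  norm_le_of_entries (norm_nonneg _) fun i j => norm_entry_le A j i

theorem norm_one_le [DecidableEq p] : ‖(1 : Matrix p p ℂ)‖ ≤ 1 := by
  refine norm_le_of_rowSum zero_le_one fun i => ?_
  rw [Finset.sum_eq_single i (fun j _ hj => by simp [one_apply_ne hj.symm]) (by simp)]
  simp

theorem norm_entry_le_maxNorm {a b : ℕ} (A : Matrix (Fin a) (Fin b) ℂ) (i : Fin a) (j : Fin b) :
    ‖A i j‖ ≤ maxNorm A :=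
  (le_ciSup (f := fun j => ‖A i j‖) (Set.finite_range _).bddAbove j).trans
    (le_ciSup (f := fun i => ⨆ j, ‖A i j‖) (Set.finite_range _).bddAbove i)

theorem maxNorm_nonneg {a b : ℕ} (A : Matrix (Fin a) (Fin b) ℂ) : 0 ≤ maxNorm A :=
  Real.iSup_nonneg fun _ => Real.iSup_nonneg fun _ => norm_nonneg _

theorem maxNorm_le {a b : ℕ} {A : Matrix (Fin a) (Fin b) ℂ} {M : ℝ} (hM : 0 ≤ M)
    (h : ∀ i j, ‖A i j‖ ≤ M) : maxNorm A ≤ M :=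
  Real.iSup_le (fun i => Real.iSup_le (fun j => h i j) hM) hM

theorem norm_le_maxNorm {a b : ℕ} (A : Matrix (Fin a) (Fin b) ℂ) : ‖A‖ ≤ b * maxNorm A := by
  simpa using norm_le_of_entries (maxNorm_nonneg A) (norm_entry_le_maxNorm A)

variable [DecidableEq m]

theorem isUnit_det_one_add {E : Matrix m m ℂ} (hE : ‖E‖ ≤ 1 / 2) : IsUnit (1 + E).det := by
  rw [isUnit_iff_ne_zero]
  intro h0
  obtain ⟨v, hv, hv0⟩ := exists_mulVec_eq_zero_iff.2 h0
  rw [add_mulVec, one_mulVec] at hv0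
  have h1 : ‖v‖ = ‖E *ᵥ v‖ := by
    rw [← norm_neg (E *ᵥ v), ← eq_neg_of_add_eq_zero_left hv0]
  have h2 : ‖E *ᵥ v‖ ≤ ‖E‖ * ‖v‖ := linfty_opNorm_mulVec E v
  have h3 : 0 < ‖v‖ := norm_pos_iff.2 hv
  nlinarith

/-- Perturbation of the inverse of a matrix. -/
theorem inv_perturbation {M M' : Matrix m m ℂ} (hM : IsUnit M.det)
    (h : ‖M⁻¹‖ * ‖M' - M‖ ≤ 1 / 2) :
    IsUnit M'.det ∧ ‖M'⁻¹‖ ≤ 2 * ‖M⁻¹‖ ∧ ‖M'⁻¹ - M⁻¹‖ ≤ 2 * ‖M⁻¹‖ ^ 2 * ‖M' - M‖ := by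
  have hfac : M' = M * (1 + M⁻¹ * (M' - M)) := by
    rw [mul_add, mul_one, ← mul_assoc, mul_nonsing_inv M hM, one_mul]
    abel
  have hu : IsUnit M'.det := by
    rw [hfac, det_mul]
    exact hM.mul (isUnit_det_one_add ((linfty_opNorm_mul _ _).trans h))
  have hdiff : M'⁻¹ - M⁻¹ = -(M'⁻¹ * (M' - M) * M⁻¹) := by
    rw [mul_sub, sub_mul, nonsing_inv_mul M' hu, mul_assoc, mul_nonsing_inv M hM]
    simp
  have hn : ‖M'⁻¹ - M⁻¹‖ ≤ ‖M'⁻¹‖ * ‖M' - M‖ * ‖M⁻¹‖ := by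
    rw [hdiff, norm_neg]
    refine (linfty_opNorm_mul _ _).trans ?_
    exact mul_le_mul_of_nonneg_right (linfty_opNorm_mul _ _) (norm_nonneg _)
  have h2 : ‖M'⁻¹‖ ≤ 2 * ‖M⁻¹‖ := by
    have h3 : ‖M'⁻¹‖ ≤ ‖M⁻¹‖ + ‖M'⁻¹ - M⁻¹‖ := by
      calc ‖M'⁻¹‖ = ‖M⁻¹ + (M'⁻¹ - M⁻¹)‖ := by congr 1; abel
        _ ≤ _ := norm_add_le _ _
    nlinarith [norm_nonneg M'⁻¹, norm_nonneg M⁻¹, norm_nonneg (M' - M)]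
  refine ⟨hu, h2, hn.trans ?_⟩
  have : 0 ≤ ‖M' - M‖ * ‖M⁻¹‖ := by positivity
  nlinarith

end MatrixNorm

/-! ### Bounds by powers of one constant -/

/-- `‖a‖ ≤ Q^k x`: every estimate of the step is a bound by a power of one constant `Q`, times
a factor `x` that carries the dependence on the error and on the small divisors. -/
def PowBound {E : Type*} [Norm E] (Q : ℝ) (k : ℕ) (x : ℝ) (a : E) : Prop := ‖a‖ ≤ Q ^ k * x

section PowBound

variable {E : Type*} [SeminormedAddCommGroup E] {Q x y : ℝ} {k l : ℕ} {a b : E}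

theorem PowBound.mono (hQ : 2 ≤ Q) (h : PowBound Q k x a) (hx : 0 ≤ x) (hkl : k ≤ l)
    (hxy : x ≤ y) : PowBound Q l y a := by
  have : 1 ≤ Q := by linarith
  exact le_trans h (mul_le_mul (pow_le_pow_right₀ this hkl) hxy hx (by positivity))

theorem PowBound.add (hQ : 2 ≤ Q) (hx : 0 ≤ x) (ha : PowBound Q k x a) (hb : PowBound Q l x b) :
    PowBound Q (max k l + 1) x (a + b) := by
  have ha' := ha.mono hQ hx (le_max_left k l) le_rfl
  have hb' := hb.mono hQ hx (le_max_right k l) le_rfl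
  unfold PowBound at *
  have h0 : 0 ≤ Q ^ max k l * x := by positivity
  calc ‖a + b‖ ≤ ‖a‖ + ‖b‖ := norm_add_le _ _
    _ ≤ 2 * (Q ^ max k l * x) := by linarith
    _ ≤ Q * (Q ^ max k l * x) := by gcongr
    _ = Q ^ (max k l + 1) * x := by ring

theorem PowBound.neg (ha : PowBound Q k x a) : PowBound Q k x (-a) := by
  simpa [PowBound] using ha

theorem PowBound.sub (hQ : 2 ≤ Q) (hx : 0 ≤ x) (ha : PowBound Q k x a) (hb : PowBound Q l x b) :
    PowBound Q (max k l + 1) x (a - b) := by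
  rw [sub_eq_add_neg]; exact ha.add hQ hx hb.neg

variable {p q m : Type*} [Fintype p] [Fintype q] [Fintype m]

theorem PowBound.mul (hQ : 2 ≤ Q) (hx : 0 ≤ x) {A : Matrix p q ℂ} {B : Matrix q m ℂ}
    (hA : PowBound Q k x A) (hB : PowBound Q l y B) : PowBound Q (k + l) (x * y) (A * B) := by
  refine (linfty_opNorm_mul A B).trans ((mul_le_mul hA hB (norm_nonneg _) ?_).trans_eq ?_)
  · positivity
  · ring

theorem PowBound.mulVec (hQ : 2 ≤ Q) (hx : 0 ≤ x) {A : Matrix p q ℂ} {v : q → ℂ}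
    (hA : PowBound Q k x A) (hv : PowBound Q l y v) : PowBound Q (k + l) (x * y) (A *ᵥ v) := by
  refine (linfty_opNorm_mulVec A v).trans ((mul_le_mul hA hv (norm_nonneg _) ?_).trans_eq ?_)
  · positivity
  · ring

theorem PowBound.transpose {A : Matrix p q ℂ} (hp : (Fintype.card p : ℝ) ≤ Q)
    (hA : PowBound Q k x A) : PowBound Q (k + 1) x Aᵀ := by
  have hQ : 0 ≤ Q := le_trans (by positivity) hp
  refine (norm_transpose_le A).trans ((mul_le_mul hp hA (norm_nonneg _) hQ).trans_eq ?_)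
  ring

theorem powBound_one [DecidableEq p] : PowBound Q 0 1 (1 : Matrix p p ℂ) := by
  simpa [PowBound] using norm_one_le (p := p)

end PowBound

/-- `a` and `a'` are bounded by `Q^k` and differ by at most `Q^k τ`. -/
structure PowClose {E : Type*} [SeminormedAddCommGroup E] (Q τ : ℝ) (k : ℕ) (a a' : E) : Prop where
  left : PowBound Q k 1 a
  right : PowBound Q k 1 a'
  diff : PowBound Q k τ (a' - a)

section PowClose

variable {E : Type*} [SeminormedAddCommGroup E] {Q τ : ℝ} {k l : ℕ} {a a' b b' : E}

theorem PowClose.mono (hQ : 2 ≤ Q) (hτ : 0 ≤ τ) (h : PowClose Q τ k a a') (hkl : k ≤ l) :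
    PowClose Q τ l a a' :=
  ⟨h.left.mono hQ zero_le_one hkl le_rfl, h.right.mono hQ zero_le_one hkl le_rfl,
    h.diff.mono hQ hτ hkl le_rfl⟩

theorem PowClose.add (hQ : 2 ≤ Q) (hτ : 0 ≤ τ) (ha : PowClose Q τ k a a')
    (hb : PowClose Q τ l b b') : PowClose Q τ (max k l + 1) (a + b) (a' + b') :=
  ⟨ha.left.add hQ zero_le_one hb.left, ha.right.add hQ zero_le_one hb.right, by
    rw [add_sub_add_comm]; exact ha.diff.add hQ hτ hb.diff⟩

theorem PowClose.neg (ha : PowClose Q τ k a a') : PowClose Q τ k (-a) (-a') :=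
  ⟨ha.left.neg, ha.right.neg, by rw [← neg_sub']; exact ha.diff.neg⟩

theorem PowClose.sub (hQ : 2 ≤ Q) (hτ : 0 ≤ τ) (ha : PowClose Q τ k a a')
    (hb : PowClose Q τ l b b') : PowClose Q τ (max k l + 1) (a - b) (a' - b') := by
  rw [sub_eq_add_neg, sub_eq_add_neg]; exact ha.add hQ hτ hb.neg

variable {p q m : Type*} [Fintype p] [Fintype q] [Fintype m]

theorem PowClose.mul (hQ : 2 ≤ Q) (hτ : 0 ≤ τ) {A A' : Matrix p q ℂ} {B B' : Matrix q m ℂ}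
    (hA : PowClose Q τ k A A') (hB : PowClose Q τ l B B') :
    PowClose Q τ (k + l + 1) (A * B) (A' * B') := by
  refine ⟨(hA.left.mul hQ zero_le_one hB.left).mono hQ (by simp) (Nat.le_succ _) (by simp),
    (hA.right.mul hQ zero_le_one hB.right).mono hQ (by simp) (Nat.le_succ _) (by simp), ?_⟩
  have h : A' * B' - A * B = (A' - A) * B' + A * (B' - B) := by
    rw [Matrix.sub_mul, Matrix.mul_sub]; abel
  rw [h]
  have h1 := hA.diff.mul hQ hτ hB.right
  have h2 := hA.left.mul hQ zero_le_one hB.diff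
  rw [mul_one] at h1
  rw [one_mul] at h2
  simpa using h1.add hQ hτ h2

theorem PowClose.mulVec (hQ : 2 ≤ Q) (hτ : 0 ≤ τ) {A A' : Matrix p q ℂ} {B B' : q → ℂ}
    (hA : PowClose Q τ k A A') (hB : PowClose Q τ l B B') :
    PowClose Q τ (k + l + 1) (A *ᵥ B) (A' *ᵥ B') := by
  refine ⟨(hA.left.mulVec hQ zero_le_one hB.left).mono hQ (by simp) (Nat.le_succ _) (by simp),
    (hA.right.mulVec hQ zero_le_one hB.right).mono hQ (by simp) (Nat.le_succ _) (by simp), ?_⟩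
  have h : A' *ᵥ B' - A *ᵥ B = (A' - A) *ᵥ B' + A *ᵥ (B' - B) := by
    rw [Matrix.sub_mulVec, Matrix.mulVec_sub]; abel
  rw [h]
  have h1 := hA.diff.mulVec hQ hτ hB.right
  have h2 := hA.left.mulVec hQ zero_le_one hB.diff
  rw [mul_one] at h1
  rw [one_mul] at h2
  simpa using h1.add hQ hτ h2

theorem PowClose.transpose {A A' : Matrix p q ℂ}
    (hp : (Fintype.card p : ℝ) ≤ Q) (hA : PowClose Q τ k A A') :
    PowClose Q τ (k + 1) Aᵀ A'ᵀ :=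
  ⟨hA.left.transpose hp, hA.right.transpose hp, by
    rw [← transpose_sub]; exact hA.diff.transpose hp⟩

end PowClose

/-! ### The approximately Lagrangian frame -/

section Frame

variable {n : ℕ} {X : Matrix (Fin (2 * n)) (Fin n) ℂ} {B Bi : Matrix (Fin (2 * n)) (Fin (2 * n)) ℂ}
  {N : Matrix (Fin n) (Fin n) ℂ}

/-- The matrix `-N Xᵀ B X N`, the correction that makes the first block row
`G Xᵀ B⁻¹ + N Xᵀ` of the approximate inverse of the frame `(X, B X N)` annihilate `B X N`. -/
def frameG (X : Matrix (Fin (2 * n)) (Fin n) ℂ) (B : Matrix (Fin (2 * n)) (Fin (2 * n)) ℂ)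
    (N : Matrix (Fin n) (Fin n) ℂ) : Matrix (Fin n) (Fin n) ℂ :=
  -(N * Xᵀ * B * X * N)

/-- The defect `1 - V W` of the approximate inverse `W` of the frame `V = (X, B X N)`, whose block
rows are `G Xᵀ B⁻¹ + N Xᵀ` with `G = -N Xᵀ B X N`, and `Xᵀ B⁻¹`. The matrix `B⁻¹` is a separate
argument `Bi`. -/
def frameDefect (X : Matrix (Fin (2 * n)) (Fin n) ℂ) (B Bi : Matrix (Fin (2 * n)) (Fin (2 * n)) ℂ)
    (N : Matrix (Fin n) (Fin n) ℂ) : Matrix (Fin (2 * n)) (Fin (2 * n)) ℂ :=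
  1 - (X * (frameG X B N * Xᵀ * Bi + N * Xᵀ) + B * X * N * (Xᵀ * Bi))

/-- If `X` spans an almost isotropic subspace, the defect is small. The frame `V` is a square
matrix, so that the left inverse of `V` obtained from `W V = 1 + O(Xᵀ B⁻¹ X)` is a right inverse. -/
theorem frameDefect_eq (hB : Bi * B = 1) (hN : Xᵀ * X * N = 1) (hN' : N * (Xᵀ * X) = 1)
    {F : Matrix (Fin n) (Fin n) ℂ} (hF : F * (1 + frameG X B N * (Xᵀ * Bi * X)) = 1)
    (hF' : (1 + frameG X B N * (Xᵀ * Bi * X)) * F = 1) :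
    frameDefect X B Bi N = -((X * frameG X B N + B * X * N) * (Xᵀ * Bi * X) * F *
      (frameG X B N * Xᵀ * Bi + N * Xᵀ)) := by
  set G := frameG X B N with hG
  set L := Xᵀ * Bi * X with hL
  set Y := B * X * N with hY
  set W1 := G * Xᵀ * Bi + N * Xᵀ with hW1
  set W2 := Xᵀ * Bi with hW2
  have h2Y : W2 * Y = 1 := by
    calc W2 * Y = Xᵀ * (Bi * B) * X * N := by rw [hW2, hY]; simp only [Matrix.mul_assoc]
      _ = 1 := by rw [hB, Matrix.mul_one, hN]
  have h1X : W1 * X = 1 + G * L := by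
    rw [hW1, Matrix.add_mul, add_comm, Matrix.mul_assoc N, hN', hL, hW2]
    simp only [Matrix.mul_assoc]
  have h1Y : W1 * Y = 0 := by
    have e1 : W1 = G * W2 + N * Xᵀ := by rw [hW1, hW2, Matrix.mul_assoc]
    rw [e1, Matrix.add_mul, Matrix.mul_assoc, h2Y, Matrix.mul_one, hG, frameG, hY]
    simp only [Matrix.mul_assoc]
    simp
  have hWV : fromRows (F * W1) (W2 - L * F * W1) * fromCols X Y = 1 := by
    rw [fromRows_mul_fromCols, ← fromBlocks_one]
    congr 1
    · rw [Matrix.mul_assoc, h1X, hF]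
    · rw [Matrix.mul_assoc, h1Y, Matrix.mul_zero]
    · rw [Matrix.sub_mul, Matrix.mul_assoc _ W1, h1X, Matrix.mul_assoc L, hF, Matrix.mul_one,
        hL, sub_self]
    · rw [Matrix.sub_mul, h2Y, Matrix.mul_assoc _ W1, h1Y, Matrix.mul_zero, sub_zero]
  have hVW : fromCols X Y * fromRows (F * W1) (W2 - L * F * W1) = 1 :=
    (mul_eq_one_comm_of_card_eq _ _ _ (by simp [two_mul])).1 hWV
  rw [fromCols_mul_fromRows] at hVW
  have hF1 : F = 1 - G * L * F := by
    rw [Matrix.add_mul, Matrix.one_mul] at hF'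
    rw [← hF']; abel
  rw [frameDefect, ← hG, ← hY, ← hW1, ← hW2]
  have h3 : X * W1 = X * (F * W1) + X * (G * L * F * W1) := by
    rw [← Matrix.mul_add, ← Matrix.add_mul]
    congr 2
    nth_rewrite 1 [hF1]
    rw [sub_add_cancel, Matrix.one_mul]
  rw [← hVW, h3, Matrix.mul_sub]
  simp only [Matrix.add_mul, Matrix.mul_assoc]
  abel

theorem norm_frameDefect_le {Q : ℝ} (hQ : 2 ≤ Q) (hn : (2 * n : ℕ) ≤ Q)
    (hB : Bi * B = 1) (hN : Xᵀ * X * N = 1) (hN' : N * (Xᵀ * X) = 1)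
    (hXQ : PowBound Q 1 1 X) (hNQ : PowBound Q 1 1 N) (hBQ : PowBound Q 1 1 B)
    (hBiQ : PowBound Q 1 1 Bi) {x : ℝ} (hL : ‖Xᵀ * Bi * X‖ ≤ x) (hx : Q ^ 6 * x ≤ 1 / 2) :
    PowBound Q 19 x (frameDefect X B Bi N) := by
  have h1 : (0 : ℝ) ≤ 1 := zero_le_one
  have hx0 : 0 ≤ x := (norm_nonneg _).trans hL
  have hXt : PowBound Q 2 1 Xᵀ := hXQ.transpose (by simpa using hn)
  have hGQ : PowBound Q 6 1 (frameG X B N) := by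
    have := ((((hNQ.mul hQ h1 hXt).mul hQ (by simp) hBQ).mul hQ (by simp) hXQ).mul hQ (by simp)
      hNQ).neg
    simpa [frameG] using this
  have hE : ‖frameG X B N * (Xᵀ * Bi * X)‖ ≤ 1 / 2 := by
    refine (linfty_opNorm_mul _ _).trans (le_trans ?_ hx)
    have := hGQ
    rw [PowBound, mul_one] at this
    exact mul_le_mul this hL (norm_nonneg _) (by positivity)
  have hu := isUnit_det_one_add hE
  have hinv := inv_perturbation (M := (1 : Matrix (Fin n) (Fin n) ℂ))
    (M' := 1 + frameG X B N * (Xᵀ * Bi * X)) (by simp) (by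
      rw [inv_one, add_sub_cancel_left]
      refine le_trans ?_ hE
      exact mul_le_of_le_one_left (norm_nonneg _) norm_one_le)
  rw [frameDefect_eq hB hN hN' (nonsing_inv_mul _ hu) (mul_nonsing_inv _ hu)]
  have hFQ : PowBound Q 1 1 (1 + frameG X B N * (Xᵀ * Bi * X))⁻¹ := by
    have h3 := hinv.2.1
    rw [inv_one] at h3
    have h4 := norm_one_le (p := Fin n)
    rw [PowBound]
    linarith
  have hLQ : PowBound Q 0 x (Xᵀ * Bi * X) := by simpa [PowBound] using hL
  have hXGY : PowBound Q 8 1 (X * frameG X B N + B * X * N) := by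
    have e1 := hXQ.mul hQ h1 hGQ
    have e2 := (hBQ.mul hQ h1 hXQ).mul hQ (by simp) hNQ
    rw [one_mul] at e1 e2
    rw [one_mul] at e2
    simpa using e1.add hQ h1 e2
  have hW1 : PowBound Q 10 1 (frameG X B N * Xᵀ * Bi + N * Xᵀ) := by
    have e1 := (hGQ.mul hQ h1 hXt).mul hQ (by simp) hBiQ
    have e2 := hNQ.mul hQ h1 hXt
    rw [one_mul] at e1 e2
    rw [one_mul] at e1
    simpa using e1.add hQ h1 e2
  have := (((hXGY.mul hQ h1 hLQ).mul hQ (by simpa using hx0) hFQ).mul hQ (by simpa using hx0)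
    hW1).neg
  simpa using this

end Frame

end QuasiNewton

namespace QuasiNewton

open Matrix Filter Topology

/-! ### Real analytic periodic functions, vectors and matrices -/

/-- `g` is holomorphic and periodic on `U_ρ` and real on `ℝⁿ`. -/
structure RealHol {n : ℕ} (ρ : ℝ) (g : (Fin n → ℂ) → ℂ) : Prop where
  hol : HolPeriodic ρ g
  real : ∀ t : Fin n → ℝ, (starRingEnd ℂ) (g (toC t)) = g (toC t)

section RealHol

variable {n : ℕ} {ρ : ℝ} {g h : (Fin n → ℂ) → ℂ}

theorem RealHol.add (hg : RealHol ρ g) (hh : RealHol ρ h) : RealHol ρ fun θ => g θ + h θ :=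
  ⟨hg.hol.add hh.hol, fun t => by rw [map_add, hg.real, hh.real]⟩

theorem RealHol.sub (hg : RealHol ρ g) (hh : RealHol ρ h) : RealHol ρ fun θ => g θ - h θ :=
  ⟨hg.hol.sub hh.hol, fun t => by rw [map_sub, hg.real, hh.real]⟩

theorem RealHol.neg (hg : RealHol ρ g) : RealHol ρ fun θ => -g θ :=
  ⟨hg.hol.neg, fun t => by rw [map_neg, hg.real]⟩

theorem RealHol.mul (hg : RealHol ρ g) (hh : RealHol ρ h) : RealHol ρ fun θ => g θ * h θ :=
  ⟨hg.hol.mul hh.hol, fun t => by rw [map_mul, hg.real, hh.real]⟩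

theorem realHol_const {c : ℂ} (hc : (starRingEnd ℂ) c = c) : RealHol (n := n) ρ fun _ => c :=
  ⟨holPeriodic_const c, fun _ => hc⟩

theorem RealHol.sum {ι : Type*} {s : Finset ι} {g : ι → (Fin n → ℂ) → ℂ}
    (hg : ∀ i ∈ s, RealHol ρ (g i)) : RealHol ρ fun θ => ∑ i ∈ s, g i θ :=
  ⟨HolPeriodic.sum fun i hi => (hg i hi).hol, fun t => by
    rw [map_sum]; exact Finset.sum_congr rfl fun i hi => (hg i hi).real t⟩

theorem RealHol.prod {ι : Type*} {s : Finset ι} {g : ι → (Fin n → ℂ) → ℂ}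
    (hg : ∀ i ∈ s, RealHol ρ (g i)) : RealHol ρ fun θ => ∏ i ∈ s, g i θ :=
  ⟨HolPeriodic.prod fun i hi => (hg i hi).hol, fun t => by
    rw [map_prod]; exact Finset.prod_congr rfl fun i hi => (hg i hi).real t⟩

theorem RealHol.inv (hg : RealHol ρ g) (h0 : ∀ θ ∈ strip n ρ, g θ ≠ 0) :
    RealHol ρ fun θ => (g θ)⁻¹ :=
  ⟨⟨hg.hol.diff.inv h0, fun k θ hθ => by rw [hg.hol.periodic k θ hθ]⟩, fun t => by
    rw [map_inv₀, hg.real]⟩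

theorem RealHol.congr (hρ : 0 < ρ) (hg : RealHol ρ g) (hgh : ∀ θ ∈ strip n ρ, h θ = g θ) :
    RealHol ρ h :=
  ⟨hg.hol.congr hgh, fun t => by rw [hgh _ (toC_mem_strip hρ t), hg.real]⟩

/-- A derivative along a real curve of a function with real values is real. -/
theorem conj_eq_of_hasDerivAt {φ : ℝ → ℂ} {φ' : ℂ} (hφ : HasDerivAt φ φ' 0)
    (hr : ∀ᶠ s in 𝓝 (0 : ℝ), (starRingEnd ℂ) (φ s) = φ s) : (starRingEnd ℂ) φ' = φ' := by
  have h1 : HasDerivAt (fun s => star (φ s)) (star φ') 0 := hφ.star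
  have h2 : HasDerivAt φ (star φ') 0 :=
    h1.congr_of_eventuallyEq (hr.mono fun s hs => hs.symm)
  exact h2.unique hφ

theorem RealHol.fderiv_apply (hρ : 0 < ρ) (hg : RealHol ρ g) (v : Fin n → ℝ) :
    RealHol ρ fun θ => fderiv ℂ g θ (toC v) := by
  refine ⟨hg.hol.fderiv_apply _, fun t => ?_⟩
  refine conj_eq_of_hasDerivAt (hg.hol.hasDerivAt_line (toC_mem_strip hρ t) (toC v))
    (Eventually.of_forall fun s => ?_)
  rw [← toC_smul, ← toC_add, hg.real]

theorem toC_single {m : ℕ} (j : Fin m) : toC (Pi.single j (1 : ℝ)) = Pi.single j 1 := by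
  ext i
  by_cases h : i = j
  · subst h; simp [toC]
  · simp [toC, h]

end RealHol

/-- A matrix function all of whose entries are real analytic and periodic. -/
def MatHol {n : ℕ} {p q : Type*} (ρ : ℝ) (F : (Fin n → ℂ) → Matrix p q ℂ) : Prop :=
  ∀ i j, RealHol ρ fun θ => F θ i j

/-- A vector function all of whose components are real analytic and periodic. -/
def VecHol {n : ℕ} {p : Type*} (ρ : ℝ) (f : (Fin n → ℂ) → p → ℂ) : Prop :=
  ∀ i, RealHol ρ fun θ => f θ i

section MatHol

variable {n : ℕ} {ρ : ℝ} {p q m : Type*} [Fintype q]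
  {F F' : (Fin n → ℂ) → Matrix p q ℂ} {G : (Fin n → ℂ) → Matrix q m ℂ}
  {f f' : (Fin n → ℂ) → q → ℂ}

omit [Fintype q] in
theorem MatHol.add (hF : MatHol ρ F) (hF' : MatHol ρ F') : MatHol ρ fun θ => F θ + F' θ :=
  fun i j => (hF i j).add (hF' i j)

omit [Fintype q] in
theorem MatHol.sub (hF : MatHol ρ F) (hF' : MatHol ρ F') : MatHol ρ fun θ => F θ - F' θ :=
  fun i j => (hF i j).sub (hF' i j)

omit [Fintype q] in
theorem MatHol.transpose (hF : MatHol ρ F) : MatHol ρ fun θ => (F θ)ᵀ :=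
  fun i j => hF j i

theorem MatHol.mul (hF : MatHol ρ F) (hG : MatHol ρ G) : MatHol ρ fun θ => F θ * G θ :=
  fun i j => by
    simp only [Matrix.mul_apply]
    exact RealHol.sum fun k _ => (hF i k).mul (hG k j)

theorem MatHol.mulVec (hF : MatHol ρ F) (hf : VecHol ρ f) : VecHol ρ fun θ => F θ *ᵥ f θ :=
  fun i => by
    simp only [Matrix.mulVec, dotProduct]
    exact RealHol.sum fun k _ => (hF i k).mul (hf k)

omit [Fintype q] in
theorem VecHol.add (hf : VecHol ρ f) (hf' : VecHol ρ f') : VecHol ρ fun θ => f θ + f' θ :=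
  fun i => (hf i).add (hf' i)

omit [Fintype q] in
theorem VecHol.sub (hf : VecHol ρ f) (hf' : VecHol ρ f') : VecHol ρ fun θ => f θ - f' θ :=
  fun i => (hf i).sub (hf' i)

omit [Fintype q] in
theorem VecHol.neg (hf : VecHol ρ f) : VecHol ρ fun θ => -f θ := fun i => (hf i).neg

variable [DecidableEq q] {A : (Fin n → ℂ) → Matrix q q ℂ}

omit [Fintype q] in
theorem matHol_one : MatHol (n := n) ρ fun _ => (1 : Matrix q q ℂ) := fun i j =>
  realHol_const (by rw [Matrix.one_apply]; split_ifs <;> simp)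

theorem MatHol.det (hA : MatHol ρ A) : RealHol ρ fun θ => (A θ).det := by
  simp only [Matrix.det_apply']
  exact RealHol.sum fun σ _ => (realHol_const (by simp)).mul
    (RealHol.prod fun i _ => hA _ _)

theorem MatHol.inv (hA : MatHol ρ A) (h : ∀ θ ∈ strip n ρ, IsUnit (A θ).det) :
    MatHol ρ fun θ => (A θ)⁻¹ := fun i j => by
  simp only [Matrix.inv_def, Ring.inverse_eq_inv', Matrix.smul_apply, smul_eq_mul,
    Matrix.adjugate_apply]
  refine (hA.det.inv fun θ hθ => (h θ hθ).ne_zero).mul (MatHol.det fun a b => ?_)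
  simp only [Matrix.updateRow_apply]
  split_ifs
  · refine realHol_const ?_
    by_cases hb : b = i
    · subst hb; simp
    · simp [hb]
  · exact hA a b

end MatHol

/-! ### Directional derivatives of matrix functions -/

/-- `F'` is the derivative of the matrix function `F` at `θ` in the direction `v`. -/
def HasMatDeriv {n : ℕ} {p q : Type*} (F : (Fin n → ℂ) → Matrix p q ℂ) (F' : Matrix p q ℂ)
    (θ v : Fin n → ℂ) : Prop :=
  ∀ i j, HasLineDerivAt ℂ (fun x => F x i j) (F' i j) θ v

/-- `f'` is the derivative of the vector function `f` at `θ` in the direction `v`. -/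
def HasVecDeriv {n : ℕ} {p : Type*} (f : (Fin n → ℂ) → p → ℂ) (f' : p → ℂ)
    (θ v : Fin n → ℂ) : Prop :=
  ∀ i, HasLineDerivAt ℂ (fun x => f x i) (f' i) θ v

section MatDeriv

variable {n : ℕ} {ρ : ℝ} {p q m : Type*} [Fintype q]
  {F F₁ : (Fin n → ℂ) → Matrix p q ℂ} {G : (Fin n → ℂ) → Matrix q m ℂ}
  {f g : (Fin n → ℂ) → q → ℂ} {F' F₁' : Matrix p q ℂ} {G' : Matrix q m ℂ} {f' g' : q → ℂ}
  {θ v : Fin n → ℂ}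

omit [Fintype q] in
theorem HasMatDeriv.transpose (hF : HasMatDeriv F F' θ v) :
    HasMatDeriv (fun x => (F x)ᵀ) F'ᵀ θ v := fun i j => hF j i

theorem HasMatDeriv.mul (hF : HasMatDeriv F F' θ v) (hG : HasMatDeriv G G' θ v) :
    HasMatDeriv (fun x => F x * G x) (F' * G θ + F θ * G') θ v := fun i j => by
  have h : HasDerivAt (fun s : ℂ => ∑ k, F (θ + s • v) i k * G (θ + s • v) k j)
      (∑ k, (F' i k * G (θ + (0 : ℂ) • v) k j + F (θ + (0 : ℂ) • v) i k * G' k j)) 0 :=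
    HasDerivAt.fun_sum fun k _ => HasDerivAt.mul (hF i k) (hG k j)
  simp only [zero_smul, add_zero] at h
  simpa only [HasLineDerivAt, Matrix.mul_apply, Matrix.add_apply, Finset.sum_add_distrib] using h

theorem HasMatDeriv.mulVec (hF : HasMatDeriv F F' θ v) (hf : HasVecDeriv f f' θ v) :
    HasVecDeriv (fun x => F x *ᵥ f x) (F' *ᵥ f θ + F θ *ᵥ f') θ v := fun i => by
  have h : HasDerivAt (fun s : ℂ => ∑ k, F (θ + s • v) i k * f (θ + s • v) k)
      (∑ k, (F' i k * f (θ + (0 : ℂ) • v) k + F (θ + (0 : ℂ) • v) i k * f' k)) 0 :=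
    HasDerivAt.fun_sum fun k _ => HasDerivAt.mul (hF i k) (hf k)
  simp only [zero_smul, add_zero] at h
  simpa only [HasLineDerivAt, Matrix.mulVec, dotProduct, Pi.add_apply,
    Finset.sum_add_distrib] using h

omit [Fintype q] in
theorem HasVecDeriv.add (hf : HasVecDeriv f f' θ v) (hg : HasVecDeriv g g' θ v) :
    HasVecDeriv (fun x => f x + g x) (f' + g') θ v := fun i => HasDerivAt.add (hf i) (hg i)

omit [Fintype q] in
theorem HasVecDeriv.unique {g' : q → ℂ} (hf : HasVecDeriv f f' θ v) (hg : HasVecDeriv f g' θ v) :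
    f' = g' := funext fun i => HasDerivAt.unique (hf i) (hg i)

omit [Fintype q] in
theorem HasMatDeriv.unique (hf : HasMatDeriv F F' θ v) (hg : HasMatDeriv F F₁' θ v) :
    F' = F₁' := by
  ext i j; exact HasDerivAt.unique (hf i j) (hg i j)

theorem hasMatDeriv_of_eventually_const {A₀ : Matrix p m ℂ} {A : (Fin n → ℂ) → Matrix p m ℂ}
    (h : ∀ᶠ x in 𝓝 θ, A x = A₀) : HasMatDeriv A 0 θ v := fun i j => by
  have hc : Tendsto (fun s : ℂ => θ + s • v) (𝓝 0) (𝓝 θ) := by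
    have : Continuous fun s : ℂ => θ + s • v := by fun_prop
    simpa using this.tendsto 0
  refine (hasDerivAt_const (0 : ℂ) (A₀ i j)).congr_of_eventuallyEq ?_
  filter_upwards [hc.eventually h] with s hs
  rw [hs]

omit [Fintype q] in
theorem MatHol.hasMatDeriv (hF : MatHol ρ F) (hθ : θ ∈ strip n ρ) (v : Fin n → ℂ) :
    HasMatDeriv F (Matrix.of fun i j => fderiv ℂ (fun x => F x i j) θ v) θ v := fun i j =>
  ((hF i j).hol.differentiableAt hθ).hasFDerivAt.hasLineDerivAt v

/-- The derivative of the inverse of a matrix function. -/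
theorem HasMatDeriv.inv [DecidableEq q] {A : (Fin n → ℂ) → Matrix q q ℂ} {A' : Matrix q q ℂ}
    (hA : HasMatDeriv A A' θ v) (hAh : MatHol ρ A)
    (h : ∀ θ ∈ strip n ρ, IsUnit (A θ).det) (hθ : θ ∈ strip n ρ) :
    HasMatDeriv (fun x => (A x)⁻¹) (-((A θ)⁻¹ * A' * (A θ)⁻¹)) θ v := by
  have h1 := (hAh.inv h).hasMatDeriv hθ v
  set D' := Matrix.of fun i j => fderiv ℂ (fun x => (A x)⁻¹ i j) θ v with hD
  have h2 := h1.mul hA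
  have h3 : HasMatDeriv (fun x => (A x)⁻¹ * A x) 0 θ v := by
    refine hasMatDeriv_of_eventually_const (A₀ := 1) ?_
    filter_upwards [(isOpen_strip n ρ).mem_nhds hθ] with x hx
    exact Matrix.nonsing_inv_mul _ (h x hx)
  have h4 := h2.unique h3
  have h5 : D' = -((A θ)⁻¹ * A' * (A θ)⁻¹) := by
    have h6 : D' * A θ = -((A θ)⁻¹ * A') := eq_neg_of_add_eq_zero_left h4
    calc D' = D' * A θ * (A θ)⁻¹ := by
          rw [Matrix.mul_assoc, Matrix.mul_nonsing_inv _ (h θ hθ), Matrix.mul_one]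
      _ = _ := by rw [h6, Matrix.neg_mul]
  rwa [h5] at h1

end MatDeriv

end QuasiNewton

namespace QuasiNewton

open Matrix Filter Topology

/-! ### The system along a torus -/

section Domain

variable {n : ℕ} {S : System n}

theorem System.isPeriod_zero : S.IsPeriod 0 := by
  unfold System.IsPeriod; split_ifs <;> simp

theorem System.IsPeriod.add {v w : Fin (2 * n) → ℤ} (hv : S.IsPeriod v) (hw : S.IsPeriod w) :
    S.IsPeriod (v + w) := by
  unfold System.IsPeriod at *
  split_ifs at * with h
  · intro i hi; simp [hv i hi, hw i hi]
  · simp [hv, hw]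

theorem intC_add {m : ℕ} (v w : Fin m → ℤ) : intC (v + w) = intC v + intC w := by
  ext; simp [intC]

theorem intC_zero {m : ℕ} : intC (0 : Fin m → ℤ) = 0 := by ext; simp [intC]

variable {ρ₀ r : ℝ} {K₀ : (Fin n → ℂ) → (Fin (2 * n) → ℂ)}

theorem System.isOpen_nbhd : IsOpen (S.nbhd ρ₀ r K₀) := by
  have : S.nbhd ρ₀ r K₀ = ⋃ θ ∈ closedStrip n ρ₀, ⋃ v ∈ {v | S.IsPeriod v},
      {z | ‖z - (K₀ θ + intC v)‖ < r} := by
    ext z; simp [System.nbhd]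
  rw [this]
  exact isOpen_biUnion fun θ _ => isOpen_biUnion fun v _ =>
    isOpen_lt (by fun_prop) continuous_const

theorem System.add_mem_nbhd {v : Fin (2 * n) → ℤ} (hv : S.IsPeriod v) {z : Fin (2 * n) → ℂ}
    (hz : z ∈ S.nbhd ρ₀ r K₀) : z + intC v ∈ S.nbhd ρ₀ r K₀ := by
  obtain ⟨θ, hθ, w, hw, h⟩ := hz
  refine ⟨θ, hθ, w + v, hw.add hv, ?_⟩
  rwa [intC_add, ← add_assoc, add_sub_add_right_eq_sub]

theorem System.ball_subset_nbhd {θ : Fin n → ℂ} (hθ : θ ∈ closedStrip n ρ₀)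
    {z : Fin (2 * n) → ℂ} (hz : ‖z - K₀ θ‖ < r) : z ∈ S.nbhd ρ₀ r K₀ :=
  ⟨θ, hθ, 0, S.isPeriod_zero, by rwa [intC_zero, add_zero]⟩

/-- An open set that is invariant under the periods of the phase space. -/
structure System.Domain (S : System n) (D : Set (Fin (2 * n) → ℂ)) : Prop where
  isOpen : IsOpen D
  add_mem : ∀ v, S.IsPeriod v → ∀ z ∈ D, z + intC v ∈ D

theorem System.domain_nbhd : S.Domain (S.nbhd ρ₀ r K₀) :=
  ⟨S.isOpen_nbhd, fun _ hv _ hz => S.add_mem_nbhd hv hz⟩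

/-- A holomorphic function on `D` that is periodic in the angles and real on the phase space. -/
structure System.PhaseHol (S : System n) (D : Set (Fin (2 * n) → ℂ))
    (f : (Fin (2 * n) → ℂ) → ℂ) : Prop where
  diff : DifferentiableOn ℂ f D
  periodic : ∀ v, S.IsPeriod v → ∀ z ∈ D, f (z + intC v) = f z
  real : ∀ x ∈ S.U, toC x ∈ D → (starRingEnd ℂ) (f (toC x)) = f (toC x)

variable {D : Set (Fin (2 * n) → ℂ)} {f g : (Fin (2 * n) → ℂ) → ℂ}

/-- The derivative of a holomorphic map along a real line, seen as a function of real variables. -/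
theorem hasDerivAt_toC_line {m : ℕ} {F : Type*} [NormedAddCommGroup F] [NormedSpace ℂ F]
    {f : (Fin m → ℂ) → F} {x : Fin m → ℝ} (hf : DifferentiableAt ℂ f (toC x)) (v : Fin m → ℝ) :
    HasDerivAt (fun s : ℝ => f (toC (x + s • v))) (fderiv ℂ f (toC x) (toC v)) 0 := by
  have h1 : HasDerivAt (fun s : ℝ => toC x + s • toC v) (toC v) 0 := by
    simpa using ((hasDerivAt_id (0 : ℝ)).smul_const (toC v)).const_add (toC x)
  have h2 : HasFDerivAt f ((fderiv ℂ f (toC x)).restrictScalars ℝ)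
      (toC x + (0 : ℝ) • toC v) := by
    simpa using hf.hasFDerivAt.restrictScalars ℝ
  have h3 := h2.comp_hasDerivAt (0 : ℝ) h1
  refine (h3.congr_of_eventuallyEq (Eventually.of_forall fun s => ?_))
  simp only [Function.comp_apply, toC_add, toC_smul, Complex.coe_smul]

theorem System.PhaseHol.fderiv_apply (hD : S.Domain D) (hf : S.PhaseHol D f)
    (v : Fin (2 * n) → ℝ) : S.PhaseHol D fun z => fderiv ℂ f z (toC v) := by
  refine ⟨differentiableOn_fderiv_apply hD.isOpen hf.diff _, fun w hw z hz => ?_,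
    fun x hx hxD => ?_⟩
  · rw [← fderiv_comp_add_right]
    have : (fun z => f (z + intC w)) =ᶠ[𝓝 z] f := by
      filter_upwards [hD.isOpen.mem_nhds hz] with z' hz' using hf.periodic w hw z' hz'
    rw [this.fderiv_eq]
  · refine conj_eq_of_hasDerivAt (hasDerivAt_toC_line
      (hf.diff.differentiableAt (hD.isOpen.mem_nhds hxD)) v) ?_
    have hc : Continuous fun s : ℝ => x + s • v := by fun_prop
    have hU : ∀ᶠ s in 𝓝 (0 : ℝ), x + s • v ∈ S.U :=
      hc.continuousAt.eventually_mem (S.isOpen_U.mem_nhds (by simpa using hx))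
    have hDe : ∀ᶠ s in 𝓝 (0 : ℝ), toC (x + s • v) ∈ D :=
      (continuous_toC.comp hc).continuousAt.eventually_mem
        (hD.isOpen.mem_nhds (by simpa using hxD))
    filter_upwards [hU, hDe] with s hs1 hs2
    rw [hf.real _ hs1 hs2]

/-- A torus `K` on `U_ρ` with values in `D`. -/
structure System.TorusIn (S : System n) (D : Set (Fin (2 * n) → ℂ)) (ρ : ℝ)
    (K : (Fin n → ℂ) → (Fin (2 * n) → ℂ)) : Prop where
  pos : 0 < ρ
  diff : DifferentiableOn ℂ K (strip n ρ)
  mapsTo : ∀ θ ∈ strip n ρ, K θ ∈ D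
  periodic : ∀ k : Fin n → ℤ, ∃ v, S.IsPeriod v ∧ ∀ θ ∈ strip n ρ, K (θ + intC k) = K θ + intC v
  real : ∀ t : Fin n → ℝ, ∃ x ∈ S.U, K (toC t) = toC x

variable {ρ : ℝ} {K : (Fin n → ℂ) → (Fin (2 * n) → ℂ)}

theorem System.TorusIn.comp (hK : S.TorusIn D ρ K) (hf : S.PhaseHol D f) :
    RealHol ρ fun θ => f (K θ) := by
  refine ⟨⟨hf.diff.comp hK.diff hK.mapsTo, fun k θ hθ => ?_⟩, fun t => ?_⟩
  · obtain ⟨v, hv, h⟩ := hK.periodic k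
    rw [h θ hθ, hf.periodic v hv _ (hK.mapsTo θ hθ)]
  · obtain ⟨x, hx, h⟩ := hK.real t
    have hm := hK.mapsTo _ (toC_mem_strip hK.pos t)
    rw [h] at hm ⊢
    exact hf.real x hx hm

theorem System.TorusIn.differentiableAt (hK : S.TorusIn D ρ K) {θ : Fin n → ℂ}
    (hθ : θ ∈ strip n ρ) : DifferentiableAt ℂ K θ :=
  hK.diff.differentiableAt ((isOpen_strip n ρ).mem_nhds hθ)

theorem fderiv_eq_jac_mulVec {p : ℕ} (K : (Fin n → ℂ) → (Fin p → ℂ)) (θ v : Fin n → ℂ) :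
    fderiv ℂ K θ v = jac K θ *ᵥ v := by
  ext i
  have h : v = ∑ j, v j • (Pi.single j 1 : Fin n → ℂ) := by
    ext k; simp [Finset.sum_apply, Pi.single_apply]
  conv_lhs => rw [h]
  rw [map_sum, Finset.sum_apply]
  simp only [map_smul, Pi.smul_apply, smul_eq_mul, jac, Matrix.mulVec, dotProduct, Matrix.of_apply,
    mul_comm]

theorem System.TorusIn.matHol_jac (hK : S.TorusIn D ρ K) : MatHol ρ (jac K) := by
  intro i j
  refine ⟨⟨?_, fun k θ hθ => ?_⟩, fun t => ?_⟩
  · have := differentiableOn_fderiv_apply (isOpen_strip n ρ) hK.diff (Pi.single j 1)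
    exact (differentiableOn_pi.1 this) i
  · obtain ⟨v, -, h⟩ := hK.periodic k
    simp only [jac, Matrix.of_apply, fderiv_periodic h hθ]
  · have h1 := hasDerivAt_pi.1 (hasDerivAt_toC_line
      (hK.differentiableAt (toC_mem_strip hK.pos t)) (Pi.single j 1)) i
    rw [toC_single] at h1
    refine conj_eq_of_hasDerivAt h1 (Eventually.of_forall fun s => ?_)
    obtain ⟨x, -, h⟩ := hK.real (t + s • Pi.single j 1)
    rw [h]; simp [toC]

end Domain

namespace System.Extension

variable {n : ℕ} {S : System n} {D : Set (Fin (2 * n) → ℂ)} {E : S.Extension D}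

theorem phaseHol_H (hD : S.Domain D) : S.PhaseHol D E.H :=
  ⟨E.holo_H, fun v hv z hz => (E.periodic v hv z hz (hD.add_mem v hv z hz)).1, fun x hx hxD => by
    rw [E.ext_H x hx hxD, Complex.conj_ofReal]⟩

/-- The evaluation of a matrix at an entry, as a continuous linear map. -/
noncomputable def _root_.QuasiNewton.entryCLM {p q : Type*} [Fintype p] [Fintype q] (i : p)
    (j : q) : Matrix p q ℂ →L[ℂ] ℂ :=
  LinearMap.mkContinuous (Matrix.entryLinearMap ℂ ℂ i j) 1 fun A => by
    rw [one_mul]; exact norm_entry_le A i j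

theorem differentiableOn_entry (E : S.Extension D) (i j : Fin (2 * n)) :
    DifferentiableOn ℂ (fun z => E.B z i j) D :=
  (entryCLM i j).differentiable.comp_differentiableOn E.holo_B

theorem phaseHol_B (hD : S.Domain D) (i j : Fin (2 * n)) : S.PhaseHol D fun z => E.B z i j :=
  ⟨E.differentiableOn_entry i j,
    fun v hv z hz => by rw [(E.periodic v hv z hz (hD.add_mem v hv z hz)).2], fun x hx hxD => by
    rw [E.ext_B x hx hxD, Complex.conj_ofReal]⟩

theorem phaseHol_grad (hD : S.Domain D) (j : Fin (2 * n)) : S.PhaseHol D fun z => E.grad z j := by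
  have := (phaseHol_H (E := E) hD).fderiv_apply hD (Pi.single j 1)
  rwa [toC_single] at this

theorem phaseHol_dirB (hD : S.Domain D) (l i j : Fin (2 * n)) :
    S.PhaseHol D fun z => E.dirB z (Pi.single l 1) i j := by
  have := (phaseHol_B (E := E) hD i j).fderiv_apply hD (Pi.single l 1)
  rwa [toC_single] at this

theorem phaseHol_Psi (hD : S.Domain D) (i k : Fin (2 * n)) : S.PhaseHol D fun z => E.Psi z i k := by
  have := (phaseHol_grad (E := E) hD i).fderiv_apply hD (Pi.single k 1)
  rwa [toC_single] at this

theorem dirB_apply_eq_sum (E : S.Extension D) (z h : Fin (2 * n) → ℂ) (i j : Fin (2 * n)) :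
    E.dirB z h i j = ∑ l, E.dirB z (Pi.single l 1) i j * h l := by
  have hh : h = ∑ l, h l • (Pi.single l 1 : Fin (2 * n) → ℂ) := by
    ext k; simp [Finset.sum_apply, Pi.single_apply]
  simp only [dirB, Matrix.of_apply]
  conv_lhs => rw [hh]
  rw [map_sum]
  simp only [map_smul, smul_eq_mul, mul_comm]

theorem dirB_sub (E : S.Extension D) (z h h' : Fin (2 * n) → ℂ) :
    E.dirB z (h - h') = E.dirB z h - E.dirB z h' := by
  ext i j; simp [dirB]

/-- `Φ(z) h = (DB(z) h) ∇H(z)`. -/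
theorem Phi_mulVec (E : S.Extension D) (z h : Fin (2 * n) → ℂ) :
    E.Phi z *ᵥ h = E.dirB z h *ᵥ E.grad z := by
  ext i
  simp only [Matrix.mulVec, dotProduct, Phi, Matrix.of_apply, E.dirB_apply_eq_sum z h,
    Finset.sum_mul]
  rw [Finset.sum_comm]
  refine Finset.sum_congr rfl fun j _ => Finset.sum_congr rfl fun l _ => by ring

theorem Psi_mulVec (E : S.Extension D) (z h : Fin (2 * n) → ℂ) (i : Fin (2 * n)) :
    (E.Psi z *ᵥ h) i = fderiv ℂ (fun w => E.grad w i) z h := by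
  have hh : h = ∑ l, h l • (Pi.single l 1 : Fin (2 * n) → ℂ) := by
    ext k; simp [Finset.sum_apply, Pi.single_apply]
  conv_rhs => rw [hh]
  rw [map_sum]
  simp only [Matrix.mulVec, dotProduct, Psi, Matrix.of_apply, map_smul, smul_eq_mul, mul_comm]

variable {ρ : ℝ} {K : (Fin n → ℂ) → (Fin (2 * n) → ℂ)}

theorem matHol_B (hD : S.Domain D) (hK : S.TorusIn D ρ K) : MatHol ρ fun θ => E.B (K θ) :=
  fun i j => hK.comp (phaseHol_B hD i j)

theorem vecHol_grad (hD : S.Domain D) (hK : S.TorusIn D ρ K) : VecHol ρ fun θ => E.grad (K θ) :=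
  fun i => hK.comp (phaseHol_grad hD i)

theorem matHol_dirB (hD : S.Domain D) (hK : S.TorusIn D ρ K) {h : (Fin n → ℂ) → Fin (2 * n) → ℂ}
    (hh : VecHol ρ h) : MatHol ρ fun θ => E.dirB (K θ) (h θ) := fun i j => by
  simp only [E.dirB_apply_eq_sum _ (h _)]
  exact RealHol.sum fun l _ => (hK.comp (phaseHol_dirB hD l i j)).mul (hh l)

theorem matHol_linA (hD : S.Domain D) (hK : S.TorusIn D ρ K) : MatHol ρ (E.linA K) := by
  refine MatHol.add (fun i k => ?_) ((matHol_B hD hK).mul fun i k => hK.comp (phaseHol_Psi hD i k))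
  simp only [Phi, Matrix.of_apply]
  exact RealHol.sum fun j _ => (hK.comp (phaseHol_dirB hD k i j)).mul
    (hK.comp (phaseHol_grad hD j))

theorem matHol_invGram (hK : S.TorusIn D ρ K)
    (hN : ∀ θ ∈ strip n ρ, IsUnit ((jac K θ)ᵀ * jac K θ).det) : MatHol ρ (invGram K) :=
  (hK.matHol_jac.transpose.mul hK.matHol_jac).inv hN

theorem matHol_Binv (hD : S.Domain D) (hK : S.TorusIn D ρ K)
    (hB : ∀ z ∈ D, IsUnit (E.B z).det) : MatHol ρ fun θ => (E.B (K θ))⁻¹ :=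
  (matHol_B hD hK).inv fun θ hθ => hB _ (hK.mapsTo θ hθ)

theorem vecHol_X (hD : S.Domain D) (hK : S.TorusIn D ρ K) :
    VecHol ρ fun θ => E.B (K θ) *ᵥ E.grad (K θ) :=
  (matHol_B hD hK).mulVec (vecHol_grad hD hK)

theorem vecHol_toC (ω : Fin n → ℝ) : VecHol (n := n) ρ fun _ => toC ω := fun i =>
  realHol_const (by simp [toC])

theorem vecHol_err (hD : S.Domain D) (hK : S.TorusIn D ρ K) (ω : Fin n → ℝ) :
    VecHol ρ (E.err ω K) := by
  have : E.err ω K = fun θ => E.B (K θ) *ᵥ E.grad (K θ) - jac K θ *ᵥ toC ω := by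
    ext1 θ; rw [err, dω, fderiv_eq_jac_mulVec]
  rw [this]
  exact (vecHol_X hD hK).sub (hK.matHol_jac.mulVec (vecHol_toC ω))

theorem matHol_S0 (hD : S.Domain D) (hK : S.TorusIn D ρ K)
    (hN : ∀ θ ∈ strip n ρ, IsUnit ((jac K θ)ᵀ * jac K θ).det) : MatHol ρ (E.S0 K) := by
  have hX := hK.matHol_jac
  have hNm := matHol_invGram hK hN
  have hB := matHol_B (E := E) hD hK
  have hA := matHol_linA (E := E) hD hK
  exact (((hNm.mul hX.transpose).mul
    ((((hA.mul hB).sub (hB.mul hA)).sub (matHol_dirB hD hK (vecHol_X hD hK))).add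
      ((((hB.mul hX).mul hNm).mul hX.transpose).mul (hA.add hA.transpose)))).mul hX).mul hNm

theorem vecHol_pX (hD : S.Domain D) (hK : S.TorusIn D ρ K) (hBu : ∀ z ∈ D, IsUnit (E.B z).det)
    (hN : ∀ θ ∈ strip n ρ, IsUnit ((jac K θ)ᵀ * jac K θ).det) (ω : Fin n → ℝ) :
    VecHol ρ (E.pX ω K) := by
  have hX := hK.matHol_jac
  have hNm := matHol_invGram hK hN
  have hB := matHol_B (E := E) hD hK
  exact ((hNm.transpose.mul hX.transpose).mul
    (((((hB.mul hX).mul hNm).mul hX.transpose).mul (matHol_Binv hD hK hBu)).sub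
      matHol_one)).mulVec (vecHol_err hD hK ω)

theorem vecHol_pY (hD : S.Domain D) (hK : S.TorusIn D ρ K) (hBu : ∀ z ∈ D, IsUnit (E.B z).det)
    (ω : Fin n → ℝ) : VecHol ρ (E.pY ω K) :=
  ((hK.matHol_jac.transpose.mul (matHol_Binv hD hK hBu)).mulVec (vecHol_err hD hK ω)).neg

end System.Extension

end QuasiNewton

namespace QuasiNewton

open Matrix Filter Topology

/-! ### The Poisson structure and the Lagrangian form of a torus -/

/-- The second derivatives of a holomorphic map are symmetric. -/
theorem fderiv_fderiv_comm {V F : Type*} [NormedAddCommGroup V] [NormedSpace ℂ V]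
    [FiniteDimensional ℂ V] [NormedAddCommGroup F] [NormedSpace ℂ F] [CompleteSpace F]
    {f : V → F} {U : Set V} (hU : IsOpen U) (hf : DifferentiableOn ℂ f U) {x : V} (hx : x ∈ U)
    (v w : V) :
    fderiv ℂ (fun z => fderiv ℂ f z v) x w = fderiv ℂ (fun z => fderiv ℂ f z w) x v := by
  have hc : ContDiffAt ℂ 2 f x :=
    (contDiffOn_of_differentiableOn_complex hU hf 2).contDiffAt (hU.mem_nhds hx)
  have hd : DifferentiableAt ℂ (fderiv ℂ f) x :=
    (hc.fderiv_right (m := 1) (by norm_num)).differentiableAt (by norm_num)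
  have hs := hc.isSymmSndFDerivAt (by simp)
  have key : ∀ a b : V, fderiv ℂ (fun z => fderiv ℂ f z a) x b = fderiv ℂ (fderiv ℂ f) x b a := by
    intro a b
    rw [fderiv_clm_apply hd (differentiableAt_const a)]
    simp
  rw [key, key, hs.eq]

theorem fderiv_jac_mulVec_comm {n p : ℕ} {ρ : ℝ} {K : (Fin n → ℂ) → (Fin p → ℂ)}
    (hK : DifferentiableOn ℂ K (strip n ρ)) {θ : Fin n → ℂ} (hθ : θ ∈ strip n ρ)
    (v w : Fin n → ℂ) (l : Fin p) :
    fderiv ℂ (fun θ => (jac K θ *ᵥ w) l) θ v = fderiv ℂ (fun θ => (jac K θ *ᵥ v) l) θ w := by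
  have h := fun w : Fin n → ℂ => fderiv_apply (𝕜 := ℂ) (Φ := fun θ => fderiv ℂ K θ w) (x := θ)
    ((differentiableOn_fderiv_apply (isOpen_strip n ρ) hK w).differentiableAt
      ((isOpen_strip n ρ).mem_nhds hθ)) l
  simp only [← fderiv_eq_jac_mulVec, h]
  exact congrFun (fderiv_fderiv_comm (isOpen_strip n ρ) hK hθ _ _) l

theorem fcoeff_sub {n : ℕ} {ρ : ℝ} {g h : (Fin n → ℂ) → ℂ} (hρ : 0 < ρ) (hg : HolPeriodic ρ g)
    (hh : HolPeriodic ρ h) (k : Fin n → ℤ) :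
    fcoeff (fun θ => g θ - h θ) k = fcoeff g k - fcoeff h k := by
  unfold fcoeff cubeCoeff
  rw [← cubeAvg_sub]
  · simp only [sub_mul]
  · exact ((hg.contPeriodic_real hρ).mul (contPeriodic_expC (-k))).cont
  · exact ((hh.contPeriodic_real hρ).mul (contPeriodic_expC (-k))).cont

theorem ContPeriodic.add {n : ℕ} {φ ψ : (Fin n → ℝ) → ℂ} (hφ : ContPeriodic φ)
    (hψ : ContPeriodic ψ) : ContPeriodic fun t => φ t + ψ t :=
  ⟨hφ.cont.add hψ.cont, fun k t => by rw [hφ.periodic, hψ.periodic]⟩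

theorem ContPeriodic.sum {n : ℕ} {ι : Type*} [Fintype ι] {φ : ι → (Fin n → ℝ) → ℂ}
    (hφ : ∀ i, ContPeriodic (φ i)) : ContPeriodic fun t => ∑ i, φ i t :=
  ⟨continuous_finsetSum _ fun i _ => (hφ i).cont, fun k t =>
    Finset.sum_congr rfl fun i _ => (hφ i).periodic k t⟩

namespace System.Extension

variable {n : ℕ} {S : System n} {D : Set (Fin (2 * n) → ℂ)} {E : S.Extension D}

section Poisson

/-- The complex derivatives of the extension of `B` are the derivatives of `B` on the phase
space. -/
theorem fderiv_B_toC (hD : IsOpen D) {x : Fin (2 * n) → ℝ} (hx : x ∈ S.U) (hxD : toC x ∈ D)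
    (i j l : Fin (2 * n)) : E.dirB (toC x) (Pi.single l 1) i j =
      ((fderiv ℝ (fun w => S.B w i j) x (Pi.single l 1) : ℝ) : ℂ) := by
  have h1 := hasDerivAt_toC_line ((E.differentiableOn_entry i j).differentiableAt
    (hD.mem_nhds hxD)) (Pi.single l (1 : ℝ))
  rw [toC_single] at h1
  have h2 : HasDerivAt (fun s : ℝ => S.B (x + s • Pi.single l (1 : ℝ)) i j)
      (fderiv ℝ (fun w => S.B w i j) x (Pi.single l 1)) 0 :=
    ((S.analytic_B i j x hx).differentiableAt.hasFDerivAt.hasLineDerivAt _)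
  refine h1.unique (h2.ofReal_comp.congr_of_eventuallyEq ?_)
  have hc : Continuous fun s : ℝ => x + s • (Pi.single l (1 : ℝ) : Fin (2 * n) → ℝ) := by
    fun_prop
  have hU := hc.continuousAt.eventually_mem (S.isOpen_U.mem_nhds
    (by simpa using hx : x + (0 : ℝ) • (Pi.single l (1 : ℝ) : Fin (2 * n) → ℝ) ∈ S.U))
  have hDe := (continuous_toC.comp hc).continuousAt.eventually_mem (hD.mem_nhds
    (by simpa using hxD : toC (x + (0 : ℝ) • (Pi.single l (1 : ℝ) : Fin (2 * n) → ℝ)) ∈ D))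
  filter_upwards [hU, hDe] with s hs1 hs2
  exact E.ext_B _ hs1 hs2 i j

variable {ρ : ℝ} {K : (Fin n → ℂ) → (Fin (2 * n) → ℂ)} (hD : S.Domain D)
  (hK : S.TorusIn D ρ K) {θ : Fin n → ℂ} (hθ : θ ∈ strip n ρ)
include hD hK hθ

/-- The identities of the Poisson structure hold at the real points of the torus, hence on the
whole strip, by uniqueness of holomorphic continuation. -/
theorem B_skew (i j : Fin (2 * n)) : E.B (K θ) i j = -E.B (K θ) j i := by
  refine (hK.comp (phaseHol_B hD i j)).hol.eq_of_eq_real hK.pos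
    (hK.comp (phaseHol_B hD j i)).hol.neg (fun t => ?_) hθ
  obtain ⟨x, hx, h⟩ := hK.real t
  have hm := hK.mapsTo _ (toC_mem_strip hK.pos t)
  rw [h] at hm ⊢
  rw [E.ext_B x hx hm, E.ext_B x hx hm, S.skew x hx i j, Complex.ofReal_neg]

theorem transpose_B : (E.B (K θ))ᵀ = -E.B (K θ) := by
  ext i j
  rw [Matrix.transpose_apply, Matrix.neg_apply, B_skew hD hK hθ j i]

theorem dirB_skew (l i j : Fin (2 * n)) :
    E.dirB (K θ) (Pi.single l 1) i j = -E.dirB (K θ) (Pi.single l 1) j i := by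
  refine (hK.comp (phaseHol_dirB hD l i j)).hol.eq_of_eq_real hK.pos
    (hK.comp (phaseHol_dirB hD l j i)).hol.neg (fun t => ?_) hθ
  obtain ⟨x, hx, h⟩ := hK.real t
  have hm := hK.mapsTo _ (toC_mem_strip hK.pos t)
  rw [h] at hm ⊢
  rw [fderiv_B_toC hD.isOpen hx hm, fderiv_B_toC hD.isOpen hx hm, ← Complex.ofReal_neg]
  congr 1
  have : (fun w => S.B w i j) =ᶠ[𝓝 x] fun w => -S.B w j i := by
    filter_upwards [S.isOpen_U.mem_nhds hx] with w hw using S.skew w hw i j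
  rw [this.fderiv_eq, fderiv_fun_neg, _root_.neg_apply]

theorem jacobi_torus (i j k : Fin (2 * n)) :
    ∑ l, (E.dirB (K θ) (Pi.single l 1) i j * E.B (K θ) l k
      + E.dirB (K θ) (Pi.single l 1) j k * E.B (K θ) l i
      + E.dirB (K θ) (Pi.single l 1) k i * E.B (K θ) l j) = 0 := by
  have h : RealHol ρ fun θ => ∑ l, (E.dirB (K θ) (Pi.single l 1) i j * E.B (K θ) l k
      + E.dirB (K θ) (Pi.single l 1) j k * E.B (K θ) l i
      + E.dirB (K θ) (Pi.single l 1) k i * E.B (K θ) l j) :=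
    RealHol.sum fun l _ => (((hK.comp (phaseHol_dirB hD l i j)).mul
      (hK.comp (phaseHol_B hD l k))).add ((hK.comp (phaseHol_dirB hD l j k)).mul
      (hK.comp (phaseHol_B hD l i)))).add ((hK.comp (phaseHol_dirB hD l k i)).mul
      (hK.comp (phaseHol_B hD l j)))
  refine h.hol.eq_of_eq_real hK.pos (holPeriodic_const 0) (fun t => ?_) hθ
  obtain ⟨x, hx, hx'⟩ := hK.real t
  have hm := hK.mapsTo _ (toC_mem_strip hK.pos t)
  simp only [hx'] at hm ⊢
  simp only [fderiv_B_toC hD.isOpen hx hm, E.ext_B x hx hm]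
  exact_mod_cast congrArg (fun y : ℝ => (y : ℂ)) (S.jacobi x hx i j k)

omit hK hθ in
theorem Psi_symm {z : Fin (2 * n) → ℂ} (hz : z ∈ D) : (E.Psi z)ᵀ = E.Psi z := by
  ext i j
  exact fderiv_fderiv_comm hD.isOpen E.holo_H hz _ _

/-- The Lie derivative of the Poisson tensor `B` along the vector field `B ∇H` vanishes. This is
where the Jacobi identity enters. -/
theorem linA_mul_B :
    E.linA K θ * E.B (K θ) + E.B (K θ) * (E.linA K θ)ᵀ =
      E.dirB (K θ) (E.B (K θ) *ᵥ E.grad (K θ)) := by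
  have hB := transpose_B (E := E) hD hK hθ
  have h1 : E.linA K θ * E.B (K θ) + E.B (K θ) * (E.linA K θ)ᵀ =
      E.Phi (K θ) * E.B (K θ) + E.B (K θ) * (E.Phi (K θ))ᵀ := by
    rw [linA, Matrix.transpose_add, Matrix.transpose_mul, hB, Psi_symm hD (hK.mapsTo θ hθ)]
    simp only [Matrix.add_mul, Matrix.mul_add, Matrix.mul_neg, Matrix.mul_assoc]
    abel
  rw [h1]
  ext i j
  -- the Jacobi identity for the indices `i`, `m`, `j`, contracted with `∂_m H`
  have hJ : ∑ m, E.grad (K θ) m * ∑ l, (E.dirB (K θ) (Pi.single l 1) i m * E.B (K θ) l j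
      + E.dirB (K θ) (Pi.single l 1) m j * E.B (K θ) l i
      + E.dirB (K θ) (Pi.single l 1) j i * E.B (K θ) l m) = 0 :=
    Finset.sum_eq_zero fun m _ => by rw [jacobi_torus hD hK hθ, mul_zero]
  rw [← sub_eq_zero, ← hJ, Matrix.add_apply, E.dirB_apply_eq_sum]
  simp only [Matrix.mul_apply, Matrix.transpose_apply, Phi, Matrix.of_apply, Matrix.mulVec,
    dotProduct, Finset.sum_mul, Finset.mul_sum, mul_add, Finset.sum_add_distrib]
  rw [sub_eq_add_neg, ← Finset.sum_neg_distrib]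
  refine congrArg₂ _ (congrArg₂ _ ?_ ?_) ?_
  · rw [Finset.sum_comm]
    exact Finset.sum_congr rfl fun m _ => Finset.sum_congr rfl fun l _ => by ring
  · rw [Finset.sum_comm]
    exact Finset.sum_congr rfl fun m _ => Finset.sum_congr rfl fun l _ => by
      rw [dirB_skew hD hK hθ l j m, B_skew hD hK hθ i l]; ring
  · conv_rhs => rw [Finset.sum_comm]
    refine Finset.sum_congr rfl fun l _ => ?_
    rw [← Finset.sum_neg_distrib]
    exact Finset.sum_congr rfl fun m _ => by
      rw [dirB_skew hD hK hθ l i j]; ring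

end Poisson

section Lagrange

variable {ρ : ℝ} {K : (Fin n → ℂ) → (Fin (2 * n) → ℂ)}

/-- The derivative at `x` of a function on the phase space is periodic in the angles. -/
theorem _root_.QuasiNewton.System.fderiv_add_period {f : (Fin (2 * n) → ℝ) → ℝ}
    {v : Fin (2 * n) → ℤ} (hf : ∀ z ∈ S.U, f (z + fun i => (v i : ℝ)) = f z)
    {x : Fin (2 * n) → ℝ} (hx : x ∈ S.U) :
    fderiv ℝ f (x + fun i => (v i : ℝ)) = fderiv ℝ f x := by
  rw [← fderiv_comp_add_right]
  have : (fun z => f (z + fun i => (v i : ℝ))) =ᶠ[𝓝 x] f := by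
    filter_upwards [S.isOpen_U.mem_nhds hx] with z hz using hf z hz
  rw [this.fderiv_eq]

/-- The matrix of the two-form is real on the phase space. -/
theorem inv_B_toC {x : Fin (2 * n) → ℝ} (hx : x ∈ S.U)
    (hxD : toC x ∈ D) (i j : Fin (2 * n)) : (E.B (toC x))⁻¹ i j = (((S.B x)⁻¹ i j : ℝ) : ℂ) := by
  have h1 : E.B (toC x) = (S.B x).map Complex.ofRealHom := by
    ext i j; simp [E.ext_B x hx hxD]
  have h2 : (E.B (toC x))⁻¹ = ((S.B x)⁻¹).map Complex.ofRealHom := by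
    refine Matrix.inv_eq_left_inv ?_
    rw [h1, ← Matrix.map_mul, Matrix.nonsing_inv_mul _ (S.invertible x hx),
      Matrix.map_one _ (map_zero _) (map_one _)]
  rw [h2]; rfl

/-- The pull-back of the two-form by `K`, as a matrix. -/
noncomputable def lagrange (E : S.Extension D) (K : (Fin n → ℂ) → (Fin (2 * n) → ℂ))
    (θ : Fin n → ℂ) : Matrix (Fin n) (Fin n) ℂ :=
  (jac K θ)ᵀ * (E.B (K θ))⁻¹ * jac K θ

theorem matHol_lagrange (hD : S.Domain D) (hK : S.TorusIn D ρ K)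
    (hBu : ∀ z ∈ D, IsUnit (E.B z).det) : MatHol ρ (E.lagrange K) :=
  (hK.matHol_jac.transpose.mul (matHol_Binv hD hK hBu)).mul hK.matHol_jac

/-- As the two-form is exact, so is its pull-back to the torus: its Fourier coefficients are
those of the exterior derivative of a one-form with coefficients `G`. -/
theorem exists_fcoeff_lagrange (hK : S.TorusIn D ρ K) :
    ∃ G : (Fin n → ℝ) → (Fin n → ℤ) → ℂ, ∀ v w k,
      fcoeff (fun θ => toC v ⬝ᵥ (E.lagrange K θ *ᵥ toC w)) k =
        2 * Real.pi * Complex.I * (((∑ j, (k j : ℝ) * v j : ℝ) : ℂ) * G w k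
          - ((∑ j, (k j : ℝ) * w j : ℝ) : ℂ) * G v k) := by
  obtain ⟨a, ha, hper, hex⟩ := S.exact
  choose xr hxU hxr using hK.real
  have hxre : ∀ t, xr t = fun l => (K (toC t) l).re := fun t => by
    rw [hxr]; ext l; simp [toC]
  have hstrip : ∀ t : Fin n → ℝ, toC t ∈ strip n ρ := toC_mem_strip hK.pos
  have hKc : Continuous fun t : Fin n → ℝ => K (toC t) := by
    refine continuous_iff_continuousAt.2 fun t => ?_
    exact (hK.differentiableAt (hstrip t)).continuousAt.comp continuous_toC.continuousAt
  have hxc : Continuous xr := by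
    have : xr = fun t l => (K (toC t) l).re := funext hxre
    rw [this]
    exact continuous_pi fun l => Complex.continuous_re.comp ((continuous_apply l).comp hKc)
  -- `a` and its derivative are periodic along the torus
  have hxper : ∀ (k : Fin n → ℤ) t, ∃ v, S.IsPeriod v ∧
      xr (t + fun i => (k i : ℝ)) = xr t + fun i => (v i : ℝ) := fun k t => by
    obtain ⟨v, hv, h⟩ := hK.periodic k
    refine ⟨v, hv, ?_⟩
    rw [hxre, hxre, toC_add_int, h _ (hstrip t)]
    ext l; simp [intC]
  have haU : ∀ v, S.IsPeriod v → ∀ z ∈ S.U, a (z + fun i => (v i : ℝ)) = a z := by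
    intro v hv z hz
    unfold System.IsPeriod at hv
    split_ifs at hv with h
    · exact hper h v hv z hz
    · subst hv
      congr 1; ext i; simp
  -- the tangent vectors of the torus
  have hT : ∀ w : Fin n → ℝ, VecHol ρ fun θ => jac K θ *ᵥ toC w := fun w =>
    hK.matHol_jac.mulVec (vecHol_toC w)
  have hTre : ∀ w t l, ((((jac K (toC t) *ᵥ toC w) l).re : ℝ) : ℂ) = (jac K (toC t) *ᵥ toC w) l :=
    fun w t l => Complex.conj_eq_iff_re.1 ((hT w l).real t)
  set da : Fin (2 * n) → Fin (2 * n) → (Fin n → ℝ) → ℂ := fun m l t =>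
    ((fderiv ℝ (fun z => a z l) (xr t) (Pi.single m 1) : ℝ) : ℂ) with hda
  have hda_cont : ∀ m l, ContPeriodic (da m l) := fun m l => by
    refine ⟨?_, fun k t => ?_⟩
    · refine Complex.continuous_ofReal.comp ?_
      have h1 := ((ha l).continuousOn_fderiv_of_isOpen S.isOpen_U (by simp)).comp_continuous hxc hxU
      exact h1.clm_apply continuous_const
    · obtain ⟨v, hv, h⟩ := hxper k t
      simp only [hda]
      rw [h, S.fderiv_add_period (fun z hz => by rw [haU v hv z hz]) (hxU t)]
  have ha_cont : ∀ l, ContPeriodic fun t => ((a (xr t) l : ℝ) : ℂ) := fun l => by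
    refine ⟨Complex.continuous_ofReal.comp ((ha l).continuousOn.comp_continuous hxc hxU),
      fun k t => ?_⟩
    obtain ⟨v, hv, h⟩ := hxper k t
    rw [h, haU v hv _ (hxU t)]
  -- the one-form along the torus, evaluated at the vector `w`, and its derivatives
  set g : (Fin n → ℝ) → (Fin n → ℝ) → ℂ := fun w t =>
    ∑ l, ((a (xr t) l : ℝ) : ℂ) * (jac K (toC t) *ᵥ toC w) l with hg
  set ψ : (Fin n → ℝ) → (Fin n → ℝ) → (Fin n → ℝ) → ℂ := fun v w t =>
    ∑ l, ((∑ m, da m l t * (jac K (toC t) *ᵥ toC v) m) * (jac K (toC t) *ᵥ toC w) l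
      + ((a (xr t) l : ℝ) : ℂ) * fderiv ℂ (fun θ => (jac K θ *ᵥ toC w) l) (toC t) (toC v)) with hψ
  have hgc : ∀ w, ContPeriodic (g w) := fun w =>
    ContPeriodic.sum fun l => (ha_cont l).mul ((hT w l).hol.contPeriodic_real hK.pos)
  have hψc : ∀ v w, ContPeriodic (ψ v w) := fun v w =>
    ContPeriodic.sum fun l => ((ContPeriodic.sum fun m => (hda_cont m l).mul
      ((hT v m).hol.contPeriodic_real hK.pos)).mul ((hT w l).hol.contPeriodic_real hK.pos)).add
      ((ha_cont l).mul (((hT w l).fderiv_apply hK.pos v).hol.contPeriodic_real hK.pos))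
  have hder : ∀ v w t, HasDerivAt (fun s : ℝ => g w (t + s • v)) (ψ v w t) 0 := by
    intro v w t
    refine HasDerivAt.fun_sum fun l _ => ?_
    have h1 : HasDerivAt (fun s : ℝ => xr (t + s • v))
        (fun m => ((jac K (toC t) *ᵥ toC v) m).re) 0 := by
      refine hasDerivAt_pi.2 fun m => ?_
      have h := hasDerivAt_pi.1 (hasDerivAt_toC_line (hK.differentiableAt (hstrip t)) v) m
      rw [fderiv_eq_jac_mulVec] at h
      have hre : HasFDerivAt (fun z : ℂ => z.re) Complex.reCLM (K (toC (t + (0 : ℝ) • v)) m) :=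
        Complex.reCLM.hasFDerivAt
      have h' : HasDerivAt (fun s : ℝ => (K (toC (t + s • v)) m).re)
          ((jac K (toC t) *ᵥ toC v) m).re 0 :=
        HasFDerivAt.comp_hasDerivAt (f := fun s : ℝ => K (toC (t + s • v)) m) (0 : ℝ) hre h
      simpa only [hxre] using h'
    have h2 : HasFDerivAt (fun z => a z l) (fderiv ℝ (fun z => a z l) (xr t))
        (xr (t + (0 : ℝ) • v)) := by
      have := ((ha l).contDiffAt (S.isOpen_U.mem_nhds (hxU t))).differentiableAt (by simp)
      simpa using this.hasFDerivAt
    have h3 := (h2.comp_hasDerivAt (0 : ℝ) h1).ofReal_comp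
    have h4 : ((fderiv ℝ (fun z => a z l) (xr t) fun m => ((jac K (toC t) *ᵥ toC v) m).re : ℝ) : ℂ)
        = ∑ m, da m l t * (jac K (toC t) *ᵥ toC v) m := by
      have hh : (fun m => ((jac K (toC t) *ᵥ toC v) m).re) = ∑ m,
          ((jac K (toC t) *ᵥ toC v) m).re • (Pi.single m 1 : Fin (2 * n) → ℝ) := by
        ext k; simp [Finset.sum_apply, Pi.single_apply]
      rw [hh, map_sum]
      simp only [map_smul, smul_eq_mul, Complex.ofReal_sum, Complex.ofReal_mul, hTre, hda]
      exact Finset.sum_congr rfl fun m _ => mul_comm _ _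
    rw [h4] at h3
    have h5 := hasDerivAt_toC_line ((hT w l).hol.differentiableAt (hstrip t)) v
    have h6 := HasDerivAt.fun_mul h3 h5
    simpa only [Function.comp_def, zero_smul, add_zero] using h6
  have hcomm : ∀ v w t l, fderiv ℂ (fun θ => (jac K θ *ᵥ toC w) l) (toC t) (toC v) =
      fderiv ℂ (fun θ => (jac K θ *ᵥ toC v) l) (toC t) (toC w) :=
    fun v w t l => fderiv_jac_mulVec_comm hK.diff (hstrip t) _ _ l
  refine ⟨fun w => cubeCoeff (g w), fun v w k => ?_⟩
  -- the mixed second derivatives of `K` cancel in the exterior derivative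
  have hvw : ∀ t, toC v ⬝ᵥ (E.lagrange K (toC t) *ᵥ toC w) = ψ v w t - ψ w v t := by
    intro t
    have hm := hK.mapsTo _ (hstrip t)
    have hinv : ∀ i j, (E.B (K (toC t)))⁻¹ i j = da i j t - da j i t := fun i j => by
      rw [hxr] at hm ⊢
      rw [inv_B_toC (hxU t) hm, hex _ (hxU t) i j, Complex.ofReal_sub]
    have h1 : toC v ⬝ᵥ (E.lagrange K (toC t) *ᵥ toC w) =
        (jac K (toC t) *ᵥ toC v) ⬝ᵥ ((E.B (K (toC t)))⁻¹ *ᵥ (jac K (toC t) *ᵥ toC w)) := by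
      rw [lagrange, ← Matrix.mulVec_mulVec, ← Matrix.mulVec_mulVec, Matrix.dotProduct_mulVec,
        Matrix.vecMul_transpose]
    rw [h1]
    have h2 : ∀ i, ((E.B (K (toC t)))⁻¹ *ᵥ (jac K (toC t) *ᵥ toC w)) i =
        ∑ j, (da i j t - da j i t) * (jac K (toC t) *ᵥ toC w) j := fun i => by
      simp only [← hinv]; rfl
    simp only [dotProduct, h2, hψ, Finset.sum_add_distrib, hcomm w v t, add_sub_add_right_eq_sub,
      sub_mul, Finset.sum_sub_distrib, mul_sub, Finset.mul_sum, Finset.sum_mul]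
    congr 1
    · rw [Finset.sum_comm]
      exact Finset.sum_congr rfl fun l _ => Finset.sum_congr rfl fun m _ => by ring
    · exact Finset.sum_congr rfl fun l _ => Finset.sum_congr rfl fun m _ => by ring
  unfold fcoeff
  simp only [hvw]
  have hs : cubeCoeff (fun t => ψ v w t - ψ w v t) k =
      cubeCoeff (ψ v w) k - cubeCoeff (ψ w v) k := by
    unfold cubeCoeff
    rw [← cubeAvg_sub]
    · simp only [sub_mul]
    · exact ((hψc v w).mul (contPeriodic_expC (-k))).cont
    · exact ((hψc w v).mul (contPeriodic_expC (-k))).cont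
  rw [hs, cubeCoeff_deriv (hgc w) (hψc v w) v (hder v w) k,
    cubeCoeff_deriv (hgc v) (hψc w v) w (hder w v) k]
  ring

theorem single_dotProduct_lagrange (i : Fin n) (θ w : Fin n → ℂ) :
    (Pi.single i 1 : Fin n → ℂ) ⬝ᵥ (E.lagrange K θ *ᵥ w) = (E.lagrange K θ *ᵥ w) i := by
  rw [single_one_dotProduct]

variable {ω : Fin n → ℝ} (hD : S.Domain D) (hK : S.TorusIn D ρ K)
  (hBu : ∀ z ∈ D, IsUnit (E.B z).det)
include hD hK hBu

/-- With `e = B ∇H - DK ω`, the right-hand side `p_y` is the contraction of the pulled-back two-form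
with `ω`, up to the gradient of the energy along the torus. -/
theorem pY_eq {θ : Fin n → ℂ} (hθ : θ ∈ strip n ρ) (j : Fin n) :
    E.pY ω K θ j = (E.lagrange K θ *ᵥ toC ω) j
      - fderiv ℂ (fun θ => E.H (K θ)) θ (Pi.single j 1) := by
  have hu := hBu _ (hK.mapsTo θ hθ)
  have h1 : E.pY ω K θ = E.lagrange K θ *ᵥ toC ω - (jac K θ)ᵀ *ᵥ E.grad (K θ) := by
    rw [pY, err, dω, fderiv_eq_jac_mulVec, lagrange, Matrix.mulVec_sub, neg_sub,
      Matrix.mulVec_mulVec, Matrix.mulVec_mulVec, Matrix.mul_assoc _ _ (E.B (K θ)),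
      Matrix.nonsing_inv_mul _ hu, Matrix.mul_one]
  have h2 : HasFDerivAt (fun θ => E.H (K θ)) ((fderiv ℂ E.H (K θ)).comp (fderiv ℂ K θ)) θ :=
    (E.holo_H.differentiableAt (hD.isOpen.mem_nhds (hK.mapsTo θ hθ))).hasFDerivAt.comp θ
      (hK.differentiableAt hθ).hasFDerivAt
  rw [h1, Pi.sub_apply, h2.fderiv, ContinuousLinearMap.comp_apply]
  congr 1
  have hh : fderiv ℂ K θ (Pi.single j 1) =
      ∑ l, jac K θ l j • (Pi.single l 1 : Fin (2 * n) → ℂ) := by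
    ext k; simp [Finset.sum_apply, Pi.single_apply, jac]
  rw [hh, map_sum]
  simp only [map_smul, smul_eq_mul, Matrix.mulVec, dotProduct, Matrix.transpose_apply, grad]

/-- The Fourier coefficients of `p_y`, in terms of those of a one-form `G` on the torus. -/
theorem exists_fcoeff_pY (ω : Fin n → ℝ) :
    ∃ (G : Fin n → (Fin n → ℤ) → ℂ) (h : (Fin n → ℤ) → ℂ),
      (∀ i j k, fcoeff (fun θ => E.lagrange K θ i j) k =
        2 * Real.pi * Complex.I * (k i * G j k - k j * G i k)) ∧
      ∀ j k, fcoeff (fun θ => E.pY ω K θ j) k =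
        2 * Real.pi * Complex.I * (k j * h k - ((∑ i, (k i : ℝ) * ω i : ℝ) : ℂ) * G j k) := by
  obtain ⟨G, hG⟩ := exists_fcoeff_lagrange (E := E) hK
  have hsum : ∀ (k : Fin n → ℤ) (j : Fin n),
      ((∑ i, (k i : ℝ) * (Pi.single j (1 : ℝ) : Fin n → ℝ) i : ℝ) : ℂ) = k j := fun k j => by
    simp [Pi.single_apply]
  have hL := matHol_lagrange hD hK hBu
  have hH := hK.comp (phaseHol_H (E := E) hD)
  refine ⟨fun j => G (Pi.single j 1), fun k => G ω k - fcoeff (fun θ => E.H (K θ)) k,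
    fun i j k => ?_, fun j k => ?_⟩
  · have := hG (Pi.single i 1) (Pi.single j 1) k
    rw [hsum, hsum] at this
    rw [← this]
    congr 1
    ext θ
    rw [toC_single, toC_single, single_dotProduct_lagrange, Matrix.mulVec_single_one]
    rfl
  · have h1 := hG (Pi.single j 1) ω k
    have h2 := hH.hol.fcoeff_fderiv hK.pos (Pi.single j 1) k
    have h3 := fcoeff_sub hK.pos ((hL.mulVec (vecHol_toC ω)) j).hol
      (hH.fderiv_apply hK.pos (Pi.single j 1)).hol k
    rw [hsum] at h1 h2
    simp only [toC_single, single_dotProduct_lagrange] at h1 h2 h3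
    have h4 : fcoeff (fun θ => E.pY ω K θ j) k = fcoeff (fun θ => (E.lagrange K θ *ᵥ toC ω) j
        - fderiv ℂ (fun θ => E.H (K θ)) θ (Pi.single j 1)) k := by
      unfold fcoeff
      congr 1
      ext t
      exact pY_eq hD hK hBu (toC_mem_strip hK.pos t) j
    rw [h4, h3, h1, h2]
    ring

/-- The right-hand side `p_y` has average zero. -/
theorem average_pY (ω : Fin n → ℝ) (j : Fin n) : average (fun θ => E.pY ω K θ j) = 0 := by
  obtain ⟨G, h, -, h2⟩ := exists_fcoeff_pY hD hK hBu ω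
  rw [← fcoeff_zero, h2]
  simp

/-- If `∂_ω ξ = -p_y`, then the pull-back of the two-form to the torus is the exterior derivative
of `ξ`: the Fourier coefficients of `p_y` show that `ξ` differs from the pulled-back one-form by a
gradient, as `k · ω ≠ 0` for `k ≠ 0`. -/
theorem lagrange_eq_of_dω {γ σ : ℝ} (hω : IsDiophantine γ σ ω) (hγ : 0 < γ)
    {ξ : (Fin n → ℂ) → (Fin n → ℂ)} (hξ : ∀ j, HolPeriodic ρ fun θ => ξ θ j)
    (hd : ∀ j, ∀ θ ∈ strip n ρ, fderiv ℂ (fun θ => ξ θ j) θ (toC ω) = -E.pY ω K θ j)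
    {θ : Fin n → ℂ} (hθ : θ ∈ strip n ρ) (i j : Fin n) :
    E.lagrange K θ i j = fderiv ℂ (fun θ => ξ θ j) θ (Pi.single i 1)
      - fderiv ℂ (fun θ => ξ θ i) θ (Pi.single j 1) := by
  obtain ⟨G, h, h1, h2⟩ := exists_fcoeff_pY hD hK hBu ω
  have hsum : ∀ (k : Fin n → ℤ) (j : Fin n),
      ((∑ i, (k i : ℝ) * (Pi.single j (1 : ℝ) : Fin n → ℝ) i : ℝ) : ℂ) = k j := fun k j => by
    simp [Pi.single_apply]
  refine ((matHol_lagrange hD hK hBu) i j).hol.eq_of_fcoeff_eq hK.pos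
    (((hξ j).fderiv_apply (Pi.single i 1)).sub ((hξ i).fderiv_apply (Pi.single j 1)))
    (fun k => ?_) hθ
  have h3 : ∀ i j, fcoeff (fun θ => fderiv ℂ (fun θ => ξ θ j) θ (Pi.single i 1)) k =
      2 * Real.pi * Complex.I * k i * fcoeff (fun θ => ξ θ j) k := fun i j => by
    have := (hξ j).fcoeff_fderiv hK.pos (Pi.single i 1) k
    rwa [hsum, toC_single] at this
  rw [fcoeff_sub hK.pos ((hξ j).fderiv_apply _) ((hξ i).fderiv_apply _), h1, h3, h3]
  by_cases hk : k = 0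
  · subst hk; simp
  set τ : ℂ := ((∑ i, (k i : ℝ) * ω i : ℝ) : ℂ) with hτ
  have hτ0 : τ ≠ 0 := by
    have := hω.pos hγ hk
    rw [hτ, Ne, Complex.ofReal_eq_zero]
    exact abs_pos.1 this
  have h4 : ∀ j, 2 * Real.pi * Complex.I * τ * fcoeff (fun θ => ξ θ j) k =
      -(2 * Real.pi * Complex.I * (k j * h k - τ * G j k)) := fun j => by
    rw [← (hξ j).fcoeff_fderiv hK.pos ω k, ← h2, ← neg_inj, neg_neg]
    have : fcoeff (fun θ => fderiv ℂ (fun θ => ξ θ j) θ (toC ω)) k =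
        fcoeff (fun θ => 0 - E.pY ω K θ j) k := by
      unfold fcoeff
      congr 1
      ext t
      exact (hd j _ (toC_mem_strip hK.pos t)).trans (zero_sub _).symm
    have h0 : fcoeff (fun _ : Fin n → ℂ => (0 : ℂ)) k = 0 := by
      simp [fcoeff, cubeCoeff, cubeAvg]
    rw [this, fcoeff_sub hK.pos (holPeriodic_const 0) (vecHol_pY hD hK hBu ω j).hol, h0, zero_sub,
      neg_neg]
  refine mul_left_cancel₀ hτ0 ?_
  linear_combination (-(k i : ℂ)) * h4 j + (k j : ℂ) * h4 i

end Lagrange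

end System.Extension

end QuasiNewton

namespace QuasiNewton

open Matrix Filter Topology

/-! ### The residual of the linearized equation -/

theorem HasVecDeriv.congr {n : ℕ} {q : Type*} {f g : (Fin n → ℂ) → q → ℂ} {f' : q → ℂ}
    {θ v : Fin n → ℂ} (hf : HasVecDeriv f f' θ v) (h : ∀ᶠ x in 𝓝 θ, g x = f x) :
    HasVecDeriv g f' θ v := fun i => by
  refine HasDerivAt.congr_of_eventuallyEq (hf i) ?_
  have hc : Continuous fun s : ℂ => θ + s • v := by fun_prop
  have ht : Tendsto (fun s : ℂ => θ + s • v) (𝓝 0) (𝓝 θ) := by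
    simpa using hc.tendsto 0
  filter_upwards [ht.eventually h] with s hs
  rw [hs]

section FrameAlgebra

variable {n : ℕ} {A B Bi B₁ B₂ : Matrix (Fin (2 * n)) (Fin (2 * n)) ℂ}
  {X X' : Matrix (Fin (2 * n)) (Fin n) ℂ} {N : Matrix (Fin n) (Fin n) ℂ}

/-- The braces in the definition of `S⁰`. -/
def torsionCore (A B B₁ : Matrix (Fin (2 * n)) (Fin (2 * n)) ℂ)
    (X : Matrix (Fin (2 * n)) (Fin n) ℂ) (N : Matrix (Fin n) (Fin n) ℂ) :
    Matrix (Fin (2 * n)) (Fin (2 * n)) ℂ :=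
  A * B - B * A - B₁ + B * X * N * Xᵀ * (A + Aᵀ)

/-- By the invariance of `B` under the flow, the braces equal `-B (1 - P) (A + Aᵀ)` with the
projection `P = X N Xᵀ`. -/
theorem torsionCore_eq (hA : A * B + B * Aᵀ = B₁) :
    torsionCore A B B₁ X N = B * (X * N * Xᵀ * (A + Aᵀ) - (A + Aᵀ)) := by
  simp only [torsionCore, ← hA, Matrix.mul_sub, Matrix.mul_add, Matrix.mul_assoc]
  abel

/-- The part of the torsion term that is normal to the torus is of the size of the defect of the
frame, because `Xᵀ B⁻¹` annihilates the torsion term. -/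
theorem frameDefect_mul_torsionCore (hA : A * B + B * Aᵀ = B₁) (hB : Bi * B = 1)
    (hN : Xᵀ * X * N = 1) :
    frameDefect X B Bi N * (torsionCore A B B₁ X N * X * N) =
      torsionCore A B B₁ X N * X * N - X * (N * Xᵀ * torsionCore A B B₁ X N * X * N) := by
  have h0 : Xᵀ * Bi * torsionCore A B B₁ X N = 0 := by
    rw [torsionCore_eq hA]
    calc Xᵀ * Bi * (B * (X * N * Xᵀ * (A + Aᵀ) - (A + Aᵀ)))
        = Xᵀ * (Bi * B) * (X * N * Xᵀ * (A + Aᵀ) - (A + Aᵀ)) := by simp only [Matrix.mul_assoc]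
      _ = (Xᵀ * X * N) * (Xᵀ * (A + Aᵀ)) - Xᵀ * (A + Aᵀ) := by
          rw [hB, Matrix.mul_one, Matrix.mul_sub]; simp only [Matrix.mul_assoc]
      _ = 0 := by rw [hN, Matrix.one_mul, sub_self]
  have h1 : ∀ R : Matrix (Fin n) (Fin (2 * n)) ℂ, R = Xᵀ * Bi →
      R * (torsionCore A B B₁ X N * X * N) = 0 := by
    rintro R rfl
    rw [← Matrix.mul_assoc, ← Matrix.mul_assoc, h0, Matrix.zero_mul, Matrix.zero_mul]
  rw [frameDefect, Matrix.sub_mul, Matrix.one_mul, Matrix.add_mul, Matrix.mul_assoc X,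
    Matrix.mul_assoc (B * X * N), h1 _ rfl, Matrix.mul_zero, add_zero, Matrix.add_mul,
    Matrix.mul_assoc (frameG X B N) Xᵀ Bi, Matrix.mul_assoc (frameG X B N), h1 _ rfl,
    Matrix.mul_zero, zero_add]
  simp only [Matrix.mul_assoc]

/-- The error is reproduced by the right-hand sides `p_x`, `p_y` up to the defect of the frame. -/
theorem frameDefect_mulVec (e : Fin (2 * n) → ℂ) (hNt : Nᵀ = N) :
    frameDefect X B Bi N *ᵥ e =
      e + X *ᵥ ((Nᵀ * Xᵀ * (B * X * N * Xᵀ * Bi - 1)) *ᵥ e)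
        + (B * X * N) *ᵥ (-((Xᵀ * Bi) *ᵥ e)) := by
  rw [hNt, frameDefect, frameG, Matrix.mulVec_neg, Matrix.mulVec_mulVec, Matrix.mulVec_mulVec]
  simp only [Matrix.sub_mulVec, Matrix.one_mulVec, Matrix.add_mulVec, Matrix.mul_add,
    Matrix.mul_sub, Matrix.neg_mul, Matrix.mul_neg, Matrix.neg_mulVec, Matrix.mul_assoc,
    Matrix.mul_one]
  abel

/-- The derivative of the frame vectors `B X N`, compared with the linearized flow; `X' = A X - F`
is the derivative of `X` and `B₁ - B₂` that of `B`. -/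
theorem flow_frame_eq (F : Matrix (Fin (2 * n)) (Fin n) ℂ) (hX' : X' = A * X - F) :
    A * (B * X * N) - ((B₁ - B₂) * X * N + B * X' * N
      + B * X * -(N * (X'ᵀ * X + Xᵀ * X') * N)) =
    torsionCore A B B₁ X N * X * N + (B₂ * X * N + B * F * N
      - B * X * (N * (Fᵀ * X + Xᵀ * F) * N)) := by
  subst hX'
  simp only [torsionCore, Matrix.transpose_sub, Matrix.transpose_mul, Matrix.sub_mul,
    Matrix.add_mul, Matrix.mul_add, Matrix.mul_sub, Matrix.mul_neg, Matrix.mul_assoc]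
  abel

/-- The residual of the linearized equation, for the correction `X ξ_x + B X N ξ_y`. -/
theorem residual_algebra {e : Fin (2 * n) → ℂ} {ξx ξy px py : Fin n → ℂ}
    {F : Matrix (Fin (2 * n)) (Fin n) ℂ} {S₀ : Matrix (Fin n) (Fin n) ℂ}
    (hA : A * B + B * Aᵀ = B₁) (hB : Bi * B = 1) (hN : Xᵀ * X * N = 1) (hNt : Nᵀ = N)
    (hX' : X' = A * X - F) (hS : S₀ = N * Xᵀ * torsionCore A B B₁ X N * X * N)
    (hpx : px = (Nᵀ * Xᵀ * (B * X * N * Xᵀ * Bi - 1)) *ᵥ e) (hpy : py = -((Xᵀ * Bi) *ᵥ e)) :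
    e + A *ᵥ (X *ᵥ ξx + (B * X * N) *ᵥ ξy)
      - (X' *ᵥ ξx + X *ᵥ (S₀ *ᵥ ξy - px)
        + (((B₁ - B₂) * X * N + B * X' * N + B * X * -(N * (X'ᵀ * X + Xᵀ * X') * N)) *ᵥ ξy
          + (B * X * N) *ᵥ (-py))) =
    F *ᵥ ξx + (frameDefect X B Bi N * (torsionCore A B B₁ X N * X * N)
        + (B₂ * X * N + B * F * N - B * X * (N * (Fᵀ * X + Xᵀ * F) * N))) *ᵥ ξy
      + frameDefect X B Bi N *ᵥ e := by
  rw [frameDefect_mulVec e hNt, ← hpx, ← hpy, frameDefect_mul_torsionCore hA hB hN, ← hS]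
  have h1 := congrArg (· *ᵥ ξy)
    (flow_frame_eq (A := A) (B := B) (B₁ := B₁) (B₂ := B₂) (N := N) F hX')
  generalize (B₁ - B₂) * X * N + B * X' * N + B * X * -(N * (X'ᵀ * X + Xᵀ * X') * N) = Y' at h1 ⊢
  generalize B₂ * X * N + B * F * N - B * X * (N * (Fᵀ * X + Xᵀ * F) * N) = R at h1 ⊢
  generalize torsionCore A B B₁ X N * X * N = Z at h1 ⊢
  rw [Matrix.sub_mulVec, sub_eq_iff_eq_add] at h1
  rw [Matrix.mulVec_add, Matrix.mulVec_mulVec, Matrix.mulVec_mulVec, h1, hX']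
  simp only [Matrix.sub_mulVec, Matrix.add_mulVec, Matrix.mulVec_sub, Matrix.mulVec_neg,
    Matrix.mulVec_mulVec]
  abel

end FrameAlgebra

namespace System.Extension

variable {n : ℕ} {S : System n} {D : Set (Fin (2 * n) → ℂ)} {E : S.Extension D}
  {ρ : ℝ} {K : (Fin n → ℂ) → (Fin (2 * n) → ℂ)} {ω : Fin n → ℝ}
  (hD : S.Domain D) (hK : S.TorusIn D ρ K) {θ : Fin n → ℂ} (hθ : θ ∈ strip n ρ)

section Derivatives

include hD hK hθ

theorem hasMatDeriv_B (v : Fin n → ℂ) :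
    HasMatDeriv (fun θ => E.B (K θ)) (E.dirB (K θ) (jac K θ *ᵥ v)) θ v := fun i j => by
  have h := ((E.differentiableOn_entry i j).differentiableAt
    (hD.isOpen.mem_nhds (hK.mapsTo θ hθ))).hasFDerivAt.comp θ (hK.differentiableAt hθ).hasFDerivAt
  have h2 := h.hasLineDerivAt v
  rw [ContinuousLinearMap.comp_apply, fderiv_eq_jac_mulVec] at h2
  exact h2

theorem hasVecDeriv_grad (v : Fin n → ℂ) :
    HasVecDeriv (fun θ => E.grad (K θ)) (E.Psi (K θ) *ᵥ (jac K θ *ᵥ v)) θ v := fun i => by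
  have h := (((phaseHol_grad (E := E) hD i).diff).differentiableAt
    (hD.isOpen.mem_nhds (hK.mapsTo θ hθ))).hasFDerivAt.comp θ (hK.differentiableAt hθ).hasFDerivAt
  have h2 := h.hasLineDerivAt v
  rw [ContinuousLinearMap.comp_apply, fderiv_eq_jac_mulVec, ← E.Psi_mulVec] at h2
  exact h2

/-- `A` is the derivative of the vector field `B ∇H` along the torus. -/
theorem hasVecDeriv_field (v : Fin n → ℂ) :
    HasVecDeriv (fun θ => E.B (K θ) *ᵥ E.grad (K θ)) (E.linA K θ *ᵥ (jac K θ *ᵥ v)) θ v := by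
  have h := (hasMatDeriv_B (E := E) hD hK hθ v).mulVec (hasVecDeriv_grad (E := E) hD hK hθ v)
  rwa [← E.Phi_mulVec, Matrix.mulVec_mulVec _ (E.B (K θ)), ← Matrix.add_mulVec] at h

/-- The derivative of the tangent vectors of the torus along the flow. -/
theorem hasMatDeriv_jac :
    HasMatDeriv (jac K) (E.linA K θ * jac K θ - jac (E.err ω K) θ) θ (toC ω) := fun l j => by
  have h1 := hK.matHol_jac.hasMatDeriv hθ (toC ω) l j
  have h2 := (hasVecDeriv_field (E := E) hD hK hθ (Pi.single j 1)) l
  have h3 : HasLineDerivAt ℂ (fun θ => (jac K θ *ᵥ toC ω) l)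
      (fderiv ℂ (fun θ => (jac K θ *ᵥ toC ω) l) θ (Pi.single j 1)) θ (Pi.single j 1) :=
    (((hK.matHol_jac.mulVec (vecHol_toC ω)) l).hol.differentiableAt hθ).hasFDerivAt.hasLineDerivAt _
  have h4 : HasLineDerivAt ℂ (fun θ => E.err ω K θ l) (jac (E.err ω K) θ l j) θ
      (Pi.single j 1) := by
    have hd : DifferentiableAt ℂ (E.err ω K) θ :=
      differentiableAt_pi.2 fun i => (vecHol_err hD hK ω i).hol.differentiableAt hθ
    have := hd.hasFDerivAt.hasLineDerivAt (Pi.single j 1)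
    exact (hasDerivAt_pi.1 this) l
  have h5 : HasLineDerivAt ℂ (fun θ => E.err ω K θ l)
      ((E.linA K θ *ᵥ (jac K θ *ᵥ Pi.single j 1)) l
        - fderiv ℂ (fun θ => (jac K θ *ᵥ toC ω) l) θ (Pi.single j 1)) θ (Pi.single j 1) := by
    have h := HasDerivAt.fun_sub h2 h3
    unfold HasLineDerivAt
    simpa only [err, dω, fderiv_eq_jac_mulVec, Pi.sub_apply] using h
  have h6 := HasDerivAt.unique h4 h5
  rw [← fderiv_jac_mulVec_comm hK.diff hθ, Matrix.mulVec_mulVec, Matrix.mulVec_single_one] at h6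
  have h7 : (E.linA K θ * jac K θ - jac (E.err ω K) θ) l j =
      fderiv ℂ (fun x => jac K x l j) θ (toC ω) := by
    rw [Matrix.sub_apply, h6]
    simp only [Matrix.mulVec_single_one, Matrix.col_apply, sub_sub_cancel]
  rw [h7]
  exact h1

variable (hBu : ∀ z ∈ D, IsUnit (E.B z).det)
  (hN : ∀ θ ∈ strip n ρ, IsUnit ((jac K θ)ᵀ * jac K θ).det)
include hN

/-- The frame `B DK N` along the flow. -/
theorem hasMatDeriv_frame {X' : Matrix (Fin (2 * n)) (Fin n) ℂ}
    (hX' : X' = E.linA K θ * jac K θ - jac (E.err ω K) θ) :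
    HasMatDeriv (fun θ => E.B (K θ) * jac K θ * invGram K θ)
      ((E.dirB (K θ) (E.B (K θ) *ᵥ E.grad (K θ)) - E.dirB (K θ) (E.err ω K θ)) * jac K θ
          * invGram K θ + E.B (K θ) * X' * invGram K θ
        + E.B (K θ) * jac K θ * -(invGram K θ * (X'ᵀ * jac K θ + (jac K θ)ᵀ * X')
          * invGram K θ)) θ (toC ω) := by
  have hXd : HasMatDeriv (jac K) X' θ (toC ω) := hX' ▸ hasMatDeriv_jac (E := E) hD hK hθ
  have hBd := hasMatDeriv_B (E := E) hD hK hθ (toC ω)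
  have hNd : HasMatDeriv (invGram K) _ θ (toC ω) := (hXd.transpose.mul hXd).inv
    (hK.matHol_jac.transpose.mul hK.matHol_jac) hN hθ
  have h := (hBd.mul hXd).mul hNd
  have h1 : jac K θ *ᵥ toC ω = E.B (K θ) *ᵥ E.grad (K θ) - E.err ω K θ := by
    rw [err, dω, fderiv_eq_jac_mulVec, sub_sub_cancel]
  rw [h1, dirB_sub, Matrix.add_mul] at h
  exact h

include hBu in
/-- The residual of the linearized equation. Each term on the right is a product of two small
factors, taken from the error `e`, its derivative, the solution `ξ` and the frame defect `T`. -/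
theorem residual_eq {ξx ξy : (Fin n → ℂ) → (Fin n → ℂ)} {Δ : (Fin n → ℂ) → (Fin (2 * n) → ℂ)}
    (hξx : VecHol ρ ξx) (hξy : VecHol ρ ξy)
    (hx : dω ω ξx θ = E.S0 K θ *ᵥ ξy θ - E.pX ω K θ) (hy : dω ω ξy θ = -E.pY ω K θ)
    (hΔ : ∀ θ ∈ strip n ρ,
      Δ θ = jac K θ *ᵥ ξx θ + (E.B (K θ) * jac K θ * invGram K θ) *ᵥ ξy θ)
    {T Z R : _} (hT : T = frameDefect (jac K θ) (E.B (K θ)) (E.B (K θ))⁻¹ (invGram K θ))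
    (hZ : Z = torsionCore (E.linA K θ) (E.B (K θ)) (E.dirB (K θ) (E.B (K θ) *ᵥ E.grad (K θ)))
      (jac K θ) (invGram K θ) * jac K θ * invGram K θ)
    (hR : R = E.dirB (K θ) (E.err ω K θ) * jac K θ * invGram K θ
      + E.B (K θ) * jac (E.err ω K) θ * invGram K θ
      - E.B (K θ) * jac K θ * (invGram K θ * ((jac (E.err ω K) θ)ᵀ * jac K θ
        + (jac K θ)ᵀ * jac (E.err ω K) θ) * invGram K θ)) :
    E.err ω K θ + E.linA K θ *ᵥ Δ θ - dω ω Δ θ =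
      jac (E.err ω K) θ *ᵥ ξx θ + (T * Z + R) *ᵥ ξy θ + T *ᵥ E.err ω K θ := by
  set X' := E.linA K θ * jac K θ - jac (E.err ω K) θ with hX'
  have hξd : ∀ {ξ : (Fin n → ℂ) → (Fin n → ℂ)}, VecHol ρ ξ →
      HasVecDeriv ξ (dω ω ξ θ) θ (toC ω) := fun {ξ} h j => by
    have hd : DifferentiableAt ℂ ξ θ :=
      differentiableAt_pi.2 fun i => (h i).hol.differentiableAt hθ
    exact hasDerivAt_pi.1 (hd.hasFDerivAt.hasLineDerivAt (toC ω)) j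
  have h1 := (hX' ▸ hasMatDeriv_jac (E := E) (ω := ω) hD hK hθ :
    HasMatDeriv (jac K) X' θ (toC ω)).mulVec (hξd hξx)
  have h2 := (hasMatDeriv_frame hD hK hθ hN hX').mulVec (hξd hξy)
  have h3 := h1.add h2
  have hΔh : VecHol ρ Δ := by
    intro i
    have := ((hK.matHol_jac.mulVec hξx).add
      ((((matHol_B (E := E) hD hK).mul hK.matHol_jac).mul (matHol_invGram hK hN)).mulVec hξy)) i
    exact this.congr hK.pos fun θ hθ => congrFun (hΔ θ hθ) i
  have h4 : HasVecDeriv Δ (dω ω Δ θ) θ (toC ω) := fun j => by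
    have hd : DifferentiableAt ℂ Δ θ :=
      differentiableAt_pi.2 fun i => (hΔh i).hol.differentiableAt hθ
    exact hasDerivAt_pi.1 (hd.hasFDerivAt.hasLineDerivAt (toC ω)) j
  have h5 := h4.unique (h3.congr (by
    filter_upwards [(isOpen_strip n ρ).mem_nhds hθ] with x hx using hΔ x hx))
  have hu := hBu _ (hK.mapsTo θ hθ)
  have hNt : (invGram K θ)ᵀ = invGram K θ := by
    rw [invGram, Matrix.transpose_nonsing_inv, Matrix.transpose_mul, Matrix.transpose_transpose]
  rw [h5, hx, hy, hΔ θ hθ]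
  subst hT hZ hR
  have hNi : (jac K θ)ᵀ * jac K θ * invGram K θ = 1 := Matrix.mul_nonsing_inv _ (hN θ hθ)
  exact residual_algebra (linA_mul_B hD hK hθ) (Matrix.nonsing_inv_mul _ hu) hNi hNt hX' rfl rfl rfl

end Derivatives

end System.Extension

end QuasiNewton

namespace QuasiNewton

open Matrix Filter Topology

/-! ### Bounds for the system and their variation -/

theorem norm_single_one_le {m : ℕ} (i : Fin m) : ‖(Pi.single i 1 : Fin m → ℂ)‖ ≤ 1 := by
  refine (pi_norm_le_iff_of_nonneg zero_le_one).2 fun j => ?_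
  by_cases h : j = i
  · subst h; simp
  · simp [h]

/-- Entrywise bounds give a bound for the operator norm, at the cost of one power of `Q`. -/
theorem PowBound.of_entries {p q : Type*} [Fintype p] [Fintype q] {Q x : ℝ} {k : ℕ}
    {A : Matrix p q ℂ} (hQ : 2 ≤ Q) (hx : 0 ≤ x) (hq : (Fintype.card q : ℝ) ≤ Q)
    (h : ∀ i j, PowBound Q k x (A i j)) : PowBound Q (k + 1) x A := by
  have h0 : 0 ≤ Q ^ k * x := by positivity
  refine (norm_le_of_entries h0 h).trans ((mul_le_mul_of_nonneg_right hq h0).trans_eq (by ring))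

theorem PowClose.of_entries {p q : Type*} [Fintype p] [Fintype q] {Q τ : ℝ} {k : ℕ}
    {A A' : Matrix p q ℂ} (hQ : 2 ≤ Q) (hτ : 0 ≤ τ) (hq : (Fintype.card q : ℝ) ≤ Q)
    (h : ∀ i j, PowClose Q τ k (A i j) (A' i j)) : PowClose Q τ (k + 1) A A' :=
  ⟨.of_entries hQ zero_le_one hq fun i j => (h i j).left,
    .of_entries hQ zero_le_one hq fun i j => (h i j).right,
    .of_entries hQ hτ hq fun i j => (h i j).diff⟩

theorem PowBound.apply {q : Type*} [Fintype q] {Q x : ℝ} {k : ℕ} {v : q → ℂ}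
    (h : PowBound Q k x v) (i : q) : PowBound Q k x (v i) := (norm_le_pi_norm v i).trans h

theorem PowClose.apply {q : Type*} [Fintype q] {Q τ : ℝ} {k : ℕ} {v v' : q → ℂ}
    (h : PowClose Q τ k v v') (i : q) : PowClose Q τ k (v i) (v' i) :=
  ⟨h.left.apply i, h.right.apply i, h.diff.apply i⟩

theorem PowClose.refl {E : Type*} [SeminormedAddCommGroup E] {Q τ : ℝ} {k : ℕ} {a : E}
    (hQ : 2 ≤ Q) (hτ : 0 ≤ τ) (h : PowBound Q k 1 a) : PowClose Q τ k a a :=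
  ⟨h, h, by simp only [PowBound, sub_self, norm_zero]; positivity⟩

theorem powBound_pi {q : Type*} [Fintype q] {Q x : ℝ} {k : ℕ} {v : q → ℂ} (hQ : 2 ≤ Q)
    (hx : 0 ≤ x) (h : ∀ i, PowBound Q k x (v i)) : PowBound Q k x v :=
  (pi_norm_le_iff_of_nonneg (by positivity)).2 h

/-- A linear functional of norm at most one does not increase the derivatives. -/
theorem norm_iteratedFDeriv_linear_le {V F : Type*} [NormedAddCommGroup V] [NormedSpace ℂ V]
    [NormedAddCommGroup F] [NormedSpace ℂ F] (L : F →ₗ[ℂ] ℂ) (hL : ∀ x, ‖L x‖ ≤ ‖x‖) {f : V → F}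
    {z : V} {j : ℕ} (hf : ContDiffAt ℂ j f z) :
    ‖iteratedFDeriv ℂ j (fun z => L (f z)) z‖ ≤ ‖iteratedFDeriv ℂ j f z‖ := by
  have h := ContinuousLinearMap.norm_iteratedFDeriv_comp_left
    (L.mkContinuous 1 fun x => by rw [one_mul]; exact hL x) hf le_rfl
  exact h.trans (mul_le_of_le_one_left (norm_nonneg _) (L.mkContinuous_norm_le zero_le_one _))

/-- `f` is holomorphic on `D`, and its derivatives up to order `m` are bounded by `Q` there. -/
structure SmoothBound {V : Type*} [NormedAddCommGroup V] [NormedSpace ℂ V] (D : Set V) (Q : ℝ)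
    (m : ℕ) (f : V → ℂ) : Prop where
  diff : DifferentiableOn ℂ f D
  bound : ∀ j ≤ m, ∀ z ∈ D, ‖iteratedFDeriv ℂ j f z‖ ≤ Q

section SmoothBound

variable {V : Type*} [NormedAddCommGroup V] [NormedSpace ℂ V] [FiniteDimensional ℂ V] {D s : Set V}
  {Q : ℝ} {m : ℕ} {f : V → ℂ} (hD : IsOpen D)

include hD in
theorem SmoothBound.fderiv_apply (hf : SmoothBound D Q (m + 1) f) {v : V} (hv : ‖v‖ ≤ 1) :
    SmoothBound D Q m fun z => fderiv ℂ f z v := by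
  refine ⟨differentiableOn_fderiv_apply hD hf.diff v, fun j hj z hz => ?_⟩
  have hc : ContDiffAt ℂ j (fderiv ℂ f) z :=
    ((contDiffOn_of_differentiableOn_complex hD hf.diff (j + 1)).contDiffAt
      (hD.mem_nhds hz)).fderiv_right (by norm_cast)
  have h := norm_iteratedFDeriv_clm_apply_const (c := v) hc le_rfl
  rw [norm_iteratedFDeriv_fderiv] at h
  refine h.trans ?_
  have h2 := hf.bound (j + 1) (by omega) z hz
  exact (mul_le_of_le_one_left (norm_nonneg _) hv).trans h2

omit [FiniteDimensional ℂ V] in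
theorem SmoothBound.norm_le (hf : SmoothBound D Q m f) {z : V} (hz : z ∈ D) : ‖f z‖ ≤ Q := by
  have := hf.bound 0 (Nat.zero_le _) z hz
  rwa [norm_iteratedFDeriv_zero] at this

omit [FiniteDimensional ℂ V] in
theorem SmoothBound.nonneg (hf : SmoothBound D Q m f) {z : V} (hz : z ∈ D) : 0 ≤ Q :=
  (norm_nonneg _).trans (hf.norm_le hz)

omit [FiniteDimensional ℂ V] in
theorem SmoothBound.norm_fderiv_le (hf : SmoothBound D Q (m + 1) f) {z : V} (hz : z ∈ D) :
    ‖fderiv ℂ f z‖ ≤ Q := by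
  have := hf.bound 1 (by omega) z hz
  rwa [norm_iteratedFDeriv_one] at this

variable (hs : Convex ℝ s) (hsD : s ⊆ D) {z z' : V} (hz : z ∈ s) (hz' : z' ∈ s)
include hD hs hsD hz hz'

omit [FiniteDimensional ℂ V] in
theorem SmoothBound.norm_sub_le (hf : SmoothBound D Q (m + 1) f) :
    ‖f z' - f z‖ ≤ Q * ‖z' - z‖ :=
  hs.norm_image_sub_le_of_norm_fderiv_le (𝕜 := ℂ)
    (fun _ hx => hf.diff.differentiableAt (hD.mem_nhds (hsD hx)))
    (fun _ hx => hf.norm_fderiv_le (hsD hx)) hz hz'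

theorem SmoothBound.norm_fderiv_sub_le (hf : SmoothBound D Q (m + 2) f) :
    ‖fderiv ℂ f z' - fderiv ℂ f z‖ ≤ Q * ‖z' - z‖ := by
  have hQ := hf.nonneg (hsD hz)
  refine hs.norm_image_sub_le_of_norm_fderiv_le (𝕜 := ℂ) (f := fderiv ℂ f) (fun _ hx => ?_)
    (fun x hx => ?_) hz hz'
  · exact (((contDiffOn_of_differentiableOn_complex hD hf.diff 2).contDiffAt
      (hD.mem_nhds (hsD hx))).fderiv_right (m := 1) (by norm_num)).differentiableAt (by norm_num)
  · have := hf.bound 2 (by omega) x (hsD hx)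
    rwa [← norm_iteratedFDeriv_fderiv, norm_iteratedFDeriv_one] at this

/-- The first order Taylor estimate. -/
theorem SmoothBound.taylor (hf : SmoothBound D Q (m + 2) f) :
    ‖f z' - f z - fderiv ℂ f z (z' - z)‖ ≤ Q * ‖z' - z‖ ^ 2 := by
  have hQ := hf.nonneg (hsD hz)
  have hseg : segment ℝ z z' ⊆ s := hs.segment_subset hz hz'
  have h := (convex_segment z z').norm_image_sub_le_of_norm_fderiv_le' (𝕜 := ℂ) (f := f)
    (φ := fderiv ℂ f z) (C := Q * ‖z' - z‖)
    (fun x hx => hf.diff.differentiableAt (hD.mem_nhds (hsD (hseg hx)))) (fun x hx => ?_)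
    (left_mem_segment ℝ z z') (right_mem_segment ℝ z z')
  · rwa [mul_assoc, ← sq] at h
  · refine (hf.norm_fderiv_sub_le hD hs hsD hz (hseg hx)).trans ?_
    refine mul_le_mul_of_nonneg_left ?_ hQ
    rw [segment_eq_image'] at hx
    obtain ⟨t, ht, rfl⟩ := hx
    rw [add_sub_cancel_left, norm_smul, Real.norm_of_nonneg ht.1]
    exact mul_le_of_le_one_left (norm_nonneg _) ht.2

variable {τ : ℝ} (hτ : ‖z' - z‖ ≤ τ)
include hτ

omit [FiniteDimensional ℂ V] in
theorem SmoothBound.close (hf : SmoothBound D Q (m + 1) f) : PowClose Q τ 1 (f z) (f z') := by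
  have hQ := hf.nonneg (hsD hz)
  refine ⟨?_, ?_, ?_⟩
  · simpa [PowBound] using hf.norm_le (hsD hz)
  · simpa [PowBound] using hf.norm_le (hsD hz')
  · rw [PowBound, pow_one]
    exact (hf.norm_sub_le hD hs hsD hz hz').trans (by gcongr)

theorem SmoothBound.close_fderiv (hQ : 2 ≤ Q) (hf : SmoothBound D Q (m + 2) f) {h h' : V} {k : ℕ}
    (hh : PowClose Q τ k h h') : PowClose Q τ (k + 2) (fderiv ℂ f z h) (fderiv ℂ f z' h') := by
  have hτ0 : 0 ≤ τ := (norm_nonneg _).trans hτ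
  have hb : ∀ w ∈ s, ∀ u l x, PowBound Q l x u → PowBound Q (l + 1) x (fderiv ℂ f w u) := by
    intro w hw u l x hu
    exact (ContinuousLinearMap.le_of_opNorm_le_of_le _ (hf.norm_fderiv_le (hsD hw)) hu).trans_eq
      (by ring)
  refine ⟨(hb z hz _ _ _ hh.left).mono hQ zero_le_one (by omega) le_rfl,
    (hb z' hz' _ _ _ hh.right).mono hQ zero_le_one (by omega) le_rfl, ?_⟩
  have e : fderiv ℂ f z' h' - fderiv ℂ f z h =
      (fderiv ℂ f z' - fderiv ℂ f z) h' + fderiv ℂ f z (h' - h) := by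
    rw [_root_.sub_apply, map_sub]; abel
  rw [e]
  have h1 : PowBound Q (k + 1) τ ((fderiv ℂ f z' - fderiv ℂ f z) h') := by
    have hL' : ‖fderiv ℂ f z' - fderiv ℂ f z‖ ≤ Q * τ :=
      (hf.norm_fderiv_sub_le hD hs hsD hz hz').trans (by gcongr)
    refine (ContinuousLinearMap.le_of_opNorm_le_of_le _ hL' hh.right).trans_eq ?_
    ring
  exact (h1.add hQ hτ0 (hb z hz _ _ _ hh.diff)).mono hQ hτ0 (by simp) le_rfl

end SmoothBound

namespace System.Extension

variable {n : ℕ} {S : System n} {D : Set (Fin (2 * n) → ℂ)} {E : S.Extension D}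

theorem NormBounds.mono {bB bI bH bB' bI' bH' : ℝ} (h : E.NormBounds bB bI bH) (h1 : bB ≤ bB')
    (h2 : bI ≤ bI') (h3 : bH ≤ bH') : E.NormBounds bB' bI' bH' :=
  ⟨fun j hj z hz => (h.bound_B j hj z hz).trans h1, h.invertible,
    fun z hz => (h.bound_inv z hz).trans h2, fun j hj z hz => (h.bound_H j hj z hz).trans h3⟩

variable {Q : ℝ} (hE : E.NormBounds Q Q Q)
include hE

theorem NormBounds.B_le {z : Fin (2 * n) → ℂ} (hz : z ∈ D) : PowBound Q 1 1 (E.B z) := by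
  have := hE.bound_B 0 (by norm_num) z hz
  rw [norm_iteratedFDeriv_zero] at this
  simpa [PowBound] using this

theorem NormBounds.inv_le {z : Fin (2 * n) → ℂ} (hz : z ∈ D) : PowBound Q 1 1 (E.B z)⁻¹ := by
  simpa [PowBound] using hE.bound_inv z hz

theorem NormBounds.smooth_H : SmoothBound D Q 3 E.H := ⟨E.holo_H, hE.bound_H⟩

variable (hD : IsOpen D)
include hD

theorem NormBounds.smooth_B (i j : Fin (2 * n)) : SmoothBound D Q 2 fun z => E.B z i j := by
  refine ⟨E.differentiableOn_entry i j, fun l hl z hz => ?_⟩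
  have hc : ContDiffAt ℂ l E.B z :=
    (contDiffOn_of_differentiableOn_complex hD E.holo_B l).contDiffAt (hD.mem_nhds hz)
  exact (norm_iteratedFDeriv_linear_le (Matrix.entryLinearMap ℂ ℂ i j)
    (fun A => norm_entry_le A i j) hc).trans (hE.bound_B l hl z hz)

theorem NormBounds.smooth_grad (i : Fin (2 * n)) : SmoothBound D Q 2 fun z => E.grad z i :=
  hE.smooth_H.fderiv_apply hD (norm_single_one_le i)

theorem NormBounds.smooth_Psi (i k : Fin (2 * n)) : SmoothBound D Q 1 fun z => E.Psi z i k :=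
  (hE.smooth_grad hD i).fderiv_apply hD (norm_single_one_le k)

variable (hQ : 2 ≤ Q) (hn : ((2 * n : ℕ) : ℝ) ≤ Q) {s : Set (Fin (2 * n) → ℂ)} (hs : Convex ℝ s)
  (hsD : s ⊆ D) {z z' : Fin (2 * n) → ℂ} (hz : z ∈ s) (hz' : z' ∈ s)
include hQ hs hsD hz hz'

theorem NormBounds.taylor_grad :
    PowBound Q 1 (‖z' - z‖ ^ 2) (E.grad z' - E.grad z - E.Psi z *ᵥ (z' - z)) := by
  refine powBound_pi hQ (by positivity) fun i => ?_
  rw [Pi.sub_apply, Psi_mulVec, PowBound, pow_one]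
  exact (hE.smooth_grad hD i).taylor hD hs hsD hz hz'

include hn in
theorem NormBounds.taylor_B :
    PowBound Q 2 (‖z' - z‖ ^ 2) (E.B z' - E.B z - E.dirB z (z' - z)) := by
  refine .of_entries hQ (by positivity) (by simpa using hn) fun i j => ?_
  rw [PowBound, pow_one]
  exact (hE.smooth_B hD i j).taylor hD hs hsD hz hz'

variable {τ : ℝ} (hτ : ‖z' - z‖ ≤ τ)
include hτ

theorem NormBounds.close_grad : PowClose Q τ 1 (E.grad z) (E.grad z') := by
  have hτ0 : 0 ≤ τ := (norm_nonneg _).trans hτ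
  have h := fun i => (hE.smooth_grad hD i).close hD hs hsD hz hz' hτ
  exact ⟨powBound_pi hQ zero_le_one fun i => (h i).left,
    powBound_pi hQ zero_le_one fun i => (h i).right, powBound_pi hQ hτ0 fun i => (h i).diff⟩

include hn

theorem NormBounds.close_B : PowClose Q τ 2 (E.B z) (E.B z') :=
  .of_entries hQ ((norm_nonneg _).trans hτ) (by simpa using hn) fun i j =>
    (hE.smooth_B hD i j).close hD hs hsD hz hz' hτ

theorem NormBounds.close_dirB {h h' : Fin (2 * n) → ℂ} {k : ℕ} (hh : PowClose Q τ k h h') :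
    PowClose Q τ (k + 3) (E.dirB z h) (E.dirB z' h') :=
  .of_entries hQ ((norm_nonneg _).trans hτ) (by simpa using hn) fun i j =>
    (hE.smooth_B hD i j).close_fderiv (m := 0) hD hs hsD hz hz' hτ hQ hh

theorem NormBounds.close_Psi : PowClose Q τ 2 (E.Psi z) (E.Psi z') :=
  .of_entries hQ ((norm_nonneg _).trans hτ) (by simpa using hn) fun i j =>
    (hE.smooth_Psi hD i j).close hD hs hsD hz hz' hτ

theorem NormBounds.close_Phi : PowClose Q τ 6 (E.Phi z) (E.Phi z') := by
  have hτ0 : 0 ≤ τ := (norm_nonneg _).trans hτ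
  refine PowClose.of_entries hQ hτ0 (by simpa using hn) fun i k => ?_
  have h0 : PowBound Q 0 1 (Pi.single k 1 : Fin (2 * n) → ℂ) := by
    simpa [PowBound] using norm_single_one_le k
  exact ((hE.close_dirB hD hQ hn hs hsD hz hz' hτ (.refl hQ hτ0 h0)).mulVec hQ hτ0
    (hE.close_grad hD hQ hs hsD hz hz' hτ)).apply i

/-- The linear part `A`, as a function on the phase space. -/
theorem NormBounds.close_A :
    PowClose Q τ 7 (E.Phi z + E.B z * E.Psi z) (E.Phi z' + E.B z' * E.Psi z') := by
  have hτ0 : 0 ≤ τ := (norm_nonneg _).trans hτ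
  exact (hE.close_Phi hD hQ hn hs hsD hz hz' hτ).add hQ hτ0
    ((hE.close_B hD hQ hn hs hsD hz hz' hτ).mul hQ hτ0 (hE.close_Psi hD hQ hn hs hsD hz hz' hτ))

end System.Extension

end QuasiNewton

namespace QuasiNewton

open Matrix Filter Topology

/-! ### Estimates for the correction -/

/-- Cauchy's estimate on strips. -/
theorem norm_fderiv_le_of_strip {n : ℕ} {F : Type*} [NormedAddCommGroup F] [NormedSpace ℂ F]
    {f : (Fin n → ℂ) → F} {ρ δ M : ℝ} (hδ : 0 < δ) (hf : DifferentiableOn ℂ f (strip n ρ))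
    (hM : ∀ θ ∈ strip n ρ, ‖f θ‖ ≤ M) {θ : Fin n → ℂ} (hθ : θ ∈ strip n (ρ - δ)) :
    ‖fderiv ℂ f θ‖ ≤ M / δ := by
  have hb : ∀ y ∈ Metric.closedBall θ δ, y ∈ strip n ρ := fun y hy j => by
    have h1 := (norm_le_pi_norm (y - θ) j).trans (mem_closedBall_iff_norm.1 hy)
    have h2 : |(y j - θ j).im| ≤ δ := (Complex.abs_im_le_norm _).trans h1
    have h3 := hθ j
    rw [Complex.sub_im] at h2
    have h4 : (y j).im = ((y j).im - (θ j).im) + (θ j).im := by ring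
    rw [h4]
    exact (abs_add_le _ _).trans_lt (by linarith)
  exact norm_fderiv_le_of_closedBall hδ
    (fun y hy => hf.differentiableAt ((isOpen_strip n ρ).mem_nhds (hb y hy))) fun y hy =>
    hM y (hb y hy)

theorem powBound_jac_of_strip {n p : ℕ} {f : (Fin n → ℂ) → (Fin p → ℂ)} {ρ δ Q x : ℝ} {k : ℕ}
    (hQ : 2 ≤ Q) (hn : (n : ℝ) ≤ Q) (hδ : 0 < δ) (hx : 0 ≤ x)
    (hf : DifferentiableOn ℂ f (strip n ρ)) (hM : ∀ θ ∈ strip n ρ, PowBound Q k x (f θ))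
    {θ : Fin n → ℂ} (hθ : θ ∈ strip n (ρ - δ)) : PowBound Q (k + 1) (x / δ) (jac f θ) := by
  refine .of_entries hQ (by positivity) (by simpa using hn) fun i j => ?_
  have h := norm_fderiv_le_of_strip hδ hf hM hθ
  have h2 := (fderiv ℂ f θ).le_opNorm_of_le (norm_single_one_le j)
  refine ((norm_le_pi_norm _ i).trans h2).trans ?_
  rw [mul_one, ← mul_div_assoc]
  exact h

theorem norm_average_le {n : ℕ} {f : (Fin n → ℂ) → ℂ} {M : ℝ} (h : ∀ t, ‖f (toC t)‖ ≤ M) :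
    ‖average f‖ ≤ M := norm_cubeAvg_le h

theorem average_sub {n : ℕ} {ρ : ℝ} {f g : (Fin n → ℂ) → ℂ} (hρ : 0 < ρ) (hf : HolPeriodic ρ f)
    (hg : HolPeriodic ρ g) : average (fun θ => f θ - g θ) = average f - average g :=
  cubeAvg_sub (hf.contPeriodic_real hρ).cont (hg.contPeriodic_real hρ).cont

theorem average_fderiv {n : ℕ} {ρ : ℝ} {f : (Fin n → ℂ) → ℂ} (hρ : 0 < ρ) (hf : HolPeriodic ρ f)
    (v : Fin n → ℝ) : average (fun θ => fderiv ℂ f θ (toC v)) = 0 := by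
  rw [← fcoeff_zero, hf.fcoeff_fderiv hρ]; simp

theorem average_mulVec_const {n p q : ℕ} {ρ : ℝ} {A : (Fin n → ℂ) → Matrix (Fin p) (Fin q) ℂ}
    (hρ : 0 < ρ) (hA : MatHol ρ A) (c : Fin q → ℂ) (i : Fin p) :
    average (fun θ => (A θ *ᵥ c) i) = (matAverage A *ᵥ c) i := by
  simp only [Matrix.mulVec, dotProduct, average, matAverage, Matrix.of_apply]
  rw [MeasureTheory.integral_finsetSum]
  · exact Finset.sum_congr rfl fun j _ => MeasureTheory.integral_mul_const _ _
  · exact fun j _ => (integrableOn_unitCube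
      ((hA i j).hol.contPeriodic_real hρ).cont).mul_const _

theorem RealAnalyticPeriodic.vecHol {n p : ℕ} {ρ : ℝ} {f : (Fin n → ℂ) → (Fin p → ℂ)}
    (hf : RealAnalyticPeriodic ρ f) : VecHol ρ f := fun j =>
  ⟨⟨differentiableOn_pi.1 hf.differentiableOn j, fun k θ hθ => by rw [hf.periodic k θ hθ]⟩,
    fun t => by obtain ⟨x, hx⟩ := hf.real t; rw [hx]; simp [toC]⟩

theorem VecHol.differentiableOn {n : ℕ} {p : Type*} [Fintype p] {ρ : ℝ}
    {f : (Fin n → ℂ) → p → ℂ} (hf : VecHol ρ f) : DifferentiableOn ℂ f (strip n ρ) :=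
  differentiableOn_pi.2 fun i => (hf i).hol.diff

theorem VecHol.dω_apply {n p : ℕ} {ρ : ℝ} {f : (Fin n → ℂ) → Fin p → ℂ} (hf : VecHol ρ f)
    (ω : Fin n → ℝ) {θ : Fin n → ℂ} (hθ : θ ∈ strip n ρ) (j : Fin p) :
    fderiv ℂ (fun θ => f θ j) θ (toC ω) = dω ω f θ j := by
  rw [fderiv_apply (hf.differentiableOn.differentiableAt ((isOpen_strip n ρ).mem_nhds hθ)) j]
  rfl

/-- The loss factor `γ⁻¹ δ^{-σ}` for the solution of one small divisor equation. -/
noncomputable def lossFactor (γ σ δ : ℝ) : ℝ := γ⁻¹ * δ ^ (-σ)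

namespace System.Extension

variable {n : ℕ} {S : System n} {D : Set (Fin (2 * n) → ℂ)}

/-- The hypotheses of one quasi-Newton step, in terms of one constant `Q` that dominates all
constants in the step and a bound `ε` for the error. The summand `1` in `jac_le` leaves room for the
tangent vectors of the new torus; the exponent in `small` exceeds those of `Q` in all estimates. -/
structure StepData (E : S.Extension D) (σ γ : ℝ) (ω : Fin n → ℝ) (ρ δ Q ε : ℝ)
    (K : (Fin n → ℂ) → (Fin (2 * n) → ℂ)) : Prop where
  domain : S.Domain D
  torus : S.TorusIn D ρ K
  bounds : E.NormBounds Q Q Q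
  one_le_σ : 1 ≤ σ
  γ_pos : 0 < γ
  γ_le : γ ≤ 1
  dioph : IsDiophantine γ σ ω
  δ_pos : 0 < δ
  δ_lt : δ < 1
  width : 3 * δ < ρ
  two_le : 2 ≤ Q
  dim_le : ((2 * n : ℕ) : ℝ) ≤ Q
  ruessmann_le : ruessmannConst n σ ≤ Q
  gram : ∀ θ ∈ strip n ρ, IsUnit ((jac K θ)ᵀ * jac K θ).det
  avg : IsUnit (matAverage (E.S0 K)).det
  jac_le : ∀ θ ∈ strip n ρ, ‖jac K θ‖ + 1 ≤ Q
  invGram_le : ∀ θ ∈ strip n ρ, ‖invGram K θ‖ ≤ Q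
  err_le : ∀ θ ∈ strip n ρ, ‖E.err ω K θ‖ ≤ ε
  invAvg_le : ‖(matAverage (E.S0 K))⁻¹‖ ≤ Q ^ 2
  small : Q ^ 150 * (lossFactor γ σ δ ^ 2 * ε / δ) ≤ 1 / 2

namespace StepData

variable {E : S.Extension D} {σ γ : ℝ} {ω : Fin n → ℝ} {ρ δ Q ε : ℝ}
  {K : (Fin n → ℂ) → (Fin (2 * n) → ℂ)} (h : E.StepData σ γ ω ρ δ Q ε K)
include h

theorem ε_nonneg : 0 ≤ ε :=
  (norm_nonneg _).trans (h.err_le _ (toC_mem_strip h.torus.pos 0))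

theorem one_le_Q : 1 ≤ Q := by linarith [h.two_le]

theorem n_le : (n : ℝ) ≤ Q := by
  have := h.dim_le
  push_cast at this
  linarith [(n.cast_nonneg : (0 : ℝ) ≤ n)]

/-- As `γ ≤ 1`, `δ < 1` and `σ ≥ 1`, a derivative costs at most one loss factor. -/
theorem inv_δ_le : 1 / δ ≤ lossFactor γ σ δ := by
  have h1 : 1 ≤ γ⁻¹ := (one_le_inv₀ h.γ_pos).2 h.γ_le
  have h2 : 1 / δ ≤ δ ^ (-σ) := by
    rw [one_div, ← Real.rpow_neg_one]
    exact Real.rpow_le_rpow_of_exponent_ge h.δ_pos h.δ_lt.le (by linarith [h.one_le_σ])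
  have h3 : 0 ≤ δ ^ (-σ) := Real.rpow_nonneg h.δ_pos.le _
  unfold lossFactor
  nlinarith

theorem one_le_inv_δ : 1 ≤ 1 / δ := by
  rw [le_div_iff₀ h.δ_pos]; linarith [h.δ_lt]

theorem one_le_loss : 1 ≤ lossFactor γ σ δ := h.one_le_inv_δ.trans h.inv_δ_le

theorem pow_nonneg (k : ℕ) : 0 ≤ lossFactor γ σ δ ^ k := by
  have := h.one_le_loss
  positivity

theorem scale_nonneg (k : ℕ) : 0 ≤ lossFactor γ σ δ ^ k * ε :=
  mul_nonneg (h.pow_nonneg k) h.ε_nonneg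

theorem scale_mono {k l : ℕ} (hkl : k ≤ l) :
    lossFactor γ σ δ ^ k * ε ≤ lossFactor γ σ δ ^ l * ε :=
  mul_le_mul_of_nonneg_right (pow_le_pow_right₀ h.one_le_loss hkl) h.ε_nonneg

theorem scale_div_le (k : ℕ) :
    lossFactor γ σ δ ^ k * ε / δ ≤ lossFactor γ σ δ ^ (k + 1) * ε := by
  have h1 := mul_le_mul_of_nonneg_left h.inv_δ_le (h.scale_nonneg k)
  calc lossFactor γ σ δ ^ k * ε / δ = lossFactor γ σ δ ^ k * ε * (1 / δ) := by ring
    _ ≤ _ := h1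
    _ = _ := by ring

theorem bound_jac {θ : Fin n → ℂ} (hθ : θ ∈ strip n ρ) : PowBound Q 1 1 (jac K θ) := by
  have := h.jac_le θ hθ
  rw [PowBound]; linarith

theorem bound_invGram {θ : Fin n → ℂ} (hθ : θ ∈ strip n ρ) : PowBound Q 1 1 (invGram K θ) := by
  simpa [PowBound] using h.invGram_le θ hθ

theorem bound_B {θ : Fin n → ℂ} (hθ : θ ∈ strip n ρ) : PowBound Q 1 1 (E.B (K θ)) :=
  h.bounds.B_le (h.torus.mapsTo θ hθ)

theorem bound_Binv {θ : Fin n → ℂ} (hθ : θ ∈ strip n ρ) : PowBound Q 1 1 (E.B (K θ))⁻¹ :=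
  h.bounds.inv_le (h.torus.mapsTo θ hθ)

theorem bound_err {θ : Fin n → ℂ} (hθ : θ ∈ strip n ρ) : PowBound Q 0 ε (E.err ω K θ) := by
  simpa [PowBound] using h.err_le θ hθ

theorem bound_transpose_jac {θ : Fin n → ℂ} (hθ : θ ∈ strip n ρ) :
    PowBound Q 2 1 (jac K θ)ᵀ := (h.bound_jac hθ).transpose (by simpa using h.dim_le)

theorem bound_pY {θ : Fin n → ℂ} (hθ : θ ∈ strip n ρ) : PowBound Q 3 ε (E.pY ω K θ) := by
  have h1 := (((h.bound_transpose_jac hθ).mul h.two_le zero_le_one (h.bound_Binv hθ)).mulVec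
    h.two_le (by norm_num) (h.bound_err hθ)).neg
  simp only [mul_one, one_mul] at h1
  exact h1

theorem bound_pX {θ : Fin n → ℂ} (hθ : θ ∈ strip n ρ) : PowBound Q 11 ε (E.pX ω K θ) := by
  have hQ := h.two_le
  have h01 : (0 : ℝ) ≤ 1 := zero_le_one
  have h1 := ((((h.bound_B hθ).mul hQ h01 (h.bound_jac hθ)).mul hQ (by norm_num)
    (h.bound_invGram hθ)).mul hQ (by norm_num) (h.bound_transpose_jac hθ)).mul hQ (by norm_num)
    (h.bound_Binv hθ)
  simp only [mul_one] at h1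
  have h2 := h1.sub hQ h01 powBound_one
  have h3 := ((((h.bound_invGram hθ).transpose (by simpa using h.n_le)).mul hQ h01
    (h.bound_transpose_jac hθ)).mul hQ (by norm_num) h2).mulVec hQ (by norm_num) (h.bound_err hθ)
  simp only [mul_one, one_mul] at h3
  exact h3

theorem bound_A {θ : Fin n → ℂ} (hθ : θ ∈ strip n ρ) : PowBound Q 7 1 (E.linA K θ) :=
  (h.bounds.close_A h.domain.isOpen h.two_le h.dim_le (convex_singleton (K θ))
    (by simpa using h.torus.mapsTo θ hθ) rfl rfl (τ := 0) (by simp)).left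

theorem bound_grad {θ : Fin n → ℂ} (hθ : θ ∈ strip n ρ) : PowBound Q 1 1 (E.grad (K θ)) :=
  (h.bounds.close_grad h.domain.isOpen h.two_le (convex_singleton (K θ))
    (by simpa using h.torus.mapsTo θ hθ) rfl rfl (τ := 0) (by simp)).left

theorem bound_dirB {θ : Fin n → ℂ} (hθ : θ ∈ strip n ρ) {v : Fin (2 * n) → ℂ} {k : ℕ} {x : ℝ}
    (hx : 0 ≤ x) (hv : PowBound Q k x v) : PowBound Q (k + 2) x (E.dirB (K θ) v) := by
  refine (PowBound.of_entries h.two_le hx (by simpa using h.dim_le) fun i j => ?_ :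
    PowBound Q (k + 1 + 1) x (E.dirB (K θ) v))
  have h1 := (h.bounds.smooth_B h.domain.isOpen i j).norm_fderiv_le (h.torus.mapsTo θ hθ)
  exact (ContinuousLinearMap.le_of_opNorm_le_of_le _ h1 hv).trans_eq (by ring)

theorem bound_core {θ : Fin n → ℂ} (hθ : θ ∈ strip n ρ) :
    PowBound Q 15 1 (torsionCore (E.linA K θ) (E.B (K θ))
      (E.dirB (K θ) (E.B (K θ) *ᵥ E.grad (K θ))) (jac K θ) (invGram K θ)) := by
  have hQ := h.two_le
  have h01 : (0 : ℝ) ≤ 1 := zero_le_one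
  have hA := h.bound_A hθ
  have hB := h.bound_B hθ
  have hAB := hA.mul hQ h01 hB
  have hBA := hB.mul hQ h01 hA
  have hX := hB.mulVec hQ h01 (h.bound_grad hθ)
  simp only [mul_one] at hAB hBA hX
  have h1 := (hAB.sub hQ h01 hBA).sub hQ h01 (h.bound_dirB hθ h01 hX)
  have h2 := (((hB.mul hQ h01 (h.bound_jac hθ)).mul hQ (by norm_num)
    (h.bound_invGram hθ)).mul hQ (by norm_num) (h.bound_transpose_jac hθ)).mul hQ (by norm_num)
    (hA.add hQ h01 (hA.transpose (by simpa using h.dim_le)))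
  simp only [mul_one] at h2
  exact (h1.add hQ h01 h2).mono hQ h01 (by norm_num) le_rfl

theorem bound_S0 {θ : Fin n → ℂ} (hθ : θ ∈ strip n ρ) : PowBound Q 20 1 (E.S0 K θ) := by
  have hQ := h.two_le
  have h01 : (0 : ℝ) ≤ 1 := zero_le_one
  have h1 := ((((h.bound_invGram hθ).mul hQ h01 (h.bound_transpose_jac hθ)).mul hQ (by norm_num)
    (h.bound_core hθ)).mul hQ (by norm_num) (h.bound_jac hθ)).mul hQ (by norm_num)
    (h.bound_invGram hθ)
  simp only [mul_one] at h1
  exact h1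

/-- The average of the right-hand side of the equation for `ξ_x`, with a constant `c` split off
from `ξ_y`. If `c` is the average of `ξ_y`, the condition that it vanishes determines `c`. -/
theorem matAverage_mulVec {ξ : (Fin n → ℂ) → (Fin n → ℂ)} (hξ : VecHol ρ ξ)
    (c : Fin n → ℂ) (i : Fin n) :
    average (fun θ => (E.S0 K θ *ᵥ ξ θ - E.pX ω K θ) i) =
      (matAverage (E.S0 K) *ᵥ c) i
        - average (fun θ => (E.pX ω K θ - E.S0 K θ *ᵥ (ξ θ - c)) i) := by
  have hS := matHol_S0 (E := E) h.domain h.torus h.gram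
  have hp := vecHol_pX h.domain h.torus h.bounds.invertible h.gram ω
  have hc : HolPeriodic ρ fun θ => (E.S0 K θ *ᵥ c) i := by
    simp only [Matrix.mulVec, dotProduct]
    exact HolPeriodic.sum fun j _ => (hS i j).hol.mul (holPeriodic_const (c j))
  have hSξ := hS.mulVec hξ i
  have hd : HolPeriodic ρ fun θ => (E.pX ω K θ - E.S0 K θ *ᵥ (ξ θ - c)) i := by
    simp only [Matrix.mulVec_sub, Pi.sub_apply]
    exact (hp i).hol.sub (hSξ.hol.sub hc)
  rw [← average_mulVec_const h.torus.pos hS c i, ← average_sub h.torus.pos hc hd]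
  congr 1
  ext θ
  simp only [Matrix.mulVec_sub, Pi.sub_apply]
  ring

section Solution

variable {ξx ξy : (Fin n → ℂ) → (Fin n → ℂ)} (hξx : VecHol ρ ξx) (hξy : VecHol ρ ξy)
  (hx : ∀ θ ∈ strip n ρ, dω ω ξx θ = E.S0 K θ *ᵥ ξy θ - E.pX ω K θ)
  (hy : ∀ θ ∈ strip n ρ, dω ω ξy θ = -E.pY ω K θ)

include hξx hξy hx hy in
/-- Rüssmann's estimate bounds the oscillation of `ξ_y`; its average is then bounded by means of
`⟨S⁰⟩⁻¹`, as the equation for `ξ_x` is solvable. -/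
theorem bound_ξy {θ : Fin n → ℂ} (hθ : θ ∈ strip n (ρ - δ)) :
    PowBound Q 28 (lossFactor γ σ δ ^ 1 * ε) (ξy θ) := by
  have hQ := h.two_le
  have hρ := h.torus.pos
  have hσ : 0 < σ := by linarith [h.one_le_σ]
  have h1 : 0 ≤ lossFactor γ σ δ ^ 1 * ε := h.scale_nonneg 1
  have hδρ : δ < ρ := by linarith [h.width, h.δ_pos]
  set c : Fin n → ℂ := fun j => average fun θ => ξy θ j with hc
  have hosc : ∀ θ ∈ strip n (ρ - δ), PowBound Q 4 (lossFactor γ σ δ ^ 1 * ε) (ξy θ - c) := by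
    intro θ hθ
    refine powBound_pi hQ h1 fun j => ?_
    have h2 := (hξy j).hol.norm_sub_average_le h.dioph h.γ_pos hσ
      (vecHol_pY h.domain h.torus h.bounds.invertible ω j).neg.hol
      (fun θ hθ => by rw [hξy.dω_apply ω hθ, hy θ hθ]; rfl)
      (M := Q ^ 3 * ε) (fun θ hθ => by
        rw [norm_neg]; exact (h.bound_pY hθ).apply j) h.δ_pos hδρ hθ
    refine h2.trans ?_
    have h3 : 0 ≤ lossFactor γ σ δ * (Q ^ 3 * ε) :=
      mul_nonneg (by simpa using h.pow_nonneg 1) (mul_nonneg (by positivity) h.ε_nonneg)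
    have h4 := mul_le_mul_of_nonneg_right h.ruessmann_le h3
    calc _ = ruessmannConst n σ * (lossFactor γ σ δ * (Q ^ 3 * ε)) := by rw [lossFactor]; ring
      _ ≤ _ := h4
      _ = _ := by ring
  have havg : ∀ i, (matAverage (E.S0 K) *ᵥ c) i =
      average (fun θ => (E.pX ω K θ - E.S0 K θ *ᵥ (ξy θ - c)) i) := fun i => by
    have h2 := h.matAverage_mulVec hξy c i
    have h3 : average (fun θ => (E.S0 K θ *ᵥ ξy θ - E.pX ω K θ) i) = 0 := by
      rw [← average_fderiv hρ (hξx i).hol ω]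
      refine MeasureTheory.integral_congr_ae (Eventually.of_forall fun t => ?_)
      have ht := toC_mem_strip hρ t
      simp only
      rw [hξx.dω_apply ω ht, hx _ ht]
    rw [h3] at h2
    exact (sub_eq_zero.1 h2.symm)
  have hMc : PowBound Q 25 (lossFactor γ σ δ ^ 1 * ε) (matAverage (E.S0 K) *ᵥ c) := by
    refine powBound_pi hQ h1 fun i => ?_
    rw [havg]
    refine norm_average_le fun t => ?_
    have ht := toC_mem_strip hρ t
    have ht' : toC t ∈ strip n (ρ - δ) := toC_mem_strip (by linarith) t
    have h4 := (h.bound_S0 ht).mulVec hQ zero_le_one (hosc _ ht')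
    rw [one_mul] at h4
    have h5 : PowBound Q 11 (lossFactor γ σ δ ^ 1 * ε) (E.pX ω K (toC t)) :=
      (h.bound_pX ht).mono hQ h.ε_nonneg le_rfl (by simpa using h.scale_mono (Nat.zero_le 1))
    exact (h5.sub hQ h1 h4).apply i
  have hcb : PowBound Q 27 (lossFactor γ σ δ ^ 1 * ε) c := by
    have h2 : c = (matAverage (E.S0 K))⁻¹ *ᵥ (matAverage (E.S0 K) *ᵥ c) := by
      rw [Matrix.mulVec_mulVec, Matrix.nonsing_inv_mul _ h.avg, Matrix.one_mulVec]
    have h3 : PowBound Q 2 1 (matAverage (E.S0 K))⁻¹ := by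
      simpa [PowBound] using h.invAvg_le
    have h4 := h3.mulVec hQ zero_le_one hMc
    rw [one_mul, ← h2] at h4
    exact h4
  have := (hosc θ hθ).add hQ h1 hcb
  rwa [sub_add_cancel] at this

variable (hx0 : ∀ j, average (fun θ => ξx θ j) = 0)

include hξx hξy hx hy hx0 in
theorem bound_ξx {θ : Fin n → ℂ} (hθ : θ ∈ strip n (ρ - 2 * δ)) :
    PowBound Q 50 (lossFactor γ σ δ ^ 2 * ε) (ξx θ) := by
  have hQ := h.two_le
  have hσ : 0 < σ := by linarith [h.one_le_σ]
  have h1 : 0 ≤ lossFactor γ σ δ ^ 1 * ε := h.scale_nonneg 1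
  have hsub : strip n (ρ - δ) ⊆ strip n ρ := strip_mono (by linarith [h.δ_pos])
  have hf : VecHol ρ fun θ => E.S0 K θ *ᵥ ξy θ - E.pX ω K θ :=
    ((matHol_S0 h.domain h.torus h.gram).mulVec hξy).sub
      (vecHol_pX h.domain h.torus h.bounds.invertible h.gram ω)
  have hM : ∀ θ ∈ strip n (ρ - δ), PowBound Q 49 (lossFactor γ σ δ ^ 1 * ε)
      (E.S0 K θ *ᵥ ξy θ - E.pX ω K θ) := fun θ hθ => by
    have h4 := (h.bound_S0 (hsub hθ)).mulVec hQ zero_le_one (h.bound_ξy hξx hξy hx hy hθ)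
    rw [one_mul] at h4
    have h5 : PowBound Q 11 (lossFactor γ σ δ ^ 1 * ε) (E.pX ω K θ) :=
      (h.bound_pX (hsub hθ)).mono hQ h.ε_nonneg le_rfl
        (by simpa using h.scale_mono (Nat.zero_le 1))
    exact h4.sub hQ h1 h5
  refine powBound_pi hQ (h.scale_nonneg 2) fun j => ?_
  have hmono : ρ - δ ≤ ρ := by linarith [h.δ_pos]
  have h2 := ((hξx j).hol.mono hmono).norm_sub_average_le h.dioph h.γ_pos hσ
    ((hf j).hol.mono hmono) (fun θ hθ => by rw [hξx.dω_apply ω (hsub hθ), hx θ (hsub hθ)])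
    (M := Q ^ 49 * (lossFactor γ σ δ ^ 1 * ε)) (fun θ hθ => (hM θ hθ).apply j) h.δ_pos
    (by linarith [h.width, h.δ_pos]) (θ := θ) (by convert hθ using 2; ring)
  rw [hx0, sub_zero] at h2
  refine h2.trans ?_
  have h3 : 0 ≤ lossFactor γ σ δ * (Q ^ 49 * (lossFactor γ σ δ ^ 1 * ε)) :=
    mul_nonneg (by simpa using h.pow_nonneg 1) (mul_nonneg (by positivity) h1)
  have h4 := mul_le_mul_of_nonneg_right h.ruessmann_le h3
  calc _ = ruessmannConst n σ * (lossFactor γ σ δ * (Q ^ 49 * (lossFactor γ σ δ ^ 1 * ε))) := by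
        rw [lossFactor]; ring
    _ ≤ _ := h4
    _ = _ := by ring

end Solution

end StepData

end System.Extension

end QuasiNewton

namespace QuasiNewton

open Matrix Filter Topology

/-! ### Estimates for the new torus -/

namespace System.Extension

variable {n : ℕ} {S : System n} {D : Set (Fin (2 * n) → ℂ)}

/-- `ξ_x`, `ξ_y` solve the reduced equations on `U_ρ`, and `Δ` is the correction that they
define. -/
structure IsReducedSolution (E : S.Extension D) (ω : Fin n → ℝ) (ρ : ℝ)
    (K Δ : (Fin n → ℂ) → (Fin (2 * n) → ℂ)) (ξx ξy : (Fin n → ℂ) → (Fin n → ℂ)) : Prop where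
  vecHol_x : VecHol ρ ξx
  vecHol_y : VecHol ρ ξy
  eq_x : ∀ θ ∈ strip n ρ, dω ω ξx θ = E.S0 K θ *ᵥ ξy θ - E.pX ω K θ
  eq_y : ∀ θ ∈ strip n ρ, dω ω ξy θ = -E.pY ω K θ
  average_x : ∀ j, average (fun θ => ξx θ j) = 0
  eq_Δ : ∀ θ ∈ strip n ρ,
    Δ θ = jac K θ *ᵥ ξx θ + (E.B (K θ) * jac K θ * invGram K θ) *ᵥ ξy θ

theorem IsCorrection.exists_isReducedSolution {E : S.Extension D} {ω : Fin n → ℝ} {ρ : ℝ}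
    {K Δ : (Fin n → ℂ) → (Fin (2 * n) → ℂ)} (h : E.IsCorrection ω ρ K Δ) :
    ∃ ξx ξy, E.IsReducedSolution ω ρ K Δ ξx ξy := by
  obtain ⟨ξx, ξy, h1, h2, h3, h4, h5, h6⟩ := h
  exact ⟨ξx, ξy, h1.vecHol, h2.vecHol, h3, h4, h5, h6⟩

namespace StepData

variable {E : S.Extension D} {σ γ : ℝ} {ω : Fin n → ℝ} {ρ δ Q ε : ℝ}
  {K Δ : (Fin n → ℂ) → (Fin (2 * n) → ℂ)} {ξx ξy : (Fin n → ℂ) → (Fin n → ℂ)}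
  (h : E.StepData σ γ ω ρ δ Q ε K)
include h

theorem scale_mul_le {i j : ℕ} (hij : i + j ≤ 4) :
    lossFactor γ σ δ ^ i * ε * (lossFactor γ σ δ ^ j * ε) ≤ lossFactor γ σ δ ^ 4 * ε ^ 2 := by
  have h1 := pow_le_pow_right₀ h.one_le_loss hij
  have h2 : 0 ≤ ε ^ 2 := by positivity
  calc _ = lossFactor γ σ δ ^ (i + j) * ε ^ 2 := by rw [pow_add]; ring
    _ ≤ _ := mul_le_mul_of_nonneg_right h1 h2

theorem scale_le_div (k : ℕ) : lossFactor γ σ δ ^ k * ε ≤ lossFactor γ σ δ ^ k * ε / δ := by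
  have h1 := mul_le_mul_of_nonneg_left h.one_le_inv_δ (h.scale_nonneg k)
  rwa [mul_one, mul_one_div] at h1

theorem small_pow {k : ℕ} (hk : k ≤ 150) :
    Q ^ k * (lossFactor γ σ δ ^ 2 * ε / δ) ≤ 1 / 2 := by
  refine le_trans ?_ h.small
  exact mul_le_mul_of_nonneg_right (pow_le_pow_right₀ h.one_le_Q hk)
    (div_nonneg (h.scale_nonneg 2) h.δ_pos.le)

theorem strip_one {θ : Fin n → ℂ} (hθ : θ ∈ strip n (ρ - 2 * δ)) : θ ∈ strip n (ρ - δ) :=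
  strip_mono (by linarith [h.δ_pos]) hθ

theorem strip_two {θ : Fin n → ℂ} (hθ : θ ∈ strip n (ρ - 3 * δ)) : θ ∈ strip n (ρ - 2 * δ) :=
  strip_mono (by linarith [h.δ_pos]) hθ

theorem strip_zero {θ : Fin n → ℂ} (hθ : θ ∈ strip n (ρ - 2 * δ)) : θ ∈ strip n ρ :=
  strip_mono (by linarith [h.δ_pos]) hθ

theorem bound_jac_err {θ : Fin n → ℂ} (hθ : θ ∈ strip n (ρ - δ)) :
    PowBound Q 1 (lossFactor γ σ δ ^ 1 * ε) (jac (E.err ω K) θ) := by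
  have h1 := powBound_jac_of_strip h.two_le h.n_le h.δ_pos h.ε_nonneg
    (vecHol_err h.domain h.torus ω).differentiableOn (fun θ hθ => h.bound_err hθ) hθ
  refine h1.mono h.two_le (div_nonneg h.ε_nonneg h.δ_pos.le) le_rfl ?_
  simpa using h.scale_div_le 0

section Correction

variable (hs : E.IsReducedSolution ω ρ K Δ ξx ξy)
include hs

theorem vecHol_Δ : VecHol ρ Δ := by
  intro i
  have := ((h.torus.matHol_jac.mulVec hs.vecHol_x).add
    ((((matHol_B (E := E) h.domain h.torus).mul h.torus.matHol_jac).mul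
      (matHol_invGram h.torus h.gram)).mulVec hs.vecHol_y)) i
  exact this.congr h.torus.pos fun θ hθ => congrFun (hs.eq_Δ θ hθ) i

theorem bound_Δ {θ : Fin n → ℂ} (hθ : θ ∈ strip n (ρ - 2 * δ)) :
    PowBound Q 52 (lossFactor γ σ δ ^ 2 * ε) (Δ θ) := by
  have hQ := h.two_le
  have hθ0 := h.strip_zero hθ
  have h1 := (h.bound_jac hθ0).mulVec hQ zero_le_one
    (h.bound_ξx hs.vecHol_x hs.vecHol_y hs.eq_x hs.eq_y hs.average_x hθ)
  have h2 := (((h.bound_B hθ0).mul hQ zero_le_one (h.bound_jac hθ0)).mul hQ (by norm_num)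
    (h.bound_invGram hθ0)).mulVec hQ (by norm_num)
    (h.bound_ξy hs.vecHol_x hs.vecHol_y hs.eq_x hs.eq_y (h.strip_one hθ))
  simp only [one_mul, mul_one] at h1 h2
  rw [hs.eq_Δ θ hθ0]
  exact h1.add hQ (h.scale_nonneg 2)
    (h2.mono hQ (h.scale_nonneg 1) (by norm_num : _ ≤ 51) (h.scale_mono (by norm_num)))

theorem bound_jac_Δ {θ : Fin n → ℂ} (hθ : θ ∈ strip n (ρ - 3 * δ)) :
    PowBound Q 53 (lossFactor γ σ δ ^ 2 * ε / δ) (jac Δ θ) :=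
  powBound_jac_of_strip h.two_le h.n_le h.δ_pos (h.scale_nonneg 2)
    ((h.vecHol_Δ hs).differentiableOn.mono (strip_mono (by linarith [h.δ_pos])))
    (fun θ hθ => h.bound_Δ hs hθ) (by convert hθ using 2; ring)

/-- The torus is isotropic up to an error of first order. -/
theorem bound_lagrange {θ : Fin n → ℂ} (hθ : θ ∈ strip n (ρ - 2 * δ)) :
    PowBound Q 30 (lossFactor γ σ δ ^ 2 * ε) (E.lagrange K θ) := by
  have hQ := h.two_le
  refine .of_entries hQ (h.scale_nonneg 2) (by simpa using h.n_le) fun i j => ?_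
  -- the pulled-back two-form is the exterior derivative of `ξ_y`, which is small
  rw [lagrange_eq_of_dω h.domain h.torus h.bounds.invertible h.dioph h.γ_pos
    (fun j => (hs.vecHol_y j).hol)
    (fun j θ hθ => by rw [hs.vecHol_y.dω_apply ω hθ, hs.eq_y θ hθ]; rfl) (h.strip_zero hθ)]
  have h1 : ∀ i j, PowBound Q 28 (lossFactor γ σ δ ^ 2 * ε)
      (fderiv ℂ (fun θ => ξy θ j) θ (Pi.single i 1)) := fun i j => by
    have h2 := norm_fderiv_le_of_strip h.δ_pos (f := fun θ => ξy θ j)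
      ((hs.vecHol_y j).hol.diff.mono (strip_mono (by linarith [h.δ_pos] : ρ - δ ≤ ρ)))
      (fun θ hθ => (h.bound_ξy hs.vecHol_x hs.vecHol_y hs.eq_x hs.eq_y hθ).apply j)
      (θ := θ) (by convert hθ using 2; ring)
    refine ((fderiv ℂ (fun θ => ξy θ j) θ).le_opNorm_of_le (norm_single_one_le i)).trans ?_
    rw [mul_one]
    refine h2.trans ?_
    rw [mul_div_assoc]
    exact mul_le_mul_of_nonneg_left (h.scale_div_le 1) (by have := h.one_le_Q; positivity)
  exact (h1 i j).sub hQ (h.scale_nonneg 2) (h1 j i)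

theorem bound_defect {θ : Fin n → ℂ} (hθ : θ ∈ strip n (ρ - 2 * δ)) :
    PowBound Q 49 (lossFactor γ σ δ ^ 2 * ε)
      (frameDefect (jac K θ) (E.B (K θ)) (E.B (K θ))⁻¹ (invGram K θ)) := by
  have hθ0 := h.strip_zero hθ
  have hQ0 : 0 ≤ Q := by linarith [h.two_le]
  have h1 := norm_frameDefect_le h.two_le h.dim_le
    (nonsing_inv_mul _ (h.bounds.invertible _ (h.torus.mapsTo θ hθ0)))
    (mul_nonsing_inv _ (h.gram θ hθ0)) (nonsing_inv_mul _ (h.gram θ hθ0)) (h.bound_jac hθ0)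
    (h.bound_invGram hθ0) (h.bound_B hθ0) (h.bound_Binv hθ0) (h.bound_lagrange hs hθ) (by
      have h2 := h.small_pow (k := 36) (by norm_num)
      refine le_trans ?_ h2
      rw [← mul_assoc, ← pow_add]
      exact mul_le_mul_of_nonneg_left (h.scale_le_div 2) (by positivity))
  refine h1.trans_eq ?_
  ring

/-- The correction solves the linearized equation up to an error of second order. -/
theorem bound_residual {θ : Fin n → ℂ} (hθ : θ ∈ strip n (ρ - 2 * δ)) :
    PowBound Q 97 (lossFactor γ σ δ ^ 4 * ε ^ 2)
      (E.err ω K θ + E.linA K θ *ᵥ Δ θ - dω ω Δ θ) := by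
  have hQ := h.two_le
  have h01 : (0 : ℝ) ≤ 1 := zero_le_one
  have hθ0 := h.strip_zero hθ
  have s1 := h.scale_nonneg 1
  have s2 := h.scale_nonneg 2
  have hX := h.bound_jac hθ0
  have hN := h.bound_invGram hθ0
  have hB := h.bound_B hθ0
  have hXt := h.bound_transpose_jac hθ0
  have hF := h.bound_jac_err (h.strip_one hθ)
  have hT := h.bound_defect hs hθ
  have hξy := h.bound_ξy hs.vecHol_x hs.vecHol_y hs.eq_x hs.eq_y (h.strip_one hθ)
  rw [residual_eq h.domain h.torus hθ0 h.bounds.invertible h.gram hs.vecHol_x hs.vecHol_y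
    (hs.eq_x θ hθ0) (hs.eq_y θ hθ0) hs.eq_Δ rfl rfl rfl]
  have h4 : (0 : ℝ) ≤ lossFactor γ σ δ ^ 4 * ε ^ 2 := mul_nonneg (h.pow_nonneg 4) (sq_nonneg ε)
  have e1 := (hF.mulVec hQ s1 (h.bound_ξx hs.vecHol_x hs.vecHol_y hs.eq_x hs.eq_y hs.average_x
    hθ)).mono hQ (mul_nonneg s1 s2) (by norm_num : _ ≤ 95) (h.scale_mul_le (by norm_num))
  have hZ := hT.mul hQ s2 (((h.bound_core hθ0).mul hQ h01 hX).mul hQ (by norm_num) hN)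
  have hR1 := ((h.bound_dirB hθ0 h.ε_nonneg (h.bound_err hθ0)).mul hQ h.ε_nonneg hX).mul hQ
    (by simpa using h.ε_nonneg) hN
  have hR2 := (hB.mul hQ h01 hF).mul hQ (by simpa using s1) hN
  have hR3a := ((hF.transpose (by simpa using h.dim_le)).mul hQ s1 hX)
  have hR3b := hXt.mul hQ h01 hF
  simp only [one_mul, mul_one] at hZ hR1 hR2 hR3a hR3b
  have hR3 := (hB.mul hQ h01 hX).mul hQ (by norm_num)
    ((hN.mul hQ h01 (hR3a.add hQ s1 hR3b)).mul hQ (by simpa using s1) hN)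
  simp only [one_mul, mul_one] at hR3
  have hR := ((hR1.mono hQ h.ε_nonneg le_rfl (by simpa using h.scale_mono (Nat.zero_le 1))).add
    hQ s1 hR2).sub hQ s1 hR3
  have e2 := ((hZ.add hQ s2 (hR.mono hQ s1 (by norm_num : _ ≤ 66) (h.scale_mono
    (by norm_num)))).mulVec hQ s2 hξy).mono hQ (mul_nonneg s2 s1) (by norm_num : _ ≤ 95)
    (h.scale_mul_le (by norm_num))
  have e3 := (hT.mulVec hQ s2 (h.bound_err hθ0)).mono hQ (mul_nonneg s2 h.ε_nonneg)
    (by norm_num : _ ≤ 96) (by simpa using h.scale_mul_le (i := 2) (j := 0) (by norm_num))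
  exact (e1.add hQ h4 e2).add hQ h4 e3

variable {K' : (Fin n → ℂ) → (Fin (2 * n) → ℂ)}
  (hK' : ∀ θ ∈ strip n (ρ - 3 * δ), K' θ = K θ + Δ θ)
  (hconv : ∀ θ ∈ strip n (ρ - 3 * δ), ∃ s, Convex ℝ s ∧ s ⊆ D ∧ K θ ∈ s ∧ K' θ ∈ s)
include hK'

theorem hasFDerivAt_new {θ : Fin n → ℂ} (hθ : θ ∈ strip n (ρ - 3 * δ)) :
    HasFDerivAt K' (fderiv ℂ K θ + fderiv ℂ Δ θ) θ := by
  have hθ0 := h.strip_zero (h.strip_two hθ)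
  have hd : DifferentiableAt ℂ Δ θ := (h.vecHol_Δ hs).differentiableOn.differentiableAt
    ((isOpen_strip n ρ).mem_nhds hθ0)
  refine ((h.torus.differentiableAt hθ0).hasFDerivAt.add hd.hasFDerivAt).congr_of_eventuallyEq ?_
  filter_upwards [(isOpen_strip n _).mem_nhds hθ] with x hx using hK' x hx

theorem jac_new {θ : Fin n → ℂ} (hθ : θ ∈ strip n (ρ - 3 * δ)) :
    jac K' θ = jac K θ + jac Δ θ := by
  ext i j
  simp only [jac, Matrix.of_apply, Matrix.add_apply, (h.hasFDerivAt_new hs hK' hθ).fderiv]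
  rfl

/-- The distance between the old and the new torus, in the `C¹` norm. -/
theorem close_jac {θ : Fin n → ℂ} (hθ : θ ∈ strip n (ρ - 3 * δ)) :
    PowClose Q (Q ^ 53 * (lossFactor γ σ δ ^ 2 * ε / δ)) 1 (jac K θ) (jac K' θ) := by
  have hQ := h.two_le
  have hθ0 := h.strip_zero (h.strip_two hθ)
  have h1 := h.bound_jac_Δ hs hθ
  have h2 := h.jac_new hs hK' hθ
  have h3 := h.small_pow (k := 53) (by norm_num)
  have h4 := h.jac_le θ hθ0
  have h5 : 0 ≤ Q ^ 53 * (lossFactor γ σ δ ^ 2 * ε / δ) := (norm_nonneg _).trans h1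
  refine ⟨h.bound_jac hθ0, ?_, ?_⟩
  · rw [h2, PowBound]
    unfold PowBound at h1
    have := norm_add_le (jac K θ) (jac Δ θ)
    linarith
  · rw [h2, add_sub_cancel_left, PowBound, pow_one]
    refine h1.trans (le_mul_of_one_le_left h5 h.one_le_Q)

/-- The Gram matrix of the new torus is a small perturbation of the old one. -/
theorem invGram_new {θ : Fin n → ℂ} (hθ : θ ∈ strip n (ρ - 3 * δ)) :
    IsUnit ((jac K' θ)ᵀ * jac K' θ).det ∧
      PowClose Q (Q ^ 53 * (lossFactor γ σ δ ^ 2 * ε / δ)) 7 (invGram K θ) (invGram K' θ) := by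
  have hQ := h.two_le
  have hθ0 := h.strip_zero (h.strip_two hθ)
  have hX := h.close_jac hs hK' hθ
  have hτ : 0 ≤ Q ^ 53 * (lossFactor γ σ δ ^ 2 * ε / δ) :=
    (norm_nonneg _).trans (h.bound_jac_Δ hs hθ)
  have hM := ((hX.transpose (by simpa using h.dim_le)).mul hQ hτ hX).diff
  have hN := h.invGram_le θ hθ0
  have h0 : 0 ≤ ‖(jac K' θ)ᵀ * jac K' θ - (jac K θ)ᵀ * jac K θ‖ := norm_nonneg _
  have hQ0 : 0 ≤ Q := by linarith
  obtain ⟨h1, h2, h3⟩ := inv_perturbation (h.gram θ hθ0) (M' := (jac K' θ)ᵀ * jac K' θ) (by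
    refine (mul_le_mul hN hM h0 hQ0).trans ?_
    refine le_trans (le_of_eq ?_) (h.small_pow (k := 58) (by norm_num))
    ring)
  refine ⟨h1, (h.bound_invGram hθ0).mono hQ zero_le_one (by norm_num) le_rfl, ?_, ?_⟩
  · have : PowBound Q 2 1 (invGram K' θ) := by
      rw [PowBound]
      refine h2.trans ?_
      have : ‖((jac K θ)ᵀ * jac K θ)⁻¹‖ ≤ Q := hN
      nlinarith
    exact this.mono hQ zero_le_one (by norm_num) le_rfl
  · refine h3.trans ?_
    have hN' : ‖((jac K θ)ᵀ * jac K θ)⁻¹‖ ≤ Q := hN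
    calc 2 * ‖((jac K θ)ᵀ * jac K θ)⁻¹‖ ^ 2 * ‖(jac K' θ)ᵀ * jac K' θ - (jac K θ)ᵀ * jac K θ‖
        ≤ Q * Q ^ 2 * (Q ^ 4 * (Q ^ 53 * (lossFactor γ σ δ ^ 2 * ε / δ))) := by
          gcongr
          exact hM
      _ = _ := by ring

include hconv

/-- The new error is quadratic in the old one. -/
theorem bound_err_new {θ : Fin n → ℂ} (hθ : θ ∈ strip n (ρ - 3 * δ)) :
    PowBound Q 110 (lossFactor γ σ δ ^ 4 * ε ^ 2) (E.err ω K' θ) := by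
  have hQ := h.two_le
  have h01 : (0 : ℝ) ≤ 1 := zero_le_one
  have hθ2 := h.strip_two hθ
  have hθ0 := h.strip_zero hθ2
  obtain ⟨s, hsc, hsD, hz, hz'⟩ := hconv θ hθ
  have hsub : K' θ - K θ = Δ θ := by rw [hK' θ hθ, add_sub_cancel_left]
  set z := K θ with hzdef
  set z' := K' θ with hz'def
  have hO := h.domain.isOpen
  have hΔ0 : 0 ≤ ‖Δ θ‖ := norm_nonneg _
  have hg := h.bounds.close_grad hO hQ hsc hsD hz hz' (le_refl ‖z' - z‖)
  have tB := h.bounds.taylor_B hO hQ h.dim_le hsc hsD hz hz'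
  have tg := h.bounds.taylor_grad hO hQ hsc hsD hz hz'
  have hd : PowBound Q 2 ‖Δ θ‖ (E.dirB z (Δ θ)) :=
    h.bound_dirB hθ0 hΔ0 (by simp [PowBound] : PowBound Q 0 ‖Δ θ‖ (Δ θ))
  rw [hsub] at hg tB tg
  have q1 := tB.mulVec hQ (by positivity) hg.right
  have q2 := hd.mulVec hQ hΔ0 hg.diff
  have q3 := (h.bound_B hθ0).mulVec hQ h01 tg
  rw [mul_one] at q1
  rw [← sq] at q2
  rw [one_mul] at q3
  have hq := (q1.add hQ (by positivity) q2).add hQ (by positivity) q3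
  have hΔb : ‖Δ θ‖ ^ 2 ≤ (Q ^ 52 * (lossFactor γ σ δ ^ 2 * ε)) ^ 2 :=
    pow_le_pow_left₀ hΔ0 (h.bound_Δ hs hθ2) 2
  have h4 : (0 : ℝ) ≤ lossFactor γ σ δ ^ 4 * ε ^ 2 := mul_nonneg (h.pow_nonneg 4) (sq_nonneg ε)
  have hq' : PowBound Q 109 (lossFactor γ σ δ ^ 4 * ε ^ 2) ((E.B z' - E.B z - E.dirB z (Δ θ)) *ᵥ
      E.grad z' + E.dirB z (Δ θ) *ᵥ (E.grad z' - E.grad z)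
      + E.B z *ᵥ (E.grad z' - E.grad z - E.Psi z *ᵥ Δ θ)) := by
    refine le_trans hq ?_
    have : 0 ≤ Q ^ 5 := by positivity
    calc Q ^ (max (max (2 + 1) (2 + 1) + 1) (1 + 1) + 1) * ‖Δ θ‖ ^ 2 = Q ^ 5 * ‖Δ θ‖ ^ 2 := by
          norm_num
      _ ≤ Q ^ 5 * (Q ^ 52 * (lossFactor γ σ δ ^ 2 * ε)) ^ 2 := mul_le_mul_of_nonneg_left hΔb this
      _ = _ := by ring
  -- the new error is the residual of the linearized equation plus a Taylor remainder
  have he : E.err ω K' θ = (E.err ω K θ + E.linA K θ *ᵥ Δ θ - dω ω Δ θ) +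
      ((E.B z' - E.B z - E.dirB z (Δ θ)) *ᵥ E.grad z' + E.dirB z (Δ θ) *ᵥ (E.grad z' - E.grad z)
        + E.B z *ᵥ (E.grad z' - E.grad z - E.Psi z *ᵥ Δ θ)) := by
    simp only [err, dω, linA, (h.hasFDerivAt_new hs hK' hθ).fderiv, _root_.add_apply]
    rw [← hzdef, ← hz'def, Matrix.add_mulVec, E.Phi_mulVec, ← Matrix.mulVec_mulVec]
    simp only [Matrix.sub_mulVec, Matrix.mulVec_sub]
    abel
  rw [he]
  exact ((h.bound_residual hs hθ2).add hQ h4 hq').mono hQ h4 (by norm_num) le_rfl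

theorem close_S0 {θ : Fin n → ℂ} (hθ : θ ∈ strip n (ρ - 3 * δ)) :
    PowClose Q (Q ^ 53 * (lossFactor γ σ δ ^ 2 * ε / δ)) 50 (E.S0 K θ) (E.S0 K' θ) := by
  have hQ := h.two_le
  have hθ2 := h.strip_two hθ
  have hθ0 := h.strip_zero hθ2
  obtain ⟨s, hsc, hsD, hz, hz'⟩ := hconv θ hθ
  have hτ : 0 ≤ Q ^ 53 * (lossFactor γ σ δ ^ 2 * ε / δ) :=
    (norm_nonneg _).trans (h.bound_jac_Δ hs hθ)
  have hΔ : ‖K' θ - K θ‖ ≤ Q ^ 53 * (lossFactor γ σ δ ^ 2 * ε / δ) := by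
    rw [hK' θ hθ, add_sub_cancel_left]
    exact (h.bound_Δ hs hθ2).mono hQ (h.scale_nonneg 2) (by norm_num) (h.scale_le_div 2)
  have hX := h.close_jac hs hK' hθ
  have hXt := hX.transpose (by simpa using h.dim_le)
  have hN := (h.invGram_new hs hK' hθ).2
  have hO := h.domain.isOpen
  have hB := h.bounds.close_B hO hQ h.dim_le hsc hsD hz hz' hΔ
  have hA := h.bounds.close_A hO hQ h.dim_le hsc hsD hz hz' hΔ
  have hg := h.bounds.close_grad hO hQ hsc hsD hz hz' hΔ
  have hd := h.bounds.close_dirB hO hQ h.dim_le hsc hsD hz hz' hΔ (hB.mulVec hQ hτ hg)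
  have h1 := ((hA.mul hQ hτ hB).sub hQ hτ (hB.mul hQ hτ hA)).sub hQ hτ hd
  have h2 := (((hB.mul hQ hτ hX).mul hQ hτ hN).mul hQ hτ hXt).mul hQ hτ
    (hA.add hQ hτ (hA.transpose (by simpa using h.dim_le)))
  have h3 := ((((hN.mul hQ hτ hXt).mul hQ hτ (h1.add hQ hτ h2)).mul hQ hτ hX).mul hQ hτ hN)
  exact h3.mono hQ hτ (by norm_num)

/-- The average `⟨S⁰⟩` of the new torus is a small perturbation of the old one. -/
theorem matAverage_new (hK'T : S.TorusIn D (ρ - 3 * δ) K') :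
    IsUnit (matAverage (E.S0 K')).det ∧
      PowBound Q 109 (lossFactor γ σ δ ^ 2 * ε / δ)
        ((matAverage (E.S0 K'))⁻¹ - (matAverage (E.S0 K))⁻¹) := by
  have hQ := h.two_le
  have hQ0 : 0 ≤ Q := by linarith
  have hρ := hK'T.pos
  have hx : 0 ≤ lossFactor γ σ δ ^ 2 * ε / δ := div_nonneg (h.scale_nonneg 2) h.δ_pos.le
  have hτ : 0 ≤ Q ^ 53 * (lossFactor γ σ δ ^ 2 * ε / δ) := by positivity
  have hM : PowBound Q 51 (Q ^ 53 * (lossFactor γ σ δ ^ 2 * ε / δ))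
      (matAverage (E.S0 K') - matAverage (E.S0 K)) := by
    refine .of_entries hQ hτ (by simpa using h.n_le) fun i j => ?_
    have h1 := average_sub hρ
      ((matHol_S0 (E := E) h.domain hK'T fun θ hθ => (h.invGram_new hs hK' hθ).1) i j).hol
      (((matHol_S0 (E := E) h.domain h.torus h.gram) i j).hol.mono
        (by linarith [h.δ_pos] : ρ - 3 * δ ≤ ρ))
    have h2 : (matAverage (E.S0 K') - matAverage (E.S0 K)) i j =
        average fun θ => E.S0 K' θ i j - E.S0 K θ i j := h1.symm
    rw [h2]
    refine norm_average_le fun t => ?_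
    have h3 := (h.close_S0 hs hK' hconv (toC_mem_strip hρ t)).diff
    exact (norm_entry_le (E.S0 K' (toC t) - E.S0 K (toC t)) i j).trans h3
  have h0 : 0 ≤ ‖matAverage (E.S0 K') - matAverage (E.S0 K)‖ := norm_nonneg _
  have hI := h.invAvg_le
  obtain ⟨h1, -, h3⟩ := inv_perturbation h.avg (M' := matAverage (E.S0 K')) (by
    refine (mul_le_mul hI hM h0 (by positivity)).trans ?_
    refine le_trans (le_of_eq ?_) (h.small_pow (k := 106) (by norm_num))
    ring)
  refine ⟨h1, h3.trans ?_⟩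
  calc 2 * ‖(matAverage (E.S0 K))⁻¹‖ ^ 2 * ‖matAverage (E.S0 K') - matAverage (E.S0 K)‖
      ≤ Q * (Q ^ 2) ^ 2 * (Q ^ 51 * (Q ^ 53 * (lossFactor γ σ δ ^ 2 * ε / δ))) := by
        gcongr
        exact hM
    _ = _ := by ring

end Correction

end StepData

end System.Extension

end QuasiNewton

namespace QuasiNewton

open Matrix Filter Topology

/-! ### One quasi-Newton step -/

section Polynomial

/-- All coefficients are nonnegative. -/
def NonnegCoeffs (p : MvPolynomial (Fin 3) ℝ) : Prop := ∀ a, 0 ≤ p.coeff a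

variable {p q : MvPolynomial (Fin 3) ℝ}

theorem NonnegCoeffs.add (hp : NonnegCoeffs p) (hq : NonnegCoeffs q) : NonnegCoeffs (p + q) :=
  fun a => by rw [MvPolynomial.coeff_add]; exact add_nonneg (hp a) (hq a)

theorem NonnegCoeffs.mul (hp : NonnegCoeffs p) (hq : NonnegCoeffs q) : NonnegCoeffs (p * q) :=
  fun a => by
    classical
    rw [MvPolynomial.coeff_mul]
    exact Finset.sum_nonneg fun x _ => mul_nonneg (hp _) (hq _)

theorem nonnegCoeffs_C {c : ℝ} (hc : 0 ≤ c) : NonnegCoeffs (MvPolynomial.C c) := fun a => by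
  classical
  rw [MvPolynomial.coeff_C]; split_ifs <;> simp [hc]

theorem nonnegCoeffs_X (i : Fin 3) : NonnegCoeffs (MvPolynomial.X i) := fun a => by
  classical
  rw [MvPolynomial.coeff_X]; split_ifs <;> simp

theorem NonnegCoeffs.pow (hp : NonnegCoeffs p) (k : ℕ) : NonnegCoeffs (p ^ k) := by
  induction k with
  | zero => rw [pow_zero, ← MvPolynomial.C_1]; exact nonnegCoeffs_C zero_le_one
  | succ k ih => rw [pow_succ]; exact ih.mul hp

/-- The polynomial `(β (1 + y₁ + y₂ + y₃))^150`. Its value at the data of a torus is the power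
`Q^150` of a bound `Q` of all the constants in a step; the exponent exceeds those of `Q` in all
step estimates. -/
noncomputable def stepPolynomial (β : ℝ) : MvPolynomial (Fin 3) ℝ :=
  (MvPolynomial.C β * (MvPolynomial.C 1 + MvPolynomial.X 0 + MvPolynomial.X 1
    + MvPolynomial.X 2)) ^ 150

theorem nonnegCoeffs_stepPolynomial {β : ℝ} (hβ : 0 ≤ β) : NonnegCoeffs (stepPolynomial β) :=
  ((nonnegCoeffs_C hβ).mul ((((nonnegCoeffs_C zero_le_one).add (nonnegCoeffs_X 0)).add
    (nonnegCoeffs_X 1)).add (nonnegCoeffs_X 2))).pow 150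

theorem eval_stepPolynomial (β x y z : ℝ) :
    MvPolynomial.eval ![x, y, z] (stepPolynomial β) = (β * (1 + x + y + z)) ^ 150 := by
  rw [stepPolynomial, map_pow]
  congr 1
  simp

end Polynomial

section StripNorm

variable {n : ℕ} {F : Type} [SeminormedAddCommGroup F] {ρ M : ℝ} {f : (Fin n → ℂ) → F}

theorem BddOnStrip.le_stripNorm (hf : BddOnStrip ρ f) {θ : Fin n → ℂ} (hθ : θ ∈ strip n ρ) :
    ‖f θ‖ ≤ stripNorm ρ f := by
  obtain ⟨C, hC⟩ := hf
  exact le_ciSup (f := fun θ : strip n ρ => ‖f θ‖) ⟨C, by rintro _ ⟨θ, rfl⟩; exact hC θ θ.2⟩ ⟨θ, hθ⟩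

theorem stripNorm_nonneg : 0 ≤ stripNorm ρ f := Real.iSup_nonneg fun _ => norm_nonneg _

theorem stripNorm_le (hM : 0 ≤ M) (h : ∀ θ ∈ strip n ρ, ‖f θ‖ ≤ M) : stripNorm ρ f ≤ M :=
  Real.iSup_le (fun θ => h θ θ.2) hM

end StripNorm

theorem lossFactor_sq {γ σ δ : ℝ} (hγ : 0 < γ) (hδ : 0 < δ) :
    γ ^ (-2 : ℝ) * δ ^ (-(2 * σ)) = lossFactor γ σ δ ^ 2 := by
  have h1 : γ ^ (-2 : ℝ) = γ⁻¹ ^ 2 := by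
    rw [Real.rpow_neg hγ.le, inv_pow]; norm_cast
  have h2 : δ ^ (-(2 * σ)) = (δ ^ (-σ)) ^ 2 := by
    rw [← Real.rpow_natCast, ← Real.rpow_mul hδ.le]; congr 1; push_cast; ring
  rw [h1, h2, lossFactor, mul_pow]

theorem lossFactor_sq_div {γ σ δ : ℝ} (hγ : 0 < γ) (hδ : 0 < δ) :
    γ ^ (-2 : ℝ) * δ ^ (-(2 * σ + 1)) = lossFactor γ σ δ ^ 2 / δ := by
  rw [← lossFactor_sq hγ hδ, neg_add, Real.rpow_add hδ, Real.rpow_neg_one]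
  ring

theorem lossFactor_four {γ σ δ : ℝ} (hγ : 0 < γ) (hδ : 0 < δ) :
    γ ^ (-4 : ℝ) * δ ^ (-(4 * σ)) = lossFactor γ σ δ ^ 4 := by
  have h1 : γ ^ (-4 : ℝ) = γ⁻¹ ^ 4 := by
    rw [Real.rpow_neg hγ.le, inv_pow]; norm_cast
  have h2 : δ ^ (-(4 * σ)) = (δ ^ (-σ)) ^ 4 := by
    rw [← Real.rpow_natCast, ← Real.rpow_mul hδ.le]; congr 1; push_cast; ring
  rw [h1, h2, lossFactor, mul_pow]

theorem VecHol.realAnalyticPeriodic {n p : ℕ} {ρ : ℝ} {f : (Fin n → ℂ) → (Fin p → ℂ)}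
    (hf : VecHol ρ f) : RealAnalyticPeriodic ρ f :=
  ⟨hf.differentiableOn, fun k θ hθ => funext fun j => (hf j).hol.periodic k θ hθ,
    fun t => ⟨fun j => (f (toC t) j).re, funext fun j =>
      (Complex.conj_eq_iff_re.1 ((hf j).real t)).symm⟩⟩

theorem conj_average {n : ℕ} {f : (Fin n → ℂ) → ℂ}
    (hf : ∀ t, (starRingEnd ℂ) (f (toC t)) = f (toC t)) :
    (starRingEnd ℂ) (average f) = average f := by
  unfold average
  rw [← integral_conj]
  simp only [hf]

/-- The solution of a real regular linear system is real. -/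
theorem conj_eq_of_mulVec_eq {n : ℕ} {M : Matrix (Fin n) (Fin n) ℂ} (hM : IsUnit M.det)
    (hMr : ∀ i j, (starRingEnd ℂ) (M i j) = M i j) {c b : Fin n → ℂ} (h : M *ᵥ c = b)
    (hb : ∀ i, (starRingEnd ℂ) (b i) = b i) (i : Fin n) : (starRingEnd ℂ) (c i) = c i := by
  have h1 : M *ᵥ (fun i => (starRingEnd ℂ) (c i)) = b := by
    ext i
    rw [← hb i, ← h]
    simp only [Matrix.mulVec, dotProduct, map_sum, map_mul, hMr]
  have h2 : ∀ v, M *ᵥ v = b → v = M⁻¹ *ᵥ b := fun v hv => by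
    rw [← hv, Matrix.mulVec_mulVec, Matrix.nonsing_inv_mul _ hM, Matrix.one_mulVec]
  exact congrFun ((h2 _ h1).trans (h2 c h).symm) i

namespace System.Extension

variable {n : ℕ} {S : System n}

section Existence

variable {D : Set (Fin (2 * n) → ℂ)} {E : S.Extension D} {σ γ : ℝ} {ω : Fin n → ℝ} {ρ δ Q ε : ℝ}
  {K : (Fin n → ℂ) → (Fin (2 * n) → ℂ)}

/-- The reduced equations are solvable: `p_y` has average zero, and the average of `ξ_y` is chosen
such that the right-hand side of the equation for `ξ_x` has average zero. -/
theorem StepData.exists_isCorrection (h : E.StepData σ γ ω ρ δ Q ε K) :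
    ∃ Δ, E.IsCorrection ω ρ K Δ := by
  have hρ := h.torus.pos
  have hσ : 0 < σ := by linarith [h.one_le_σ]
  have hS := matHol_S0 (E := E) h.domain h.torus h.gram
  have hpx := vecHol_pX h.domain h.torus h.bounds.invertible h.gram ω
  have hpy := vecHol_pY h.domain h.torus h.bounds.invertible ω
  have havg : ∀ j, average (fun θ => -E.pY ω K θ j) = 0 := fun j => by
    have h1 := average_pY h.domain h.torus h.bounds.invertible ω j
    unfold average at h1 ⊢
    rw [MeasureTheory.integral_neg, h1, neg_zero]
  choose u hu hud hur using fun j => HolPeriodic.exists_primitive h.dioph h.γ_pos hσ hρ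
    (hpy j).neg.hol (havg j) (hpy j).neg.real
  have huV : VecHol ρ fun θ j => u j θ := fun j => ⟨hu j, hur j⟩
  set b : Fin n → ℂ := fun i =>
    average (fun θ => (E.pX ω K θ - E.S0 K θ *ᵥ fun j => u j θ) i) with hb
  have hbr : ∀ i, (starRingEnd ℂ) (b i) = b i := fun i =>
    conj_average ((hpx.sub (hS.mulVec huV)) i).real
  set c : Fin n → ℂ := (matAverage (E.S0 K))⁻¹ *ᵥ b with hc
  have hMc : matAverage (E.S0 K) *ᵥ c = b := by
    rw [hc, Matrix.mulVec_mulVec, Matrix.mul_nonsing_inv _ h.avg, Matrix.one_mulVec]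
  have hcr := conj_eq_of_mulVec_eq h.avg (fun i j => by
    rw [matAverage, Matrix.of_apply]; exact conj_average (hS i j).real) hMc hbr
  set ξy : (Fin n → ℂ) → (Fin n → ℂ) := fun θ => (fun j => u j θ) + c with hξy
  have hξyV : VecHol ρ ξy := huV.add fun i => realHol_const (hcr i)
  have hf := (hS.mulVec hξyV).sub hpx
  have hf0 : ∀ j, average (fun θ => (E.S0 K θ *ᵥ ξy θ - E.pX ω K θ) j) = 0 := fun j => by
    rw [h.matAverage_mulVec hξyV c j, hMc]
    simp only [hξy, add_sub_cancel_right, hb, sub_self]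
  choose w hw hwd hwr using fun j => HolPeriodic.exists_primitive h.dioph h.γ_pos hσ hρ
    (hf j).hol (hf0 j) (hf j).real
  set ξx : (Fin n → ℂ) → (Fin n → ℂ) := fun θ j => w j θ - average (w j) with hξx
  have hξxV : VecHol ρ ξx := fun j =>
    RealHol.sub ⟨hw j, hwr j⟩ (realHol_const (conj_average (hwr j)))
  refine ⟨fun θ => jac K θ *ᵥ ξx θ + (E.B (K θ) * jac K θ * invGram K θ) *ᵥ ξy θ, ξx, ξy,
    hξxV.realAnalyticPeriodic, hξyV.realAnalyticPeriodic, fun θ hθ => ?_, fun θ hθ => ?_,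
    fun j => ?_, fun θ _ => rfl⟩
  · ext j
    rw [← hξxV.dω_apply ω hθ]
    refine Eq.trans ?_ (hwd j θ hθ)
    simp only [hξx, fderiv_sub_const]
  · ext j
    rw [← hξyV.dω_apply ω hθ, Pi.neg_apply, ← hud j θ hθ]
    simp only [hξy, Pi.add_apply, fderiv_add_const]
  · simp only [hξx]
    rw [average_sub hρ (hw j) (holPeriodic_const _)]
    have : average (fun _ : Fin n → ℂ => average (w j)) = average (w j) :=
      cubeAvg_const (average (w j))
    rw [this, sub_self]

end Existence

variable {ρ₀ r : ℝ} {K₀ : (Fin n → ℂ) → (Fin (2 * n) → ℂ)}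

theorem _root_.QuasiNewton.System.MemP.torusIn {ρ : ℝ} {K : (Fin n → ℂ) → (Fin (2 * n) → ℂ)}
    {D : Set (Fin (2 * n) → ℂ)} (hK : S.MemP ρ K) (hρ : 0 < ρ)
    (hm : ∀ θ ∈ strip n ρ, K θ ∈ D) : S.TorusIn D ρ K :=
  ⟨hρ, hK.differentiableOn, hm, fun k => by
    obtain ⟨v, hv, h⟩ := hK.periodic k
    exact ⟨v, hv, fun θ hθ => h θ (strip_subset_closedStrip le_rfl hθ)⟩, hK.real⟩

variable {E : S.Extension (S.nbhd ρ₀ r K₀)} {σ γ : ℝ} {ω : Fin n → ℝ} {ρ δ β bB bI bH : ℝ}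
  {K : (Fin n → ℂ) → (Fin (2 * n) → ℂ)}

theorem const_stepPolynomial : E.const (stepPolynomial β) ρ K =
    (β * (1 + stripNorm ρ (jac K) + stripNorm ρ (invGram K) + E.invAvg K)) ^ 150 :=
  eval_stepPolynomial _ _ _ _

variable {lam : MvPolynomial (Fin 3) ℝ} {Q : ℝ}

/-- The hypotheses of a step, if the constant of `K` is a power of a bound `Q` of all data. -/
theorem StepConditions.stepData (hE : E.NormBounds bB bI bH) (hγ : 0 < γ) (hγ1 : γ ≤ 1)
    (hω : IsDiophantine γ σ ω) (hσ : 1 ≤ σ) (hρ : ρ ≤ ρ₀) (hδ : 0 < δ) (hδ1 : δ < 1)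
    (hδρ : 3 * δ < ρ) (hK : S.MemP ρ K) (hQ2 : 2 ≤ Q) (hQn : ((2 * n : ℕ) : ℝ) ≤ Q)
    (hQB : bB ≤ Q) (hQI : bI ≤ Q) (hQH : bH ≤ Q) (hQr : ruessmannConst n σ ≤ Q)
    (hQK : 1 + stripNorm ρ (jac K) + stripNorm ρ (invGram K) + E.invAvg K ≤ Q)
    (hc : E.const lam ρ K = Q ^ 150) (h : E.StepConditions lam σ γ ω r ρ δ K₀ K) :
    E.StepData σ γ ω ρ δ Q (stripNorm ρ (E.err ω K)) K := by
  have hx : 0 ≤ stripNorm ρ (jac K) := stripNorm_nonneg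
  have hy : 0 ≤ stripNorm ρ (invGram K) := stripNorm_nonneg
  have he : 0 ≤ stripNorm ρ (E.err ω K) := stripNorm_nonneg
  have hz : 0 ≤ E.invAvg K := maxNorm_nonneg _
  have hρ0 : 0 < ρ := by linarith
  have hQ0 : 0 ≤ Q := by linarith
  have hm : ∀ θ ∈ strip n ρ, K θ ∈ S.nbhd ρ₀ r K₀ := fun θ hθ => by
    refine S.ball_subset_nbhd (fun j => (hθ j).le.trans hρ) ?_
    refine lt_of_le_of_lt (h.bdd_sub.le_stripNorm hθ) (lt_of_le_of_lt ?_ h.inside)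
    rw [hc]
    exact le_add_of_nonneg_right (mul_nonneg (mul_nonneg (mul_nonneg (pow_nonneg hQ0 150)
      (Real.rpow_nonneg hγ.le _)) (Real.rpow_nonneg hδ.le _)) he)
  refine ⟨S.domain_nbhd, hK.torusIn hρ0 hm, hE.mono hQB hQI hQH, hσ, hγ, hγ1, hω, hδ, hδ1, hδρ,
    hQ2, hQn, hQr, h.nonDegenerate.1, h.nonDegenerate.2, fun θ hθ => ?_, fun θ hθ => ?_,
    fun θ hθ => h.bdd_err.le_stripNorm hθ, ?_, ?_⟩
  · have := h.bdd_jac.le_stripNorm hθ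
    linarith
  · have := h.bdd_invGram.le_stripNorm hθ
    linarith
  · refine (norm_le_maxNorm _).trans ?_
    have h1 : (n : ℝ) ≤ Q := by
      push_cast at hQn
      linarith [(n.cast_nonneg : (0 : ℝ) ≤ n)]
    have h2 : E.invAvg K ≤ Q := by linarith
    rw [sq]
    exact mul_le_mul h1 h2 hz (by linarith)
  · refine le_trans (le_of_eq ?_) h.small
    rw [hc, mul_assoc _ (γ ^ (-2 : ℝ)), lossFactor_sq_div hγ hδ, mul_assoc, div_mul_eq_mul_div]

/-- The step estimates, with the constant `Q^150`. -/
theorem StepConditions.stepEstimates (hU : ∀ x, toC x ∈ S.nbhd ρ₀ r K₀ → x ∈ S.U)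
    (hρ : ρ ≤ ρ₀) (hK : S.MemP ρ K)
    (hc : E.const lam ρ K = Q ^ 150) (h : E.StepConditions lam σ γ ω r ρ δ K₀ K)
    (hd : E.StepData σ γ ω ρ δ Q (stripNorm ρ (E.err ω K)) K)
    {Δ K' : (Fin n → ℂ) → (Fin (2 * n) → ℂ)}
    (hs : E.IsStep ω ρ δ K Δ K') :
    E.StepEstimates lam σ γ ω ρ δ K Δ K' := by
  obtain ⟨ξx, ξy, hsol⟩ := hs.1.exists_isReducedSolution
  have hinside := h.inside
  generalize hε : stripNorm ρ (E.err ω K) = ε at hd hinside ⊢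
  rw [hc, mul_assoc _ (γ ^ (-2 : ℝ)), lossFactor_sq hd.γ_pos hd.δ_pos, mul_assoc] at hinside
  have hQ := hd.two_le
  have hQ0 : 0 ≤ Q := by linarith
  have hδ := hd.δ_pos
  have hs2 := hd.scale_nonneg 2
  have hs2d : 0 ≤ lossFactor γ σ δ ^ 2 * ε / δ := div_nonneg hs2 hδ.le
  have hs4 : (0 : ℝ) ≤ lossFactor γ σ δ ^ 4 * ε ^ 2 := mul_nonneg (hd.pow_nonneg 4) (sq_nonneg ε)
  have hΔ : ∀ θ ∈ strip n (ρ - 2 * δ), ‖Δ θ‖ ≤ Q ^ 150 * (lossFactor γ σ δ ^ 2 * ε) :=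
    fun θ hθ => (hd.bound_Δ hsol hθ).mono hQ hs2 (by norm_num) le_rfl
  have hjΔ : ∀ θ ∈ strip n (ρ - 3 * δ),
      ‖jac Δ θ‖ ≤ Q ^ 150 * (lossFactor γ σ δ ^ 2 * ε / δ) :=
    fun θ hθ => (hd.bound_jac_Δ hsol hθ).mono hQ hs2d (by norm_num) le_rfl
  have hcs : closedStrip n (ρ - 3 * δ) ⊆ strip n (ρ - 2 * δ) :=
    closedStrip_subset_strip (by linarith)
  have hcs0 : closedStrip n (ρ - 3 * δ) ⊆ strip n ρ := closedStrip_subset_strip (by linarith)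
  have hcsc : closedStrip n (ρ - 3 * δ) ⊆ closedStrip n ρ :=
    hcs0.trans (strip_subset_closedStrip le_rfl)
  have hK' : ∀ θ ∈ strip n (ρ - 3 * δ), K' θ = K θ + Δ θ := fun θ hθ =>
    hs.2 θ (strip_subset_closedStrip le_rfl hθ)
  -- both tori stay in the ball of radius `r` about `K₀ θ`
  have hball : ∀ θ ∈ closedStrip n (ρ - 3 * δ), ‖K θ - K₀ θ‖ < r ∧ ‖K' θ - K₀ θ‖ < r := by
    intro θ hθ
    have h1 := h.bdd_sub.le_stripNorm (hcs0 hθ)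
    rw [Pi.sub_apply] at h1
    have h2 := hΔ θ (hcs hθ)
    have h3 : 0 ≤ Q ^ 150 * (lossFactor γ σ δ ^ 2 * ε) := mul_nonneg (pow_nonneg hQ0 150) hs2
    refine ⟨by linarith, ?_⟩
    rw [hs.2 θ hθ, add_sub_right_comm]
    have := norm_add_le (K θ - K₀ θ) (Δ θ)
    linarith
  have hin : ∀ θ ∈ closedStrip n (ρ - 3 * δ), θ ∈ closedStrip n ρ₀ := fun θ hθ j =>
    (hcsc hθ j).trans hρ
  have hmaps : Set.MapsTo K' (closedStrip n (ρ - 3 * δ)) (S.nbhd ρ₀ r K₀) := fun θ hθ =>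
    S.ball_subset_nbhd (hin θ hθ) (hball θ hθ).2
  have hconv : ∀ θ ∈ strip n (ρ - 3 * δ), ∃ s, Convex ℝ s ∧ s ⊆ S.nbhd ρ₀ r K₀ ∧
      K θ ∈ s ∧ K' θ ∈ s := fun θ hθ => by
    have hθ' := strip_subset_closedStrip le_rfl hθ
    exact ⟨Metric.ball (K₀ θ) r, convex_ball _ _, fun z hz =>
      S.ball_subset_nbhd (hin θ hθ') (by rwa [mem_ball_iff_norm] at hz),
      by rw [mem_ball_iff_norm]; exact (hball θ hθ').1,
      by rw [mem_ball_iff_norm]; exact (hball θ hθ').2⟩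
  have hVΔ := hd.vecHol_Δ hsol
  have hρ' : 0 < ρ - 3 * δ := by linarith [hd.width]
  have hmem : S.MemP (ρ - 3 * δ) K' := by
    refine ⟨?_, fun θ hθ => ?_, fun k => ?_, fun t => ?_⟩
    · exact ((hK.continuousOn.mono hcsc).add
        (hVΔ.differentiableOn.continuousOn.mono hcs0)).congr fun θ hθ => hs.2 θ hθ
    · exact (hd.hasFDerivAt_new hsol hK' hθ).differentiableAt.differentiableWithinAt
    · obtain ⟨v, hv, hvk⟩ := hK.periodic k
      refine ⟨v, hv, fun θ hθ => ?_⟩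
      have h1 : Δ (θ + intC k) = Δ θ := funext fun j => (hVΔ j).hol.periodic k θ (hcs0 hθ)
      rw [hs.2 θ hθ, hs.2 _ ((add_intC_mem_closedStrip k).2 hθ), hvk θ (hcsc hθ), h1]
      abel
    · have ht : toC t ∈ closedStrip n (ρ - 3 * δ) :=
        strip_subset_closedStrip le_rfl (toC_mem_strip hρ' t)
      obtain ⟨x, -, hx⟩ := hK.real t
      obtain ⟨y, hy⟩ := hVΔ.realAnalyticPeriodic.real t
      have h1 : K' (toC t) = toC (x + y) := by rw [hs.2 _ ht, hx, hy, toC_add]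
      refine ⟨x + y, hU _ ?_, h1⟩
      rw [← h1]
      exact hmaps ht
  have hT : S.TorusIn (S.nbhd ρ₀ r K₀) (ρ - 3 * δ) K' :=
    hmem.torusIn hρ' fun θ hθ => hmaps (strip_subset_closedStrip le_rfl hθ)
  have hN : ∀ θ ∈ strip n (ρ - 3 * δ), ‖invGram K' θ‖ ≤ stripNorm ρ (invGram K)
      + Q ^ 150 * (lossFactor γ σ δ ^ 2 * ε / δ) := fun θ hθ => by
    have h1 := (hd.invGram_new hsol hK' hθ).2.diff
    have h2 : PowBound Q 150 (lossFactor γ σ δ ^ 2 * ε / δ) (invGram K' θ - invGram K θ) := by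
      refine PowBound.mono hQ (k := 60) ?_ hs2d (by norm_num) le_rfl
      exact h1.trans_eq (by ring)
    have h3 := h.bdd_invGram.le_stripNorm (hd.strip_zero (hd.strip_two hθ))
    have h4 := norm_add_le (invGram K θ) (invGram K' θ - invGram K θ)
    rw [add_sub_cancel] at h4
    unfold PowBound at h2
    linarith
  have hErr : ∀ θ ∈ strip n (ρ - 3 * δ), ‖E.err ω K' θ‖ ≤
      Q ^ 150 * (lossFactor γ σ δ ^ 4 * ε ^ 2) := fun θ hθ =>
    (hd.bound_err_new hsol hK' hconv hθ).mono hQ hs4 (by norm_num) le_rfl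
  obtain ⟨hu, hM⟩ := hd.matAverage_new hsol hK' hconv hT
  have e2 : E.const lam ρ K * γ ^ (-2 : ℝ) * δ ^ (-(2 * σ)) * ε =
      Q ^ 150 * (lossFactor γ σ δ ^ 2 * ε) := by
    rw [hc, mul_assoc _ (γ ^ (-2 : ℝ)), lossFactor_sq hd.γ_pos hδ, mul_assoc]
  have e2d : E.const lam ρ K * γ ^ (-2 : ℝ) * δ ^ (-(2 * σ + 1)) * ε =
      Q ^ 150 * (lossFactor γ σ δ ^ 2 * ε / δ) := by
    rw [hc, mul_assoc _ (γ ^ (-2 : ℝ)), lossFactor_sq_div hd.γ_pos hδ, mul_assoc,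
      div_mul_eq_mul_div]
  have e4 : E.const lam ρ K * γ ^ (-4 : ℝ) * δ ^ (-(4 * σ)) * ε ^ 2 =
      Q ^ 150 * (lossFactor γ σ δ ^ 4 * ε ^ 2) := by
    rw [hc, mul_assoc _ (γ ^ (-4 : ℝ)), lossFactor_four hd.γ_pos hδ, mul_assoc]
  have p2 : 0 ≤ Q ^ 150 * (lossFactor γ σ δ ^ 2 * ε) := mul_nonneg (pow_nonneg hQ0 150) hs2
  have p2d : 0 ≤ Q ^ 150 * (lossFactor γ σ δ ^ 2 * ε / δ) := mul_nonneg (pow_nonneg hQ0 150) hs2d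
  have p4 : 0 ≤ Q ^ 150 * (lossFactor γ σ δ ^ 4 * ε ^ 2) := mul_nonneg (pow_nonneg hQ0 150) hs4
  refine ⟨⟨_, hΔ⟩, ?_, ⟨_, hjΔ⟩, ?_, hmem, ⟨fun θ hθ => (hd.invGram_new hsol hK' hθ).1, hu⟩, hmaps,
    ⟨_, hN⟩, ?_, ?_, ⟨_, hErr⟩, ?_⟩
  · rw [hε, e2]; exact stripNorm_le p2 hΔ
  · rw [hε, e2d]; exact stripNorm_le p2d hjΔ
  · rw [hε, e2d]; exact stripNorm_le (add_nonneg stripNorm_nonneg p2d) hN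
  · rw [hε, e2d]
    refine maxNorm_le (add_nonneg (maxNorm_nonneg _) p2d) fun i j => ?_
    have h1 := norm_entry_le_maxNorm (matAverage (E.S0 K))⁻¹ i j
    have h2 := (norm_entry_le ((matAverage (E.S0 K'))⁻¹ - (matAverage (E.S0 K))⁻¹) i j).trans
      (hM.mono hQ hs2d (by norm_num : _ ≤ 150) le_rfl)
    rw [Matrix.sub_apply] at h2
    have h3 := norm_add_le ((matAverage (E.S0 K))⁻¹ i j)
      ((matAverage (E.S0 K'))⁻¹ i j - (matAverage (E.S0 K))⁻¹ i j)
    rw [add_sub_cancel] at h3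
    unfold invAvg
    linarith
  · rw [hε, e4]; exact stripNorm_le p4 hErr

end System.Extension

/-- The constant `β` of the step polynomial. The absolute values make it at least `2`, whatever the
signs of the bounds. -/
noncomputable def stepConst (n : ℕ) (σ bB bI bH : ℝ) : ℝ :=
  2 + (2 * n : ℕ) + |bB| + |bI| + |bH| + |ruessmannConst n σ|

/-- A step is possible under the step conditions, and the step estimates hold. -/
theorem isStepPolynomial {n : ℕ} {σ ρ₀ r bB bI bH : ℝ} (hσ : 1 ≤ σ) :
    IsStepPolynomial n σ ρ₀ r bB bI bH (stepPolynomial (stepConst n σ bB bI bH)) := by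
  have h1 := abs_nonneg bB
  have h2 := abs_nonneg bI
  have h3 := abs_nonneg bH
  have h4 := abs_nonneg (ruessmannConst n σ)
  have h5 : (0 : ℝ) ≤ (2 * n : ℕ) := Nat.cast_nonneg _
  have hβ : 2 ≤ stepConst n σ bB bI bH := by unfold stepConst; linarith
  refine ⟨nonnegCoeffs_stepPolynomial (by linarith), ?_⟩
  intro S K₀ _ hU E hE γ ω hγ hγ1 hω ρ δ hρ hδ hδ1 hδρ K hK h
  have hx : 0 ≤ stripNorm ρ (jac K) := stripNorm_nonneg
  have hy : 0 ≤ stripNorm ρ (invGram K) := stripNorm_nonneg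
  have hz : 0 ≤ E.invAvg K := maxNorm_nonneg _
  obtain ⟨Q, hQ⟩ : ∃ Q, Q = stepConst n σ bB bI bH *
    (1 + stripNorm ρ (jac K) + stripNorm ρ (invGram K) + E.invAvg K) := ⟨_, rfl⟩
  have hc : E.const (stepPolynomial (stepConst n σ bB bI bH)) ρ K = Q ^ 150 := by
    rw [hQ, System.Extension.const_stepPolynomial]
  have hβQ : stepConst n σ bB bI bH ≤ Q := by
    rw [hQ]; exact le_mul_of_one_le_right (by linarith) (by linarith)
  have hQK : 1 + stripNorm ρ (jac K) + stripNorm ρ (invGram K) + E.invAvg K ≤ Q := by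
    rw [hQ]; exact le_mul_of_one_le_left (by linarith) (by linarith)
  have hd := h.stepData hE hγ hγ1 hω hσ hρ hδ hδ1 hδρ hK (hβ.trans hβQ)
    (le_trans (by unfold stepConst; linarith) hβQ)
    (le_trans (by unfold stepConst; linarith [le_abs_self bB]) hβQ)
    (le_trans (by unfold stepConst; linarith [le_abs_self bI]) hβQ)
    (le_trans (by unfold stepConst; linarith [le_abs_self bH]) hβQ)
    (le_trans (by unfold stepConst; linarith [le_abs_self (ruessmannConst n σ)]) hβQ) hQK hc
  exact ⟨hd.exists_isCorrection, fun Δ K' hs => h.stepEstimates hU hρ hK hc hd hs⟩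

end QuasiNewton

namespace QuasiNewton

open Matrix Filter Topology

/-! ### Convergence of the iteration -/

section Sequences

variable {ρ₀ δ₀ : ℝ}

theorem deltaSeq_pos (hδ : 0 < δ₀) (m : ℕ) : 0 < deltaSeq δ₀ m := by
  unfold deltaSeq; positivity

theorem deltaSeq_succ (δ₀ : ℝ) (m : ℕ) : deltaSeq δ₀ (m + 1) = deltaSeq δ₀ m / 2 := by
  rw [deltaSeq, deltaSeq, pow_succ, div_div]

theorem deltaSeq_le (hδ : 0 < δ₀) (m : ℕ) : deltaSeq δ₀ m ≤ δ₀ :=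
  div_le_self hδ.le (one_le_pow₀ one_le_two)

theorem rhoSeq_eq (ρ₀ δ₀ : ℝ) (m : ℕ) : rhoSeq ρ₀ δ₀ m = ρ₀ - 6 * δ₀ + 6 * deltaSeq δ₀ m := by
  induction m with
  | zero => simp [rhoSeq, deltaSeq]
  | succ m ih => rw [rhoSeq, ih, deltaSeq_succ]; ring

theorem rhoSeq_le (hδ : 0 < δ₀) (m : ℕ) : rhoSeq ρ₀ δ₀ m ≤ ρ₀ := by
  rw [rhoSeq_eq]; linarith [deltaSeq_le hδ m]

theorem three_mul_deltaSeq_lt (hδ : 0 < δ₀) (hδρ : δ₀ < ρ₀ / 12) (m : ℕ) :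
    3 * deltaSeq δ₀ m < rhoSeq ρ₀ δ₀ m := by
  rw [rhoSeq_eq]; linarith [deltaSeq_pos hδ m]

theorem lossFactor_pos {γ σ δ : ℝ} (hγ : 0 < γ) (hδ : 0 < δ) : 0 < lossFactor γ σ δ :=
  mul_pos (inv_pos.2 hγ) (Real.rpow_pos_of_pos hδ _)

theorem lossFactor_deltaSeq_succ {γ σ : ℝ} (hδ : 0 < δ₀) (m : ℕ) :
    lossFactor γ σ (deltaSeq δ₀ (m + 1)) = 2 ^ σ * lossFactor γ σ (deltaSeq δ₀ m) := by
  rw [lossFactor, lossFactor, deltaSeq_succ, Real.div_rpow (deltaSeq_pos hδ m).le zero_le_two,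
    Real.rpow_neg zero_le_two σ, div_inv_eq_mul]
  ring

end Sequences

theorem jac_congr_add {n p : ℕ} {ρ : ℝ} {K Δ K' : (Fin n → ℂ) → (Fin p → ℂ)}
    (hK : DifferentiableOn ℂ K (strip n ρ)) (hK' : DifferentiableOn ℂ K' (strip n ρ))
    (h : ∀ θ ∈ strip n ρ, K' θ = K θ + Δ θ) {θ : Fin n → ℂ} (hθ : θ ∈ strip n ρ) :
    jac K' θ = jac K θ + jac Δ θ := by
  have hn := (isOpen_strip n ρ).mem_nhds hθ
  have h1 : Δ =ᶠ[𝓝 θ] K' - K := by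
    filter_upwards [hn] with x hx
    rw [Pi.sub_apply, h x hx, add_sub_cancel_left]
  have h2 : fderiv ℂ Δ θ = fderiv ℂ K' θ - fderiv ℂ K θ := by
    rw [h1.fderiv_eq, fderiv_sub (hK'.differentiableAt hn) (hK.differentiableAt hn)]
  ext i j
  simp only [jac, Matrix.add_apply, Matrix.of_apply, h2, _root_.sub_apply, Pi.sub_apply,
    add_sub_cancel]

theorem stripNorm_add_le {n : ℕ} {F : Type} [SeminormedAddCommGroup F] {ρ ρ₁ ρ₂ : ℝ}
    {f g h : (Fin n → ℂ) → F} (hf : BddOnStrip ρ₁ f) (hg : BddOnStrip ρ₂ g) (h1 : ρ ≤ ρ₁)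
    (h2 : ρ ≤ ρ₂) (hh : ∀ θ ∈ strip n ρ, h θ = f θ + g θ) :
    BddOnStrip ρ h ∧ stripNorm ρ h ≤ stripNorm ρ₁ f + stripNorm ρ₂ g := by
  have key : ∀ θ ∈ strip n ρ, ‖h θ‖ ≤ stripNorm ρ₁ f + stripNorm ρ₂ g := fun θ hθ => by
    rw [hh θ hθ]
    exact (norm_add_le _ _).trans (add_le_add (hf.le_stripNorm (strip_mono h1 hθ))
      (hg.le_stripNorm (strip_mono h2 hθ)))
  exact ⟨⟨_, key⟩, stripNorm_le (add_nonneg stripNorm_nonneg stripNorm_nonneg) key⟩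

/-- The quadratic recursion `ε' ≤ c ℓ⁴ ε²` for the errors, where the loss factor `ℓ` grows by the
factor `T ≥ 2` in each step, while `δ` is halved: the scaled errors decrease geometrically. -/
theorem scaled_errors_succ {T c ℓ δ ε ε' : ℝ} (hT : 2 ≤ T) (hc : 0 ≤ c) (hδ : 0 < δ)
    (hε : 0 ≤ ε) (h : ε' ≤ c * (ℓ ^ 4 * ε ^ 2)) (ha : T ^ 4 * (c * (ℓ ^ 4 * ε)) ≤ 1 / 2) :
    T ^ 4 * (c * ((T * ℓ) ^ 4 * ε')) ≤ 1 / 2 ∧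
    c * ((T * ℓ) ^ 2 * ε') ≤ c * (ℓ ^ 2 * ε) / 2 ∧
    c * ((T * ℓ) ^ 2 * ε' / (δ / 2)) ≤ c * (ℓ ^ 2 * ε / δ) / 2 := by
  have hT0 : 0 ≤ T := by linarith
  set a := T ^ 4 * (c * (ℓ ^ 4 * ε)) with hadef
  have ha0 : 0 ≤ a := by positivity
  have h1 : T ^ 4 * (c * ((T * ℓ) ^ 4 * ε')) ≤ a ^ 2 := by
    calc _ ≤ T ^ 4 * (c * ((T * ℓ) ^ 4 * (c * (ℓ ^ 4 * ε ^ 2)))) := by gcongr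
      _ = a ^ 2 := by rw [hadef]; ring
  have hb0 : 0 ≤ c * (ℓ ^ 2 * ε) := by positivity
  have h2 : c * ((T * ℓ) ^ 2 * ε') ≤ c * (ℓ ^ 2 * ε) / 4 := by
    have h3 : T ^ 2 * (c * ((T * ℓ) ^ 2 * ε')) ≤ a * (c * (ℓ ^ 2 * ε)) := by
      calc _ ≤ T ^ 2 * (c * ((T * ℓ) ^ 2 * (c * (ℓ ^ 4 * ε ^ 2)))) := by gcongr
        _ = a * (c * (ℓ ^ 2 * ε)) := by rw [hadef]; ring
    have h4 : a * (c * (ℓ ^ 2 * ε)) ≤ 1 / 2 * (c * (ℓ ^ 2 * ε)) := by gcongr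
    have h5 : (0 : ℝ) ≤ c * ((T * ℓ) ^ 2 * ε') ∨ c * ((T * ℓ) ^ 2 * ε') ≤ 0 := le_total _ _
    rcases h5 with h5 | h5
    · have h6 : 4 * (c * ((T * ℓ) ^ 2 * ε')) ≤ T ^ 2 * (c * ((T * ℓ) ^ 2 * ε')) :=
        mul_le_mul_of_nonneg_right (by nlinarith) h5
      linarith
    · linarith
  refine ⟨h1.trans (by nlinarith), by linarith, ?_⟩
  calc c * ((T * ℓ) ^ 2 * ε' / (δ / 2)) = c * ((T * ℓ) ^ 2 * ε') * (2 / δ) := by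
        field_simp
    _ ≤ c * (ℓ ^ 2 * ε) / 4 * (2 / δ) := by gcongr
    _ = c * (ℓ ^ 2 * ε / δ) / 2 := by field_simp; norm_num

namespace System.Extension

variable {n : ℕ} {S : System n} {ρ₀ r : ℝ} {K₀ : (Fin n → ℂ) → (Fin (2 * n) → ℂ)}

/-- The properties of the torus `K = K_m` that the iteration preserves. The numbers `d`, `ν`, `s`
bound the data of `K₀`; `b` is the scaled error `c γ⁻² δ₀^{-2σ} ‖e₀‖` of `K₀`. -/
structure IterationInvariant (E : S.Extension (S.nbhd ρ₀ r K₀)) (σ γ : ℝ) (ω : Fin n → ℝ)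
    (δ₀ c d ν s b : ℝ) (m : ℕ) (K : (Fin n → ℂ) → (Fin (2 * n) → ℂ)) : Prop where
  memP : S.MemP (rhoSeq ρ₀ δ₀ m) K
  mapsTo : Set.MapsTo K (closedStrip n (rhoSeq ρ₀ δ₀ m)) (S.nbhd ρ₀ r K₀)
  bdd_jac : BddOnStrip (rhoSeq ρ₀ δ₀ m) (jac K)
  bdd_invGram : BddOnStrip (rhoSeq ρ₀ δ₀ m) (invGram K)
  bdd_err : BddOnStrip (rhoSeq ρ₀ δ₀ m) (E.err ω K)
  bdd_sub : BddOnStrip (rhoSeq ρ₀ δ₀ m) (K - K₀)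
  nonDegenerate : E.NonDegenerate (rhoSeq ρ₀ δ₀ m) K
  norm_jac : stripNorm (rhoSeq ρ₀ δ₀ m) (jac K) ≤ d + (1 - 1 / 2 ^ m)
  norm_invGram : stripNorm (rhoSeq ρ₀ δ₀ m) (invGram K) ≤ ν + (1 - 1 / 2 ^ m)
  invAvg_le : E.invAvg K ≤ s + (1 - 1 / 2 ^ m)
  norm_sub : stripNorm (rhoSeq ρ₀ δ₀ m) (K - K₀) ≤ 2 * b * (1 - 1 / 2 ^ m)
  err_four : (2 ^ σ) ^ 4 * (c * (lossFactor γ σ (deltaSeq δ₀ m) ^ 4 *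
    stripNorm (rhoSeq ρ₀ δ₀ m) (E.err ω K))) ≤ 1 / 2
  err_two : c * (lossFactor γ σ (deltaSeq δ₀ m) ^ 2 *
    stripNorm (rhoSeq ρ₀ δ₀ m) (E.err ω K)) ≤ b / 2 ^ m
  err_div : c * (lossFactor γ σ (deltaSeq δ₀ m) ^ 2 *
    stripNorm (rhoSeq ρ₀ δ₀ m) (E.err ω K) / deltaSeq δ₀ m) ≤ 1 / 2 ^ m / 2

variable {E : S.Extension (S.nbhd ρ₀ r K₀)} {σ γ : ℝ} {ω : Fin n → ℝ} {δ₀ c d ν s b : ℝ} {m : ℕ}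
  {K Δ K' : (Fin n → ℂ) → (Fin (2 * n) → ℂ)} {lam : MvPolynomial (Fin 3) ℝ}

section Invariant

variable (h : E.IterationInvariant σ γ ω δ₀ c d ν s b m K) (hγ : 0 < γ) (hδ₀ : 0 < δ₀)
  (hc : ∀ ρ K, stripNorm ρ (jac K) ≤ d + 1 → stripNorm ρ (invGram K) ≤ ν + 1 →
    E.invAvg K ≤ s + 1 → E.const lam ρ K ≤ c)
include h hc

theorem IterationInvariant.const_le : E.const lam (rhoSeq ρ₀ δ₀ m) K ≤ c := by
  have h2 : (0 : ℝ) ≤ 1 / 2 ^ m := by positivity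
  exact hc _ _ (h.norm_jac.trans (by linarith)) (h.norm_invGram.trans (by linarith))
    (h.invAvg_le.trans (by linarith))

include hγ hδ₀

theorem IterationInvariant.const_mul_sq_le :
    E.const lam (rhoSeq ρ₀ δ₀ m) K * γ ^ (-2 : ℝ) * deltaSeq δ₀ m ^ (-(2 * σ)) *
      stripNorm (rhoSeq ρ₀ δ₀ m) (E.err ω K) ≤ b / 2 ^ m := by
  refine le_trans ?_ h.err_two
  rw [mul_assoc _ (γ ^ (-2 : ℝ)), lossFactor_sq hγ (deltaSeq_pos hδ₀ m), mul_assoc]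
  exact mul_le_mul_of_nonneg_right (h.const_le hc) (mul_nonneg (sq_nonneg _) stripNorm_nonneg)

theorem IterationInvariant.const_mul_div_le :
    E.const lam (rhoSeq ρ₀ δ₀ m) K * γ ^ (-2 : ℝ) * deltaSeq δ₀ m ^ (-(2 * σ + 1)) *
      stripNorm (rhoSeq ρ₀ δ₀ m) (E.err ω K) ≤ 1 / 2 ^ m / 2 := by
  have hδ := deltaSeq_pos hδ₀ m
  refine le_trans ?_ h.err_div
  rw [mul_assoc _ (γ ^ (-2 : ℝ)), lossFactor_sq_div hγ hδ, mul_assoc, div_mul_eq_mul_div]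
  exact mul_le_mul_of_nonneg_right (h.const_le hc)
    (div_nonneg (mul_nonneg (sq_nonneg _) stripNorm_nonneg) hδ.le)

theorem IterationInvariant.const_mul_four_le :
    E.const lam (rhoSeq ρ₀ δ₀ m) K * γ ^ (-4 : ℝ) * deltaSeq δ₀ m ^ (-(4 * σ)) *
      stripNorm (rhoSeq ρ₀ δ₀ m) (E.err ω K) ^ 2 ≤
    c * (lossFactor γ σ (deltaSeq δ₀ m) ^ 4 * stripNorm (rhoSeq ρ₀ δ₀ m) (E.err ω K) ^ 2) := by
  rw [mul_assoc _ (γ ^ (-4 : ℝ)), lossFactor_four hγ (deltaSeq_pos hδ₀ m), mul_assoc]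
  exact mul_le_mul_of_nonneg_right (h.const_le hc)
    (mul_nonneg (pow_nonneg (lossFactor_pos hγ (deltaSeq_pos hδ₀ m)).le 4) (sq_nonneg _))

/-- The invariant implies the conditions for a step; the distance to `K₀` and the next correction
add up to less than `2 b`. -/
theorem IterationInvariant.stepConditions (hb0 : 0 ≤ b) (hb : 2 * b < r) :
    E.StepConditions lam σ γ ω r (rhoSeq ρ₀ δ₀ m) (deltaSeq δ₀ m) K₀ K := by
  refine ⟨h.bdd_jac, h.bdd_invGram, h.bdd_err, h.bdd_sub, h.nonDegenerate, ?_, ?_⟩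
  · have h1 := h.const_mul_sq_le hγ hδ₀ hc
    have h2 := h.norm_sub
    have h3 : 0 ≤ b / 2 ^ m := by positivity
    have h4 : 2 * b * (1 - 1 / 2 ^ m) + b / 2 ^ m = 2 * b - b / 2 ^ m := by ring
    linarith
  · refine (h.const_mul_div_le hγ hδ₀ hc).trans ?_
    have : (1 : ℝ) / 2 ^ m ≤ 1 := div_le_one_of_le₀ (one_le_pow₀ one_le_two) (by positivity)
    linarith

/-- The invariant is inherited by the next torus. -/
theorem IterationInvariant.succ (hσ : 1 ≤ σ) (hc0 : 0 ≤ c)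
    (hs : E.IsStep ω (rhoSeq ρ₀ δ₀ m) (deltaSeq δ₀ m) K Δ K')
    (he : E.StepEstimates lam σ γ ω (rhoSeq ρ₀ δ₀ m) (deltaSeq δ₀ m) K Δ K') :
    E.IterationInvariant σ γ ω δ₀ c d ν s b (m + 1) K' := by
  have hδ := deltaSeq_pos hδ₀ m
  have hT : (2 : ℝ) ≤ 2 ^ σ := by
    simpa using Real.rpow_le_rpow_of_exponent_le (one_le_two : (1 : ℝ) ≤ 2) hσ
  have herr : stripNorm (rhoSeq ρ₀ δ₀ (m + 1)) (E.err ω K') ≤ _ :=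
    he.norm_err.trans (h.const_mul_four_le hγ hδ₀ hc)
  obtain ⟨h4, h2, hd⟩ := scaled_errors_succ hT hc0 hδ stripNorm_nonneg herr h.err_four
  rw [← lossFactor_deltaSeq_succ hδ₀] at h4 h2 hd
  rw [← deltaSeq_succ] at hd
  have hK' : ∀ θ ∈ strip n (rhoSeq ρ₀ δ₀ (m + 1)), K' θ = K θ + Δ θ := fun θ hθ =>
    hs.2 θ (strip_subset_closedStrip le_rfl hθ)
  have hle : rhoSeq ρ₀ δ₀ (m + 1) ≤ rhoSeq ρ₀ δ₀ m := by rw [rhoSeq]; linarith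
  have hle2 : rhoSeq ρ₀ δ₀ (m + 1) ≤ rhoSeq ρ₀ δ₀ m - 2 * deltaSeq δ₀ m := by
    rw [rhoSeq]; linarith
  have hjac := stripNorm_add_le h.bdd_jac he.bdd_jac_Δ hle le_rfl fun θ hθ =>
    jac_congr_add (h.memP.differentiableOn.mono (strip_mono hle)) he.memP.differentiableOn hK' hθ
  have hsub := stripNorm_add_le (h := K' - K₀) h.bdd_sub he.bdd_Δ hle hle2 fun θ hθ => by
    rw [Pi.sub_apply, Pi.sub_apply, hK' θ hθ, add_sub_right_comm]
  have hη := h.const_mul_div_le hγ hδ₀ hc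
  have e1 : (1 : ℝ) / 2 ^ (m + 1) = 1 / 2 ^ m / 2 := by rw [pow_succ, div_div]
  have e2 : b / 2 ^ (m + 1) = b / 2 ^ m / 2 := by rw [pow_succ, div_div]
  refine ⟨he.memP, he.mapsTo, hjac.1, he.bdd_invGram, he.bdd_err, hsub.1, he.nonDegenerate,
    ?_, ?_, ?_, ?_, h4, ?_, ?_⟩
  · have := he.norm_jac_Δ
    have := h.norm_jac
    exact hjac.2.trans (by rw [e1]; linarith)
  · have := h.norm_invGram
    exact he.norm_invGram.trans (by rw [e1]; linarith)
  · have := h.invAvg_le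
    exact he.invAvg_le.trans (by rw [e1]; linarith)
  · have h1 := he.norm_Δ
    have h3 := h.norm_sub
    have h5 := h.const_mul_sq_le hγ hδ₀ hc
    refine hsub.2.trans ?_
    have e : 2 * b * (1 - 1 / 2 ^ (m + 1)) = 2 * b * (1 - 1 / 2 ^ m) + b / 2 ^ m := by
      rw [e1]; ring
    rw [e]
    linarith
  · rw [e2]
    have := h.err_two
    linarith
  · rw [e1]
    have := h.err_div
    linarith

end Invariant

/-- The invariant holds for `K₀`. -/
theorem iterationInvariant_zero {bB bI bH : ℝ} (hE : E.NormBounds bB bI bH) (hr : 0 < r)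
    (hK₀ : S.MemP ρ₀ K₀) (hγ : 0 < γ) (hγ1 : γ ≤ 1) (hσ : 1 ≤ σ) (hδ₀ : 0 < δ₀) (hδ1 : δ₀ < 1)
    (hc : 0 ≤ c) (hnd : E.NonDegenerate ρ₀ K₀) (hbj : BddOnStrip ρ₀ (jac K₀))
    (hj : stripNorm ρ₀ (jac K₀) ≤ d) (hbN : BddOnStrip ρ₀ (invGram K₀))
    (hN : stripNorm ρ₀ (invGram K₀) ≤ ν) (hs : E.invAvg K₀ ≤ s)
    (hκ : (2 ^ σ) ^ 4 * (c * (lossFactor γ σ δ₀ ^ 4 * stripNorm ρ₀ (E.err ω K₀))) ≤ 1 / 2) :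
    E.IterationInvariant σ γ ω δ₀ c d ν s
      (c * (lossFactor γ σ δ₀ ^ 2 * stripNorm ρ₀ (E.err ω K₀))) 0 K₀ := by
  have hδ : deltaSeq δ₀ 0 = δ₀ := by simp [deltaSeq]
  have hρ : rhoSeq ρ₀ δ₀ 0 = ρ₀ := rfl
  have hm : Set.MapsTo K₀ (closedStrip n ρ₀) (S.nbhd ρ₀ r K₀) := fun θ hθ =>
    S.ball_subset_nbhd hθ (by rwa [sub_self, norm_zero])
  have hz : (fun θ => (K₀ - K₀) θ) = fun _ => 0 := by ext; simp
  have hb0 : ∀ θ ∈ strip n ρ₀, ‖(K₀ - K₀) θ‖ ≤ 0 := fun θ _ => by simp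
  have herr : BddOnStrip ρ₀ (E.err ω K₀) := by
    obtain ⟨C, hC⟩ := hbj
    have hE' : E.NormBounds (|bB| + |bI| + |bH|) (|bB| + |bI| + |bH|) (|bB| + |bI| + |bH|) :=
      hE.mono (by linarith [le_abs_self bB, abs_nonneg bI, abs_nonneg bH])
        (by linarith [le_abs_self bI, abs_nonneg bB, abs_nonneg bH])
        (by linarith [le_abs_self bH, abs_nonneg bI, abs_nonneg bB])
    set Q := |bB| + |bI| + |bH|
    have hQ : 0 ≤ Q := by positivity
    refine ⟨Q * Q + C * ‖toC ω‖, fun θ hθ => ?_⟩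
    have hmθ := hm (strip_subset_closedStrip le_rfl hθ)
    rw [err, dω, fderiv_eq_jac_mulVec]
    refine (norm_sub_le _ _).trans (add_le_add ((linfty_opNorm_mulVec _ _).trans ?_)
      ((linfty_opNorm_mulVec _ _).trans ?_))
    · have h1 := hE'.B_le hmθ
      rw [PowBound, pow_one, mul_one] at h1
      exact mul_le_mul h1 ((pi_norm_le_iff_of_nonneg hQ).2 fun i =>
        (hE'.smooth_grad S.domain_nbhd.isOpen i).norm_le hmθ) (norm_nonneg _) hQ
    · exact mul_le_mul_of_nonneg_right (hC θ hθ) (norm_nonneg _)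
  have hε : 0 ≤ stripNorm ρ₀ (E.err ω K₀) := stripNorm_nonneg
  refine ⟨hK₀, hm, hbj, hbN, herr, ⟨0, hb0⟩, hnd, by simpa [hρ] using hj, by simpa [hρ] using hN,
    by simpa using hs, ?_, by rwa [hδ, hρ], by simp [hδ, hρ], ?_⟩
  · simpa [hρ] using stripNorm_le le_rfl hb0
  · rw [hδ, hρ]
    -- `1 / δ₀ ≤ ℓ ≤ ℓ²` for the loss factor `ℓ`, since `γ, δ₀ ≤ 1 ≤ σ`
    have hℓ0 := lossFactor_pos (σ := σ) hγ hδ₀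
    have h1 : δ₀⁻¹ ≤ lossFactor γ σ δ₀ := by
      have h2 : δ₀⁻¹ ≤ δ₀ ^ (-σ) := by
        rw [← Real.rpow_neg_one]
        exact Real.rpow_le_rpow_of_exponent_ge hδ₀ hδ1.le (by linarith)
      exact h2.trans (le_mul_of_one_le_left (Real.rpow_nonneg hδ₀.le _) ((one_le_inv₀ hγ).2 hγ1))
    have h1' : 1 ≤ lossFactor γ σ δ₀ := ((one_le_inv₀ hδ₀).2 hδ1.le).trans h1
    have h2 : δ₀⁻¹ ≤ lossFactor γ σ δ₀ ^ 2 := h1.trans (le_self_pow₀ h1' two_ne_zero)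
    have hT : (1 : ℝ) ≤ (2 ^ σ) ^ 4 :=
      one_le_pow₀ (Real.one_le_rpow one_le_two (by linarith))
    rw [pow_zero, div_one]
    refine le_trans ?_ hκ
    refine le_trans ?_ (le_mul_of_one_le_left (by positivity) hT)
    refine mul_le_mul_of_nonneg_left ?_ hc
    calc lossFactor γ σ δ₀ ^ 2 * stripNorm ρ₀ (E.err ω K₀) / δ₀
        = δ₀⁻¹ * (lossFactor γ σ δ₀ ^ 2 * stripNorm ρ₀ (E.err ω K₀)) := by
          rw [div_eq_inv_mul]
      _ ≤ lossFactor γ σ δ₀ ^ 2 * (lossFactor γ σ δ₀ ^ 2 * stripNorm ρ₀ (E.err ω K₀)) := by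
          gcongr
      _ = lossFactor γ σ δ₀ ^ 4 * stripNorm ρ₀ (E.err ω K₀) := by ring

/-- If the invariant implies that a step is possible and it is inherited by the result, then the
iteration exists and the invariant holds along every iteration. -/
theorem exists_isIteration {P : ℕ → ((Fin n → ℂ) → (Fin (2 * n) → ℂ)) → Prop} (h0 : P 0 K₀)
    (hex : ∀ m K, P m K → ∃ Δ, E.IsCorrection ω (rhoSeq ρ₀ δ₀ m) K Δ)
    (hsucc : ∀ m K Δ K', P m K → E.IsStep ω (rhoSeq ρ₀ δ₀ m) (deltaSeq δ₀ m) K Δ K' →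
      P (m + 1) K') :
    (∃ K, E.IsIteration ω ρ₀ δ₀ K₀ K) ∧ ∀ K, E.IsIteration ω ρ₀ δ₀ K₀ K → ∀ m, P m (K m) := by
  constructor
  · choose! Δ hΔ using hex
    let K : ℕ → (Fin n → ℂ) → (Fin (2 * n) → ℂ) := fun m => Nat.rec K₀ (fun m K => K + Δ m K) m
    have hK : ∀ m, P m (K m) → E.IsStep ω (rhoSeq ρ₀ δ₀ m) (deltaSeq δ₀ m) (K m) (Δ m (K m))
        (K (m + 1)) := fun m hm => ⟨hΔ m _ hm, fun θ _ => rfl⟩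
    have hP : ∀ m, P m (K m) := fun m => by
      induction m with
      | zero => exact h0
      | succ m ih => exact hsucc m _ _ _ ih (hK m ih)
    exact ⟨K, rfl, fun m => ⟨_, hK m (hP m)⟩⟩
  · rintro K ⟨hK0, hK⟩ m
    induction m with
    | zero => rwa [hK0]
    | succ m ih =>
      obtain ⟨Δ, hΔ⟩ := hK m
      exact hsucc m _ _ _ ih hΔ

end System.Extension

theorem stepPolynomial_const_le {n : ℕ} {S : System n} {D : Set (Fin (2 * n) → ℂ)}
    {E : S.Extension D} {β x y z : ℝ} (hβ : 0 ≤ β) {ρ : ℝ}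
    {K : (Fin n → ℂ) → (Fin (2 * n) → ℂ)} (hx : stripNorm ρ (jac K) ≤ x)
    (hy : stripNorm ρ (invGram K) ≤ y) (hz : E.invAvg K ≤ z) :
    E.const (stepPolynomial β) ρ K ≤ (β * (1 + x + y + z)) ^ 150 := by
  have h1 : 0 ≤ stripNorm ρ (jac K) := stripNorm_nonneg
  have h2 : 0 ≤ stripNorm ρ (invGram K) := stripNorm_nonneg
  have h3 : 0 ≤ E.invAvg K := maxNorm_nonneg _
  rw [System.Extension.const, eval_stepPolynomial]
  exact pow_le_pow_left₀ (mul_nonneg hβ (by linarith))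
    (mul_le_mul_of_nonneg_left (by linarith) hβ) _

/-- A bound for the constants of all tori whose data are at most `x`, `y`, `z`. -/
theorem exists_stepPolynomial_const_le {β : ℝ} (hβ : 0 ≤ β) (n : ℕ) (x y z : ℝ) :
    ∃ c : ℝ, 0 < c ∧ ∀ (S : System n) (D : Set (Fin (2 * n) → ℂ)) (E : S.Extension D) (ρ : ℝ)
      (K : (Fin n → ℂ) → (Fin (2 * n) → ℂ)), stripNorm ρ (jac K) ≤ x →
      stripNorm ρ (invGram K) ≤ y → E.invAvg K ≤ z → E.const (stepPolynomial β) ρ K ≤ c :=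
  ⟨max 1 _, lt_max_of_lt_left one_pos, fun _ _ _ _ _ hx hy hz =>
    (stepPolynomial_const_le hβ hx hy hz).trans (le_max_right _ _)⟩

end QuasiNewton

open QuasiNewton in
theorem theorem5p1 (n : ℕ) (hn : 2 ≤ n) (σ : ℝ) (hσ : 1 ≤ σ) (ρ₀ r : ℝ) (hρ₀ : 0 < ρ₀)
    (hr : 0 < r) (bB bI bH : ℝ) :
    ∃ lam : MvPolynomial (Fin 3) ℝ, IsStepPolynomial n σ ρ₀ r bB bI bH lam ∧
    ∀ d ν s : ℝ, ∃ c : ℝ, 0 < c ∧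
    ∀ (S : System n) (K₀ : (Fin n → ℂ) → (Fin (2 * n) → ℂ)), S.MemP ρ₀ K₀ →
    (∀ x, toC x ∈ S.nbhd ρ₀ r K₀ → x ∈ S.U) →
    ∀ E : S.Extension (S.nbhd ρ₀ r K₀), E.NormBounds bB bI bH →
    ∀ (γ : ℝ) (ω : Fin n → ℝ), 0 < γ → γ ≤ 1 → IsDiophantine γ σ ω →
    E.NonDegenerate ρ₀ K₀ →
    BddOnStrip ρ₀ (jac K₀) → stripNorm ρ₀ (jac K₀) ≤ d →
    BddOnStrip ρ₀ (invGram K₀) → stripNorm ρ₀ (invGram K₀) ≤ ν →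
    E.invAvg K₀ ≤ s →
    ∀ δ₀ : ℝ, 0 < δ₀ → δ₀ < min (ρ₀ / 12) 1 →
    2 ^ (4 * σ) * c * γ ^ (-4 : ℝ) * δ₀ ^ (-(4 * σ)) * stripNorm ρ₀ (E.err ω K₀) ≤ 1 / 2 →
    (1 + 2 ^ (4 * σ) / (2 ^ (2 * σ) - 1)) * c * γ ^ (-2 : ℝ) * δ₀ ^ (-(2 * σ))
      * stripNorm ρ₀ (E.err ω K₀) < r →
    (∃ K, E.IsIteration ω ρ₀ δ₀ K₀ K) ∧
    ∀ K, E.IsIteration ω ρ₀ δ₀ K₀ K → ∀ m : ℕ, 1 ≤ m →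
      S.MemP (rhoSeq ρ₀ δ₀ (m - 1)) (K (m - 1)) ∧
      Set.MapsTo (K (m - 1)) (closedStrip n (rhoSeq ρ₀ δ₀ (m - 1))) (S.nbhd ρ₀ r K₀) ∧
      E.StepConditions lam σ γ ω r (rhoSeq ρ₀ δ₀ (m - 1)) (deltaSeq δ₀ (m - 1)) K₀ (K (m - 1)) ∧
      E.const lam (rhoSeq ρ₀ δ₀ (m - 1)) (K (m - 1)) ≤ c := by
  have hβ : 0 ≤ stepConst n σ bB bI bH := by unfold stepConst; positivity
  refine ⟨stepPolynomial (stepConst n σ bB bI bH), isStepPolynomial hσ, fun d ν s => ?_⟩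
  obtain ⟨c, hc, hcle⟩ := exists_stepPolynomial_const_le hβ n (d + 1) (ν + 1) (s + 1)
  refine ⟨c, hc, ?_⟩
  intro S K₀ hK₀ hU E hE γ ω hγ hγ1 hω hnd hbj hj hbN hN hs δ₀ hδ₀ hδ h31 h32
  have hstep := isStepPolynomial (n := n) (ρ₀ := ρ₀) (r := r) (bB := bB) (bI := bI) (bH := bH) hσ
  generalize stepPolynomial (stepConst n σ bB bI bH) = lam at hcle hstep ⊢
  obtain ⟨hδρ, hδ1⟩ := lt_min_iff.1 hδ
  have hT : (2 : ℝ) ^ (4 * σ) = (2 ^ σ) ^ 4 := by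
    rw [← Real.rpow_natCast, ← Real.rpow_mul zero_le_two, mul_comm]; norm_num
  have hT2 : (2 : ℝ) ^ (2 * σ) = (2 ^ σ) ^ 2 := by
    rw [← Real.rpow_natCast, ← Real.rpow_mul zero_le_two, mul_comm]; norm_num
  have hTσ : (2 : ℝ) ≤ 2 ^ σ := by
    simpa using Real.rpow_le_rpow_of_exponent_le (one_le_two : (1 : ℝ) ≤ 2) hσ
  have hε : 0 ≤ stripNorm ρ₀ (E.err ω K₀) := stripNorm_nonneg
  have hκ : (2 ^ σ) ^ 4 * (c * (lossFactor γ σ δ₀ ^ 4 *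
      stripNorm ρ₀ (E.err ω K₀))) ≤ 1 / 2 := by
    rw [mul_assoc _ (γ ^ (-4 : ℝ)), lossFactor_four hγ hδ₀, hT] at h31
    simpa only [mul_assoc] using h31
  set b := c * (lossFactor γ σ δ₀ ^ 2 * stripNorm ρ₀ (E.err ω K₀)) with hb
  have hb0 : 0 ≤ b := mul_nonneg hc.le (mul_nonneg (sq_nonneg _) hε)
  have hbr : 2 * b < r := by
    rw [mul_assoc _ (γ ^ (-2 : ℝ)), lossFactor_sq hγ hδ₀, hT, hT2,
      mul_assoc, mul_assoc, ← hb] at h32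
    refine lt_of_le_of_lt (mul_le_mul_of_nonneg_right ?_ hb0) h32
    -- the factor in the smallness condition is at least `2`
    have h1 : (0 : ℝ) < (2 ^ σ) ^ 2 - 1 := by nlinarith
    have h2 : 1 ≤ ((2 : ℝ) ^ σ) ^ 4 / ((2 ^ σ) ^ 2 - 1) := by
      rw [le_div_iff₀ h1]
      nlinarith [sq_nonneg (((2 : ℝ) ^ σ) ^ 2 - 1)]
    linarith
  have h0 := System.Extension.iterationInvariant_zero hE hr hK₀ hγ hγ1 hσ hδ₀ hδ1 hc.le hnd hbj hj
    hbN hN hs hκ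
  have hone : ∀ m K, E.IterationInvariant σ γ ω δ₀ c d ν s b m K →
      (∃ Δ, E.IsCorrection ω (rhoSeq ρ₀ δ₀ m) K Δ) ∧
      ∀ Δ K', E.IsStep ω (rhoSeq ρ₀ δ₀ m) (deltaSeq δ₀ m) K Δ K' →
        E.StepEstimates lam σ γ ω (rhoSeq ρ₀ δ₀ m) (deltaSeq δ₀ m) K Δ K' := fun m K hK =>
    hstep.2 S K₀ hK₀ hU E hE γ ω hγ hγ1 hω _ _ (rhoSeq_le hδ₀ m) (deltaSeq_pos hδ₀ m)
      ((deltaSeq_le hδ₀ m).trans_lt hδ1) (three_mul_deltaSeq_lt hδ₀ hδρ m) K hK.memP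
      (hK.stepConditions hγ hδ₀ (hcle S _ E) hb0 hbr)
  obtain ⟨hex, hall⟩ := System.Extension.exists_isIteration h0 (fun m K hK => (hone m K hK).1)
    fun m K Δ K' hK hs => hK.succ hγ hδ₀ (hcle S _ E) hσ hc.le hs ((hone m K hK).2 Δ K' hs)
  refine ⟨hex, fun K hK m _ => ?_⟩
  have h := hall K hK (m - 1)
  exact ⟨h.memP, h.mapsTo, h.stepConditions hγ hδ₀ (hcle S _ E) hb0 hbr, h.const_le (hcle S _ E)⟩
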